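/- Let $g\ge 0$ and $k\ge 2$ be integers with $2-2g-k<0$, let $S_{g,k}$ be the surface obtained from the closed orientable surface of genus $g$ by removing $k$ distinct points, and let $\Pi=\pi_1(S_{g,k})$, acting on the universal cover $\widetilde S_{g,k}$ by deck transformations. Let $\mathrm{Aff}(\mathbb C)=\{z\mapsto az+b : a\in\mathbb C^*,\ b\in\mathbb C\}$. A complex affine structure on $S_{g,k}$ is an atlas of charts to $\mathbb C$ whose transition maps are locally restrictions of elements of $\mathrm{Aff}(\mathbb C)$. A homomorphism $\rho:\Pi\to\mathrm{Aff}(\mathbb C)$ is the monodromy of such a structure if the structure has a developing map $f:\widetilde S_{g,k}\to\mathbb C$ (a map that is locally the composition of the covering projection with an affine chart) with $f(\gamma\cdot x)=\rho(\gamma)(f(x))$ for all $\gamma\in\Pi$ and $x\in\widetilde S_{g,k}$. Then every non-trivial homomorphism $\rho:\Pi\to\mathrm{Aff}(\mathbb C)$ is the monodromy of some complex affine structure on $S_{g,k}$. If $k\ge 3$, then every homomorphism $\rho:\Pi\to\mathrm{Aff}(\mathbb C)$, including the trivial one, is the monodromy of some complex affine structure on $S_{g,k}$. -/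

import Mathlib

open Topology Set

noncomputable section

/-! ### Surfaces -/

/-- The closed unit disc in `ℂ`, regarded as a polygon whose sides are arcs of the unit circle. -/
abbrev UnitDisc : Type := Metric.closedBall (0 : ℂ) 1

/-- The point at parameter `t` of the boundary of the disc, which is divided into `4 * g` equal
arcs: the `n`-th arc (`n = 0, …, 4 * g - 1`) consists of the points with `t ∈ [n, n + 1]`. -/
def boundaryPoint (g : ℕ) (t : ℝ) : UnitDisc :=
  ⟨Complex.exp ((2 * Real.pi * t / (4 * g) : ℝ) * Complex.I), by
    rw [mem_closedBall_zero_iff, Complex.norm_exp_ofReal_mul_I]⟩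

/-- The side identifications of the standard polygon of genus `g`.  For `g ≥ 1` it is the `4g`-gon
with boundary word `a₁ b₁ a₁⁻¹ b₁⁻¹ ⋯ a_g b_g a_g⁻¹ b_g⁻¹`: each of the sides `4j` and `4j + 1` is
glued to the second next side with its direction reversed.
For `g = 0` it is the bigon with boundary word `c c⁻¹`: the upper half of the circle is glued to
the lower half by complex conjugation. -/
inductive SideGluing (g : ℕ) : UnitDisc → UnitDisc → Prop
  | sphere (hg : g = 0) (z w : UnitDisc) (hz : ‖(z : ℂ)‖ = 1)
      (hw : (w : ℂ) = (starRingEnd ℂ) (z : ℂ)) : SideGluing g z w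
  | handle (j : ℕ) (hj : j < g) (i : ℕ) (hi : i < 2) (s : ℝ) (hs : s ∈ Icc (0 : ℝ) 1) :
      SideGluing g (boundaryPoint g (4 * j + i + s)) (boundaryPoint g (4 * j + i + 2 + (1 - s)))

/-- The closed orientable surface of genus `g`, as the quotient of the standard polygon. -/
def ClosedSurface (g : ℕ) : Type := Quot (SideGluing g)

instance (g : ℕ) : TopologicalSpace (ClosedSurface g) :=
  inferInstanceAs (TopologicalSpace (Quot (SideGluing g)))

/-- `S` is a surface `S_{g,k}` of genus `g` with `k` punctures: it is homeomorphic to the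
complement of `k` distinct points in the closed orientable surface of genus `g`. -/
def IsPuncturedSurface (g k : ℕ) (S : Type*) [TopologicalSpace S] : Prop :=
  ∃ P : Set (ClosedSurface g), P.encard = k ∧ Nonempty (S ≃ₜ ↥Pᶜ)

/-! ### Complex affine structures -/

/-- The group `Aff(ℂ)` of the maps `z ↦ a z + b` with `a ≠ 0`, under composition. -/
abbrev AffC : Type := ℂ ≃ᵃ[ℂ] ℂ

/-- `f` agrees near each point of `u` with an element of `Aff(ℂ)`. -/
def IsLocallyAffineOn (f : ℂ → ℂ) (u : Set ℂ) : Prop :=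
  ∀ x ∈ u, ∃ A : AffC, ∀ᶠ y in 𝓝[u] x, f y = A y

/-- The locally affine maps between open subsets of `ℂ`. -/
def affinePregroupoid : Pregroupoid ℂ where
  property := IsLocallyAffineOn
  comp := by
    intro f g u v hf hg hu hv huv x hx
    obtain ⟨A, hA⟩ := hf x hx.1
    obtain ⟨B, hB⟩ := hg (f x) hx.2
    refine ⟨B * A, ?_⟩
    rw [hu.nhdsWithin_eq hx.1] at hA
    rw [hv.nhdsWithin_eq hx.2] at hB
    rw [huv.nhdsWithin_eq hx]
    have hc : ContinuousAt f x :=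
      (A.toContinuousAffineEquiv.continuous.continuousAt).congr
        (hA.mono fun y hy => by simp [hy])
    filter_upwards [hA, hc.eventually hB] with y h1 h2
    simp only [Function.comp_apply, h2, AffineEquiv.mul_def, AffineEquiv.trans_apply]
    rw [h1]
  id_mem := fun x _ => ⟨1, by simp⟩
  locality := by
    intro f u hu h x hx
    obtain ⟨v, hv, hxv, hf⟩ := h x hx
    obtain ⟨A, hA⟩ := hf x ⟨hx, hxv⟩
    refine ⟨A, ?_⟩
    rwa [nhdsWithin_inter_of_mem' (mem_nhdsWithin_of_mem_nhds (hv.mem_nhds hxv))] at hA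
  congr := by
    intro f g u hu hfg hf x hx
    obtain ⟨A, hA⟩ := hf x hx
    refine ⟨A, ?_⟩
    filter_upwards [hA, self_mem_nhdsWithin] with y h1 h2
    rw [hfg y h2, h1]

/-- The homeomorphisms between open subsets of `ℂ` that are locally restrictions of elements
of `Aff(ℂ)`. -/
def affineGroupoid : StructureGroupoid ℂ := affinePregroupoid.groupoid

/-- A complex affine structure on `S`: an atlas of charts to open subsets of `ℂ` whose transition
maps are locally restrictions of elements of `Aff(ℂ)`. -/
structure ComplexAffineStructure (S : Type*) [TopologicalSpace S] where
  /-- The charts. -/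
  charts : ChartedSpace ℂ S
  /-- The transition maps are affine. -/
  affine : HasGroupoid S affineGroupoid

/-- The affine charts of a complex affine structure: all charts of its maximal atlas. -/
def ComplexAffineStructure.maximalAtlas {S : Type*} [TopologicalSpace S]
    (σ : ComplexAffineStructure S) : Set (OpenPartialHomeomorph S ℂ) :=
  letI := σ.charts
  StructureGroupoid.maximalAtlas S affineGroupoid

/-! ### Developing maps and monodromy -/

/-- The fundamental group of `S` at `x`, in which the product `α * β` is the class of the loop
that runs first through `α` and then through `β`.  (The product of Mathlib's `FundamentalGroup`
is in the opposite order.) -/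
abbrev LoopGroup (S : Type*) [TopologicalSpace S] (x : S) : Type _ :=
  (FundamentalGroup S x)ᵐᵒᵖ

section

variable {S E : Type*} [TopologicalSpace S] [TopologicalSpace E] {p : E → S}

/-- The homeomorphism `φ` of the covering space `E` is the deck transformation by which the class
`γ` acts: it covers the identity, and it takes the base point `e₀` to the end point of the lift
of `γ` that starts at `e₀`. -/
def IsDeckTransformationOf (hp : IsCoveringMap p) {x₀ : S} (e₀ : p ⁻¹' {x₀})
    (γ : LoopGroup S x₀) (φ : E ≃ₜ E) : Prop :=
  (∀ e : E, p (φ e) = p e) ∧ φ e₀ = hp.monodromy γ.unop.toPath e₀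

/-- `dev` is a developing map of the affine structure `σ` on `S`: a map on the universal cover
that is locally the composition of the covering projection with an affine chart. -/
def IsDevelopingMap (p : E → S) (σ : ComplexAffineStructure S) (dev : E → ℂ) : Prop :=
  ∀ e : E, ∃ c ∈ σ.maximalAtlas, p e ∈ c.source ∧ ∀ᶠ e' in 𝓝 e, dev e' = c (p e')

/-- `ρ` is the monodromy of the affine structure `σ` on `S`, for the universal cover `p : E → S`
with base point `e₀` over `x₀`: there is a developing map `dev` with
`dev (γ · e) = ρ γ (dev e)` for all `γ` in the fundamental group and all `e` in `E`. -/
def IsMonodromy (hp : IsCoveringMap p) {x₀ : S} (e₀ : p ⁻¹' {x₀})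
    (σ : ComplexAffineStructure S) (ρ : LoopGroup S x₀ →* AffC) : Prop :=
  ∃ dev : E → ℂ, IsDevelopingMap p σ dev ∧
    ∀ (γ : LoopGroup S x₀) (φ : E ≃ₜ E), IsDeckTransformationOf hp e₀ γ φ →
      ∀ e : E, dev (φ e) = ρ γ (dev e)

end

end

/-! The closed surface is a disc whose boundary sides are glued in pairs, and since a connected
surface is homogeneous, the punctures can be assumed to lie on the boundary circle and to include
all vertices.  The strip `(0, M) × [0, ∞)` then parametrizes the punctured surface: its open part is
the interior of the polygon, and its real axis minus finitely many points consists of the sides.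
Lifting the strip to the universal cover, an equivariant developing map is the same as an immersion
of the strip whose germs along paired sides are related by `ρ`.  On each interval between
consecutive punctures the germ may be prescribed as an arbitrary affine map `B`: a path of affine
maps from `B` to the identity, whose moving frame makes a full turn while its origin moves forward
fast enough, sweeps out an immersed tab over the interval that continues the identity above it. -/

noncomputable section

section LoopThrough

variable {X : Type*} [TopologicalSpace X] {x₀ x y z x' y' : X}

/-- The class of the loop that runs from `x₀` along `b` to `y = x` and returns along `a`. -/
def loopThrough (a : Path.Homotopic.Quotient x₀ x) (b : Path.Homotopic.Quotient x₀ y) (h : x = y) :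
    LoopGroup X x₀ :=
  MulOpposite.op (FundamentalGroup.fromPath (b.trans (a.cast rfl h.symm).symm))

lemma homotopicQuotient_trans_symm (a : Path.Homotopic.Quotient x y)
    (b : Path.Homotopic.Quotient y z) : (a.trans b).symm = b.symm.trans a.symm := by
  induction a using Path.Homotopic.Quotient.ind with | _ a
  induction b using Path.Homotopic.Quotient.ind with | _ b
  simp only [← Path.Homotopic.Quotient.mk_trans, ← Path.Homotopic.Quotient.mk_symm,
    Path.trans_symm]

lemma homotopicQuotient_symm_trans_cancel (a : Path.Homotopic.Quotient x y)
    (b : Path.Homotopic.Quotient y z) : a.symm.trans (a.trans b) = b := by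
  rw [← Path.Homotopic.Quotient.trans_assoc, Path.Homotopic.Quotient.symm_trans,
    Path.Homotopic.Quotient.refl_trans]

lemma homotopicQuotient_trans_symm_cancel (a : Path.Homotopic.Quotient x y)
    (b : Path.Homotopic.Quotient x z) : a.trans (a.symm.trans b) = b := by
  rw [← Path.Homotopic.Quotient.trans_assoc, Path.Homotopic.Quotient.trans_symm,
    Path.Homotopic.Quotient.refl_trans]

lemma loopThrough_mul (a : Path.Homotopic.Quotient x₀ x) (b : Path.Homotopic.Quotient x₀ y)
    (c : Path.Homotopic.Quotient x₀ z) (h : x = y) (h' : y = z) :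
    loopThrough b c h' * loopThrough a b h = loopThrough a c (h.trans h') := by
  subst h h'
  simp only [loopThrough, Path.Homotopic.Quotient.cast_rfl_rfl, ← MulOpposite.op_mul,
    FundamentalGroup.mul_def]
  exact congrArg MulOpposite.op ((Path.Homotopic.Quotient.trans_assoc ..).trans
    (congrArg c.trans (homotopicQuotient_symm_trans_cancel b a.symm)))

lemma loopThrough_refl (γ : Path.Homotopic.Quotient x₀ x₀) :
    loopThrough (.refl x₀) γ rfl = MulOpposite.op (FundamentalGroup.fromPath γ) :=
  congrArg (fun c => MulOpposite.op (FundamentalGroup.fromPath c))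
    (Path.Homotopic.Quotient.trans_refl γ)

lemma loopThrough_trans_trans (a : Path.Homotopic.Quotient x₀ x)
    (b : Path.Homotopic.Quotient x₀ y) (c : Path.Homotopic.Quotient y y') (h : x = y)
    (h' : x' = y') :
    loopThrough (a.trans (c.cast h h')) (b.trans c) h' = loopThrough a b h := by
  subst h h'
  simp only [loopThrough, Path.Homotopic.Quotient.cast_rfl_rfl, homotopicQuotient_trans_symm,
    Path.Homotopic.Quotient.trans_assoc, homotopicQuotient_trans_symm_cancel]

end LoopThrough

section DeckClass

variable {S E : Type*} [TopologicalSpace S] [TopologicalSpace E] [SimplyConnectedSpace E]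
  {p : E → S} (hp : IsCoveringMap p) {x₀ : S} (e₀ : p ⁻¹' {x₀})

/-- The common homotopy class of the projections to the base of the paths from `e₀` to `e` in a
simply connected covering space. -/
def projectedClass (e : E) : Path.Homotopic.Quotient x₀ (p e) :=
  ((Path.Homotopic.Quotient.mk (PathConnectedSpace.somePath e₀.1 e)).map
    ⟨p, hp.continuous⟩).cast e₀.2.symm rfl

/-- The element of the fundamental group whose deck transformation takes `e` to the point `e'` of
the same fibre.  Speaking of pairs of points in a fibre makes it unnecessary to construct deck
transformations. -/
def deckClass (e e' : E) (h : p e = p e') : LoopGroup S x₀ :=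
  loopThrough (projectedClass hp e₀ e) (projectedClass hp e₀ e') h

lemma deckClass_mul {e e' e'' : E} (h : p e = p e') (h' : p e' = p e'') :
    deckClass hp e₀ e' e'' h' * deckClass hp e₀ e e' h = deckClass hp e₀ e e'' (h.trans h') :=
  loopThrough_mul _ _ _ h h'

lemma deckClass_self (e : E) : deckClass hp e₀ e e rfl = 1 :=
  mul_eq_left.1 (deckClass_mul hp e₀ rfl rfl)

lemma projectedClass_eq_map {e : E} (Γ : Path.Homotopic.Quotient e₀.1 e) :
    projectedClass hp e₀ e = (Γ.map ⟨p, hp.continuous⟩).cast e₀.2.symm rfl := by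
  rw [Subsingleton.elim Γ]
  rfl

lemma projectedClass_eq_trans {e e' : E} (Γ : Path e e') :
    projectedClass hp e₀ e' = (projectedClass hp e₀ e).trans
      ((Path.Homotopic.Quotient.mk Γ).map ⟨p, hp.continuous⟩) := by
  obtain ⟨e₀, rfl⟩ := e₀
  rw [projectedClass_eq_map hp _ (Path.Homotopic.Quotient.mk
    ((PathConnectedSpace.somePath e₀ e).trans Γ)), ← Path.Homotopic.Quotient.mk_map, Path.map_trans,
    Path.Homotopic.Quotient.mk_trans]
  rfl

lemma deckClass_eq_of_paths {e e' d d' : E} (h : p e = p d) (h' : p e' = p d')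
    (Γ : Path e e') (Δ : Path d d') (hΓ : ∀ t, p (Γ t) = p (Δ t)) :
    deckClass hp e₀ e d h = deckClass hp e₀ e' d' h' := by
  have hmap : (Path.Homotopic.Quotient.mk Γ).map ⟨p, hp.continuous⟩ =
      ((Path.Homotopic.Quotient.mk Δ).map ⟨p, hp.continuous⟩).cast h h' := by
    rw [← Path.Homotopic.Quotient.mk_map, ← Path.Homotopic.Quotient.mk_map,
      ← Path.Homotopic.Quotient.mk_cast]
    exact congrArg _ (Path.ext (funext hΓ))
  rw [deckClass, deckClass, projectedClass_eq_trans hp e₀ Γ, projectedClass_eq_trans hp e₀ Δ, hmap]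
  exact (loopThrough_trans_trans ..).symm

lemma deckClass_eq_of_continuousOn {Y : Type*} [TopologicalSpace Y] {U : Set Y}
    (hU : IsPathConnected U) {f f' : Y → E} (hf : ContinuousOn f U) (hf' : ContinuousOn f' U)
    (h : ∀ y ∈ U, p (f y) = p (f' y)) {y y' : Y} (hy : y ∈ U) (hy' : y' ∈ U) :
    deckClass hp e₀ (f y) (f' y) (h y hy) = deckClass hp e₀ (f y') (f' y') (h y' hy') := by
  obtain ⟨γ, hγ⟩ := hU.joinedIn y hy y' hy'
  exact deckClass_eq_of_paths hp e₀ _ _ (γ.map' (hf.mono (range_subset_iff.2 hγ)))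
    (γ.map' (hf'.mono (range_subset_iff.2 hγ))) fun t => h _ (hγ t)

lemma deckClass_monodromy (γ : LoopGroup S x₀) :
    deckClass hp e₀ e₀ (hp.monodromy γ.unop.toPath e₀).1
      (e₀.2.trans (hp.monodromy γ.unop.toPath e₀).2.symm) = γ := by
  have loopThrough_cast : ∀ {x y : S} (c : Path.Homotopic.Quotient x₀ x₀) (hx : x = x₀)
      (hy : y = x₀), loopThrough ((Path.Homotopic.Quotient.refl x).cast hx.symm rfl)
        (c.cast rfl hy) (hx.trans hy.symm) = MulOpposite.op (FundamentalGroup.fromPath c) := by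
    rintro x _ c rfl rfl
    simpa only [Path.Homotopic.Quotient.cast_rfl_rfl] using loopThrough_refl c
  have hrefl := projectedClass_eq_map hp e₀ (Path.Homotopic.Quotient.refl e₀.1)
  have hlift := projectedClass_eq_map hp e₀ (hp.liftPathQuotient γ.unop.toPath e₀)
  rw [hp.map_liftPathQuotient] at hlift
  rw [deckClass, hrefl, hlift.trans (Path.Homotopic.Quotient.cast_cast _ _ _ _ _)]
  exact loopThrough_cast _ e₀.2 _

lemma IsDeckTransformationOf.deckClass_eq {γ : LoopGroup S x₀} {φ : E ≃ₜ E}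
    (hφ : IsDeckTransformationOf hp e₀ γ φ) (e : E) :
    deckClass hp e₀ e (φ e) (hφ.1 e).symm = γ :=
  calc deckClass hp e₀ e (φ e) (hφ.1 e).symm
    _ = deckClass hp e₀ e₀ (φ e₀) (hφ.1 e₀).symm :=
      deckClass_eq_of_continuousOn hp e₀ isPathConnected_univ continuousOn_id
        φ.continuous.continuousOn (fun y _ => (hφ.1 y).symm) (mem_univ e) (mem_univ e₀.1)
    _ = γ := by
      convert deckClass_monodromy hp e₀ γ
      exact hφ.2

/-- `dev` is equivariant under the deck transformations with respect to `ρ`. -/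
def IsDeckEquivariant (ρ : LoopGroup S x₀ →* AffC) (dev : E → ℂ) : Prop :=
  ∀ e e' (h : p e = p e'), dev e' = ρ (deckClass hp e₀ e e' h) (dev e)

/-- `dev` is the equivariant map with respect to `ρ` whose values along the map `f`, from the set
`T` to the covering space, are given by `F`. -/
def IsDeckExtension (ρ : LoopGroup S x₀ →* AffC) {Y : Type*} (T : Set Y) (f : Y → E) (F : Y → ℂ)
    (dev : E → ℂ) : Prop :=
  ∀ e, ∀ y ∈ T, ∀ h : p (f y) = p e, dev e = ρ (deckClass hp e₀ _ _ h) (F y)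

section

variable {Y : Type*} {T : Set Y} {f : Y → E} {F : Y → ℂ} {dev : E → ℂ}

lemma exists_isDeckExtension (hT : ∀ s, ∃ y ∈ T, p (f y) = s) (ρ : LoopGroup S x₀ →* AffC)
    (hF : ∀ y ∈ T, ∀ y' ∈ T, ∀ h : p (f y) = p (f y'), F y' = ρ (deckClass hp e₀ _ _ h) (F y)) :
    ∃ dev : E → ℂ, IsDeckExtension hp e₀ ρ T f F dev := by
  choose r hrT hr using hT
  refine ⟨fun e => ρ (deckClass hp e₀ _ _ (hr (p e))) (F (r (p e))), fun e y hy h => ?_⟩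
  have h' : p (f y) = p (f (r (p e))) := h.trans (hr (p e)).symm
  rw [← deckClass_mul hp e₀ h' (hr (p e)), map_mul, AffineEquiv.mul_def,
    AffineEquiv.trans_apply, ← hF y hy _ (hrT _)]

variable {hp e₀} {ρ : LoopGroup S x₀ →* AffC}

lemma IsDeckExtension.isDeckEquivariant (hdev : IsDeckExtension hp e₀ ρ T f F dev)
    (hT : ∀ s, ∃ y ∈ T, p (f y) = s) : IsDeckEquivariant hp e₀ ρ dev := by
  intro e e' h
  obtain ⟨y, hy, hye⟩ := hT (p e)
  rw [hdev e y hy hye, hdev e' y hy (hye.trans h), ← deckClass_mul hp e₀ hye h, map_mul,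
    AffineEquiv.mul_def, AffineEquiv.trans_apply]

lemma IsDeckExtension.apply_eq_of_continuousOn (hdev : IsDeckExtension hp e₀ ρ T f F dev)
    {Z : Type*} [TopologicalSpace Z] {U : Set Z} (hU : IsPathConnected U) {γ : Z → E} {y : Z → Y}
    (hγ : ContinuousOn γ U) (hfy : ContinuousOn (fun u => f (y u)) U) (hy : MapsTo y U T)
    (h : ∀ u ∈ U, p (f (y u)) = p (γ u)) {u u' : Z} (hu : u ∈ U) (hu' : u' ∈ U) :
    dev (γ u) = ρ (deckClass hp e₀ _ _ (h u' hu')) (F (y u)) := by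
  rw [hdev (γ u) (y u) (hy hu) (h u hu)]
  exact congrArg (fun l => ρ l (F (y u))) (deckClass_eq_of_continuousOn hp e₀ hU hfy hγ h hu hu')

end

end DeckClass

section Structure

variable {S E : Type*} [TopologicalSpace S] [TopologicalSpace E] {p : E → S} {dev : E → ℂ}

/-- The chart near `p e` of the affine structure developed by `dev`. -/
def developedChart (hp : IsLocalHomeomorph p) (hdev : IsLocalHomeomorph dev) (e : E) :
    OpenPartialHomeomorph S ℂ :=
  (hp.localInverseAt e).trans (hdev.localInverseAt e).symm

section

variable (hp : IsLocalHomeomorph p) (hdev : IsLocalHomeomorph dev) (e : E)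

lemma mem_developedChart_source : p e ∈ (developedChart hp hdev e).source := by
  simp [developedChart]

lemma developedChart_source_subset :
    (developedChart hp hdev e).source ⊆ (hp.localInverseAt e).source := by
  simp [developedChart]

lemma developedChart_apply (s : S) :
    developedChart hp hdev e s = dev (hp.localInverseAt e s) := by
  simp [developedChart]

lemma developedChart_symm_apply (w : ℂ) :
    (developedChart hp hdev e).symm w = p (hdev.localInverseAt e w) := by
  simp [developedChart]

lemma developedChart_target_subset :
    (developedChart hp hdev e).target ⊆ (hdev.localInverseAt e).source := by
  simp [developedChart]

lemma eventually_apply_developedChart : ∀ᶠ e' in 𝓝 e, dev e' = developedChart hp hdev e (p e') := by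
  filter_upwards [(hp.localInverseAt e).open_target.mem_nhds hp.self_mem_localInverseAt_target]
    with e' he'
  have hinv : hp.localInverseAt e (p e') = e' := by
    simpa using (hp.localInverseAt e).right_inv he'
  rw [developedChart_apply, hinv]

end

lemma locallyPathConnectedSpace_of_isLocalHomeomorph {X Y : Type*} [TopologicalSpace X]
    [TopologicalSpace Y] [LocallyPathConnectedSpace Y] {f : X → Y} (hf : IsLocalHomeomorph f) :
    LocallyPathConnectedSpace X :=
  letI : ChartedSpace Y X :=
    { atlas := range fun x => (hf.localInverseAt x).symm
      chartAt := fun x => (hf.localInverseAt x).symm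
      mem_chart_source := fun _ => hf.self_mem_localInverseAt_target
      chart_mem_atlas := fun x => mem_range_self x }
  ChartedSpace.locallyPathConnectedSpace Y X

lemma isLocallyAffineOn_developedChart [SimplyConnectedSpace E] (hp : IsCoveringMap p) {x₀ : S}
    (e₀ : p ⁻¹' {x₀}) (hdev : IsLocalHomeomorph dev) {ρ : LoopGroup S x₀ →* AffC}
    (hρ : IsDeckEquivariant hp e₀ ρ dev) (e e' : E) :
    IsLocallyAffineOn
      ((developedChart hp.isLocalHomeomorph hdev e).symm.trans
        (developedChart hp.isLocalHomeomorph hdev e'))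
      ((developedChart hp.isLocalHomeomorph hdev e).symm.trans
        (developedChart hp.isLocalHomeomorph hdev e')).source := by
  have hlh := hp.isLocalHomeomorph
  have := locallyPathConnectedSpace_of_isLocalHomeomorph hdev
  rintro z ⟨hz, hz'⟩
  replace hz := developedChart_target_subset _ _ _ hz
  rw [mem_preimage, OpenPartialHomeomorph.symm_symm, developedChart_symm_apply] at hz'
  let d := hdev.localInverseAt e
  let u := hlh.localInverseAt e'
  have hN : p ⁻¹' (developedChart hlh hdev e').source ∈ 𝓝 (d z) :=
    hp.continuous.continuousAt.preimage_mem_nhds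
      ((developedChart hlh hdev e').open_source.mem_nhds hz')
  obtain ⟨W, ⟨hW, hWc⟩, hWN⟩ := (path_connected_basis (d z)).mem_iff.1 hN
  have hWu : MapsTo p W u.source := fun n hn => developedChart_source_subset _ _ _ (hWN hn)
  have hcov : ∀ n ∈ W, p n = p (u (p n)) := fun n hn =>
    (hlh.apply_localInverseAt_of_mem (hWu hn)).symm
  have hcont : ContinuousOn (fun n => u (p n)) W :=
    u.continuousOn.comp hp.continuous.continuousOn hWu
  refine ⟨ρ (deckClass hp e₀ _ _ (hcov _ (mem_of_mem_nhds hW))),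
    Filter.Eventually.filter_mono nhdsWithin_le_nhds ?_⟩
  filter_upwards [(d.continuousAt hz).eventually hW, d.open_source.mem_nhds hz] with w hw hwt
  rw [OpenPartialHomeomorph.coe_trans, Function.comp_apply, developedChart_symm_apply,
    developedChart_apply, hρ _ _ (hcov _ hw), hdev.apply_localInverseAt_of_mem hwt]
  exact congrArg (fun γ => ρ γ w) (deckClass_eq_of_continuousOn hp e₀ hWc continuousOn_id hcont
    hcov hw (mem_of_mem_nhds hW))

/-- The affine structure on the base of a covering whose charts are the local branches of an
equivariant local homeomorphism `dev` on the covering space. -/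
def developedStructure [SimplyConnectedSpace E] (hp : IsCoveringMap p)
    (hsurj : Function.Surjective p) {x₀ : S} (e₀ : p ⁻¹' {x₀}) (hdev : IsLocalHomeomorph dev)
    {ρ : LoopGroup S x₀ →* AffC} (hρ : IsDeckEquivariant hp e₀ ρ dev) :
    ComplexAffineStructure S :=
  letI charts : ChartedSpace ℂ S :=
    { atlas := range (developedChart hp.isLocalHomeomorph hdev)
      chartAt := fun s => developedChart hp.isLocalHomeomorph hdev (hsurj s).choose
      mem_chart_source := fun s => by
        simpa only [(hsurj s).choose_spec] using
          mem_developedChart_source hp.isLocalHomeomorph hdev (hsurj s).choose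
      chart_mem_atlas := fun s => mem_range_self _ }
  { charts := charts
    affine := by
      constructor
      rintro _ _ ⟨e, rfl⟩ ⟨e', rfl⟩
      exact ⟨isLocallyAffineOn_developedChart hp e₀ hdev hρ e e',
        isLocallyAffineOn_developedChart hp e₀ hdev hρ e' e⟩ }

lemma isMonodromy_developedStructure [SimplyConnectedSpace E] (hp : IsCoveringMap p)
    (hsurj : Function.Surjective p) {x₀ : S} (e₀ : p ⁻¹' {x₀}) (hdev : IsLocalHomeomorph dev)
    {ρ : LoopGroup S x₀ →* AffC} (hρ : IsDeckEquivariant hp e₀ ρ dev) :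
    IsMonodromy hp e₀ (developedStructure hp hsurj e₀ hdev hρ) ρ := by
  refine ⟨dev, fun e => ⟨developedChart hp.isLocalHomeomorph hdev e, ?_,
    mem_developedChart_source .., eventually_apply_developedChart ..⟩, fun γ φ hφ e => ?_⟩
  · let _ := (developedStructure hp hsurj e₀ hdev hρ).charts
    have := (developedStructure hp hsurj e₀ hdev hρ).affine
    exact StructureGroupoid.subset_maximalAtlas _ (mem_range_self e)
  · rw [hρ e (φ e) (hφ.1 e).symm, hφ.deckClass_eq]

end Structure

section AffinePath

open Complex

/-- A path `s ↦ (z ↦ a s * z + c s)` of affine maps whose origin moves in the direction `I`.  As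
seen by the moving frame `a s`, it turns and dilates at the rate `κ s` and moves at the speed
`β s`. -/
structure AffinePath where
  /-- The linear parts. -/
  a : ℝ → ℂ
  /-- The images of the origin. -/
  c : ℝ → ℂ
  /-- The logarithmic derivative of the linear part. -/
  κ : ℝ → ℂ
  /-- The speed of the origin. -/
  β : ℝ → ℝ
  continuous_κ : Continuous κ
  continuous_β : Continuous β
  hasDerivAt_a : ∀ s, HasDerivAt a (κ s * a s) s
  hasDerivAt_c : ∀ s, HasDerivAt c (I * β s * a s) s
  a_ne_zero : ∀ s, a s ≠ 0

lemma exists_nonneg_integral_mul_exp_eq (w : ℂ) : ∃ φ : ℝ → ℝ, Continuous φ ∧ (∀ u, 0 ≤ φ u) ∧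
    ∫ u in (0 : ℝ)..1, φ u * exp (2 * Real.pi * I * u) = w := by
  have hpi : (Real.pi : ℂ) ≠ 0 := ofReal_ne_zero.2 Real.pi_ne_zero
  have integral_exp_eq_zero : ∀ n : ℕ, n ≠ 0 →
      ∫ u in (0 : ℝ)..1, exp (n * (2 * Real.pi * I) * u) = 0 := by
    intro n hn
    rw [integral_exp_mul_complex (by simp [hn, hpi]), ofReal_one, mul_one, exp_nat_mul_two_pi_mul_I]
    simp
  let φ : ℝ → ℝ := fun u => 2 * (‖w‖ + (w * exp (-(2 * Real.pi * I * u))).re)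
  have hφ : ∀ u : ℝ, φ u * exp (2 * Real.pi * I * u) =
      2 * ‖w‖ * exp ((1 : ℕ) * (2 * Real.pi * I) * u) + w +
        (starRingEnd ℂ) w * exp ((2 : ℕ) * (2 * Real.pi * I) * u) := by
    intro u
    have hre := re_eq_add_conj (w * exp (-(2 * Real.pi * I * u)))
    rw [map_mul, ← exp_conj] at hre
    simp only [map_neg, map_mul, map_ofNat, conj_ofReal, conj_I, mul_neg, neg_mul, neg_neg] at hre
    have hinv : exp (-(2 * Real.pi * I * u)) * exp (2 * Real.pi * I * u) = 1 := by
      rw [← exp_add, neg_add_cancel, exp_zero]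
    rw [mul_assoc ((2 : ℕ) : ℂ), exp_nat_mul]
    simp only [φ, Nat.cast_one, one_mul]
    push_cast
    rw [hre]
    linear_combination w * hinv
  refine ⟨φ, by fun_prop, fun u => ?_, ?_⟩
  · have hnorm : ‖w * exp (-(2 * Real.pi * I * u))‖ = ‖w‖ := by simp [norm_exp]
    have := (abs_le.1 (abs_re_le_norm (w * exp (-(2 * Real.pi * I * u))))).1
    simp only [φ]
    linarith
  · have hint : ∀ f : ℝ → ℂ, Continuous f → IntervalIntegrable f MeasureTheory.volume 0 1 :=
      fun f hf => hf.intervalIntegrable 0 1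
    simp_rw [hφ]
    rw [intervalIntegral.integral_add (hint _ (by fun_prop)) (hint _ (by fun_prop)),
      intervalIntegral.integral_add (hint _ (by fun_prop)) (hint _ (by fun_prop)),
      intervalIntegral.integral_const_mul, intervalIntegral.integral_const_mul,
      integral_exp_eq_zero 1 one_ne_zero, integral_exp_eq_zero 2 two_ne_zero]
    simp

/-- The linear parts `exp (ℓ * σ s + 2 * π * I * τ s)`, where `τ` falls from `1` to `0` on
`[0, 1 / 2]` and `σ` on `[1 / 2, 1]`. -/
def turningFrame (ℓ : ℂ) (s : ℝ) : ℂ :=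
  exp (ℓ * (1 - Real.smoothTransition (2 * s - 1) : ℝ) +
    2 * Real.pi * I * (1 - Real.smoothTransition (2 * s) : ℝ))

lemma hasDerivAt_smoothTransition (x : ℝ) :
    HasDerivAt Real.smoothTransition (deriv Real.smoothTransition x) x :=
  ((Real.smoothTransition.contDiff (n := 1)).differentiable one_ne_zero x).hasDerivAt

lemma continuous_deriv_smoothTransition : Continuous (deriv Real.smoothTransition) :=
  (Real.smoothTransition.contDiff (n := 1)).continuous_deriv le_rfl

lemma hasDerivAt_one_sub_smoothTransition (k s : ℝ) :
    HasDerivAt (fun s => 1 - Real.smoothTransition (2 * s - k))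
      (-(2 * deriv Real.smoothTransition (2 * s - k))) s := by
  have h := (hasDerivAt_smoothTransition (2 * s - k)).comp s
    (((hasDerivAt_id s).const_mul 2).sub_const k)
  exact (h.const_sub 1).congr_deriv (by ring)

lemma deriv_smoothTransition_of_one_lt {x : ℝ} (hx : 1 < x) :
    deriv Real.smoothTransition x = 0 := by
  have : Real.smoothTransition =ᶠ[𝓝 x] fun _ => 1 := by
    filter_upwards [lt_mem_nhds hx] with t ht
    exact Real.smoothTransition.one_of_one_le ht.le
  rw [this.deriv_eq, deriv_const]

lemma exists_hasDerivAt_turningFrame (ℓ : ℂ) : ∃ κ : ℝ → ℂ, Continuous κ ∧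
    ∀ s, HasDerivAt (turningFrame ℓ) (κ s * turningFrame ℓ s) s := by
  have := continuous_deriv_smoothTransition
  refine ⟨fun s => ℓ * (-(2 * deriv Real.smoothTransition (2 * s - 1)) : ℝ) +
    2 * Real.pi * I * (-(2 * deriv Real.smoothTransition (2 * s)) : ℝ), by fun_prop, fun s => ?_⟩
  have hτ := hasDerivAt_one_sub_smoothTransition 0 s
  simp only [sub_zero] at hτ
  exact (((hasDerivAt_one_sub_smoothTransition 1 s).ofReal_comp.const_mul ℓ).add
    (hτ.ofReal_comp.const_mul (2 * Real.pi * I : ℂ))).cexp.congr_deriv (mul_comm _ _)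

lemma continuous_turningFrame (ℓ : ℂ) : Continuous (turningFrame ℓ) := by
  have : Continuous Real.smoothTransition := Real.smoothTransition.continuous
  unfold turningFrame
  fun_prop

lemma turningFrame_zero (ℓ : ℂ) : turningFrame ℓ 0 = exp ℓ := by
  have h := Real.smoothTransition.zero_of_nonpos (x := -1) (by norm_num)
  simp [turningFrame, h, exp_add]

lemma turningFrame_one (ℓ : ℂ) : turningFrame ℓ 1 = 1 := by
  have h := Real.smoothTransition.one_of_one_le (x := 2) (by norm_num)
  norm_num [turningFrame, h]

/-- During the full turn made on `[0, 1 / 2]` the frame points in all directions, so moving forward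
at a suitable speed attains every displacement. -/
lemma exists_nonneg_integral_mul_turningFrame_eq (ℓ w : ℂ) :
    ∃ ψ : ℝ → ℝ, Continuous ψ ∧ (∀ s, 0 ≤ ψ s) ∧
      ∫ s in (0 : ℝ)..1, ψ s * turningFrame ℓ s = w := by
  obtain ⟨φ, hφ, hφ0, hint⟩ := exists_nonneg_integral_mul_exp_eq (exp (-ℓ) * w)
  have : Continuous Real.smoothTransition := Real.smoothTransition.continuous
  have := continuous_deriv_smoothTransition
  let τ : ℝ → ℝ := fun s => 1 - Real.smoothTransition (2 * s - 0)
  let τ' : ℝ → ℝ := fun s => -(2 * deriv Real.smoothTransition (2 * s - 0))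
  let G : ℝ → ℂ := fun u => φ u * exp (2 * Real.pi * I * u)
  have hG : Continuous G := by fun_prop
  have hframe : ∀ s, (-τ' s * φ (τ s) : ℝ) * turningFrame ℓ s =
      -exp ℓ * (τ' s • (G ∘ τ) s) := by
    intro s
    rcases le_or_gt s (1 / 2) with hs | hs
    · have h0 := Real.smoothTransition.zero_of_nonpos (x := 2 * s - 1) (by linarith)
      simp only [turningFrame, h0, G, τ, sub_zero, exp_add, Function.comp_apply, real_smul]
      push_cast
      ring_nf
    · have h0 := deriv_smoothTransition_of_one_lt (x := 2 * s - 0) (by linarith)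
      simp only [τ', h0]
      simp
  have hτ0 : τ 0 = 1 := by simp [τ]
  have hτ1 : τ 1 = 0 := by
    have h := Real.smoothTransition.one_of_one_le (x := 2) (by norm_num)
    simp [τ, h]
  refine ⟨fun s => -τ' s * φ (τ s), by fun_prop, fun s => mul_nonneg ?_ (hφ0 _), ?_⟩
  · have := Real.smoothTransition.monotone.deriv_nonneg (x := 2 * s - 0)
    simp only [τ']
    linarith
  · simp_rw [hframe]
    rw [intervalIntegral.integral_const_mul, intervalIntegral.integral_deriv_smul_comp
        (fun s _ => hasDerivAt_one_sub_smoothTransition 0 s) (by fun_prop) hG,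
      show 1 - Real.smoothTransition (2 * 0 - 0) = 1 from hτ0,
      show 1 - Real.smoothTransition (2 * 1 - 0) = 0 from hτ1,
      intervalIntegral.integral_symm, hint, neg_mul_neg, ← mul_assoc, ← exp_add, add_neg_cancel,
      exp_zero, one_mul]

lemma exists_affinePath {a₀ : ℂ} (ha₀ : a₀ ≠ 0) (c₀ c₁ : ℂ) {R : ℝ} (hR : 0 ≤ R) :
    ∃ γ : AffinePath, (∀ s ∈ Icc (0 : ℝ) 1, R * ‖γ.κ s‖ ≤ γ.β s) ∧
      γ.a 0 = a₀ ∧ γ.c 0 = c₀ ∧ γ.a 1 = 1 ∧ γ.c 1 = c₁ := by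
  obtain ⟨ℓ, rfl⟩ : ∃ ℓ, exp ℓ = a₀ := ⟨log a₀, exp_log ha₀⟩
  have ha := continuous_turningFrame ℓ
  obtain ⟨κ, hκ, hκa⟩ := exists_hasDerivAt_turningFrame ℓ
  obtain ⟨D, hD⟩ : ∃ D : ℝ, ∀ s ∈ Icc (0 : ℝ) 1, ‖κ s‖ ≤ D :=
    isCompact_Icc.exists_bound_of_continuousOn hκ.continuousOn
  obtain ⟨ψ, hψ, hψ0, hint⟩ := exists_nonneg_integral_mul_turningFrame_eq ℓ
    (-I * (c₁ - c₀) - R * D * ∫ s in (0 : ℝ)..1, turningFrame ℓ s)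
  have hv : Continuous fun s => I * (R * D + ψ s : ℝ) * turningFrame ℓ s := by fun_prop
  refine ⟨⟨turningFrame ℓ, fun s => c₀ + ∫ t in (0 : ℝ)..s, I * (R * D + ψ t : ℝ) *
    turningFrame ℓ t, κ, fun s => R * D + ψ s, hκ, by fun_prop, hκa, fun s => ?_,
    fun s => exp_ne_zero _⟩, fun s hs => ?_, turningFrame_zero ℓ, by simp, turningFrame_one ℓ, ?_⟩
  · exact (intervalIntegral.integral_hasDerivAt_right (hv.intervalIntegrable _ _)
      (hv.stronglyMeasurableAtFilter _ _) hv.continuousAt).const_add c₀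
  · exact (mul_le_mul_of_nonneg_left (hD s hs) hR).trans (le_add_of_nonneg_right (hψ0 s))
  · have hsplit : ∀ t : ℝ, I * (R * D + ψ t : ℝ) * turningFrame ℓ t =
        I * (R * D * turningFrame ℓ t + ψ t * turningFrame ℓ t) := fun t => by push_cast; ring
    simp_rw [hsplit]
    rw [intervalIntegral.integral_const_mul, intervalIntegral.integral_add
      (by apply Continuous.intervalIntegrable; fun_prop)
      (by apply Continuous.intervalIntegrable; fun_prop), intervalIntegral.integral_const_mul, hint]
    linear_combination -(c₁ - c₀) * I_sq

end AffinePath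

section Tab

open Complex

lemma affineEquiv_apply (B : AffC) (z : ℂ) : B z = B.linear 1 * z + B 0 := by
  have hlinear : B.linear z = B.linear 1 * z := by
    simpa only [smul_eq_mul, mul_one, mul_comm] using B.linear.map_smul z 1
  rw [← hlinear]
  simpa using B.map_vadd 0 z

lemma affineEquiv_linear_one_ne_zero (B : AffC) : B.linear 1 ≠ 0 :=
  fun h => one_ne_zero (B.linear.map_eq_zero_iff.1 h)

lemma injective_mul_add_mul {a V : ℂ} (ha : a ≠ 0) {d : ℂ →L[ℝ] ℝ} (hd : 0 ≤ d V)
    {L : ℂ →L[ℝ] ℂ} (hL : ∀ v, L v = a * (v + V * d v)) : Function.Injective L := by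
  rw [injective_iff_map_eq_zero]
  intro v hv
  rw [hL] at hv
  have hvV : v = -(d v) • V := by
    rw [real_smul]
    push_cast
    linear_combination (mul_eq_zero.1 hv).resolve_left ha
  have hdv : d v * (1 + d V) = 0 := by
    have h := congrArg d hvV
    rw [map_smul, smul_eq_mul] at h
    linarith
  have hdv0 : d v = 0 := (mul_eq_zero.1 hdv).resolve_right (by linarith)
  rw [hvV, hdv0, neg_zero, zero_smul]

namespace AffinePath

variable (γ : AffinePath)

lemma hasStrictDerivAt_a (s : ℝ) : HasStrictDerivAt γ.a (γ.κ s * γ.a s) s := by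
  have : Continuous γ.a := continuous_iff_continuousAt.2 fun s => (γ.hasDerivAt_a s).continuousAt
  have := γ.continuous_κ
  exact hasStrictDerivAt_of_hasDerivAt_of_continuousAt (.of_forall γ.hasDerivAt_a) (by fun_prop)

lemma hasStrictDerivAt_c (s : ℝ) : HasStrictDerivAt γ.c (I * γ.β s * γ.a s) s := by
  have : Continuous γ.a := continuous_iff_continuousAt.2 fun s => (γ.hasDerivAt_a s).continuousAt
  have := γ.continuous_β
  exact hasStrictDerivAt_of_hasDerivAt_of_continuousAt (.of_forall γ.hasDerivAt_c) (by fun_prop)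

/-- Evaluates the path at a time that depends on the point; `m` is the origin of the source. -/
def sweep (s : ℂ → ℝ) (m z : ℂ) : ℂ := γ.c (s z) + γ.a (s z) * (z - m)

/-- The velocity at time `s`, in the moving frame, of the point at displacement `v` from the
origin. -/
def velocity (s : ℝ) (v : ℂ) : ℂ := I * γ.β s + γ.κ s * v

lemma exists_injective_hasStrictFDerivAt_sweep {s : ℂ → ℝ} {d : ℂ →L[ℝ] ℝ} {m z : ℂ}
    (hs : HasStrictFDerivAt s d z) (hd : 0 ≤ d (γ.velocity (s z) (z - m))) :
    ∃ L : ℂ →L[ℝ] ℂ, Function.Injective L ∧ HasStrictFDerivAt (γ.sweep s m) L z := by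
  refine ⟨_, injective_mul_add_mul (γ.a_ne_zero (s z)) hd fun v => ?_,
    ((γ.hasStrictDerivAt_c _).hasStrictFDerivAt.comp z hs).add
      (((γ.hasStrictDerivAt_a _).hasStrictFDerivAt.comp z hs).mul
        ((hasStrictFDerivAt_id (𝕜 := ℝ) z).sub_const m))⟩
  simp [velocity]
  ring

lemma abs_re_velocity_le_im {s : ℝ} {v : ℂ} {R : ℝ} (hβ : 2 * R * ‖γ.κ s‖ ≤ γ.β s)
    (hv : ‖v‖ ≤ R) : |(γ.velocity s v).re| ≤ (γ.velocity s v).im := by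
  have hnorm : ‖γ.κ s * v‖ ≤ γ.β s / 2 := by
    rw [norm_mul]
    nlinarith [norm_nonneg (γ.κ s)]
  have hre := (abs_re_le_norm (γ.κ s * v)).trans hnorm
  have him := (abs_im_le_norm (γ.κ s * v)).trans hnorm
  have hre_eq : (γ.velocity s v).re = (γ.κ s * v).re := by simp [velocity]
  have him_eq : (γ.velocity s v).im = γ.β s + (γ.κ s * v).im := by simp [velocity]
  rw [hre_eq, him_eq]
  linarith [neg_abs_le (γ.κ s * v).im]

end AffinePath

/-- The upper boundary of the tab over `(l, r)`, a parabola of slope `1` at `l` and `-1` at `r`. -/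
def tabHeight (l r x : ℝ) : ℝ := (x - l) * (r - x) / (r - l)

variable {l r : ℝ}

lemma tabHeight_pos {x : ℝ} (hx : x ∈ Ioo l r) : 0 < tabHeight l r x :=
  div_pos (mul_pos (sub_pos.2 hx.1) (sub_pos.2 hx.2)) (sub_pos.2 (hx.1.trans hx.2))

lemma tabHeight_le_min {x : ℝ} (hx : x ∈ Ioo l r) : tabHeight l r x ≤ min (x - l) (r - x) := by
  have hl := sub_pos.2 hx.1
  have hr := sub_pos.2 hx.2
  rw [tabHeight, div_le_iff₀ (by linarith)]
  rcases min_cases (x - l) (r - x) with ⟨h, _⟩ | ⟨h, _⟩ <;> rw [h] <;> nlinarith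

lemma contDiff_tabHeight : ContDiff ℝ 1 (tabHeight l r) := by
  unfold tabHeight
  fun_prop

lemma exists_hasDerivAt_tabHeight {x : ℝ} (hx : x ∈ Ioo l r) :
    ∃ q, |q| ≤ 1 ∧ HasDerivAt (tabHeight l r) q x := by
  have hrl : 0 < r - l := sub_pos.2 (hx.1.trans hx.2)
  refine ⟨_, ?_, (((hasDerivAt_id x).sub_const l).mul
    ((hasDerivAt_id x).const_sub r)).div_const (r - l)⟩
  rw [abs_div, abs_of_pos hrl, div_le_one hrl, abs_le]
  constructor <;> simp only [id] <;> linarith [hx.1, hx.2]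

/-- The time at which an affine path is evaluated on the tab over `(l, r)`: it grows from `0` near
`(l, r)` to `1` near the upper boundary of the tab. -/
def tabTime (l r : ℝ) (z : ℂ) : ℝ :=
  Real.smoothTransition (3 * (z.im / tabHeight l r z.re) - 1)

lemma tabTime_mem_Icc (z : ℂ) : tabTime l r z ∈ Icc (0 : ℝ) 1 :=
  ⟨Real.smoothTransition.nonneg _, Real.smoothTransition.le_one _⟩

lemma tabTime_eq_one {z : ℂ} (hz : z.re ∈ Ioo l r) (h : 2 * tabHeight l r z.re ≤ 3 * z.im) :
    tabTime l r z = 1 := by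
  have : 2 / 3 ≤ z.im / tabHeight l r z.re := by
    rw [le_div_iff₀ (tabHeight_pos hz)]
    linarith
  exact Real.smoothTransition.one_of_one_le (by linarith)

lemma tabTime_eq_zero {z : ℂ} (hz : z.re ∈ Ioo l r) (h : 3 * z.im ≤ tabHeight l r z.re) :
    tabTime l r z = 0 := by
  have : z.im / tabHeight l r z.re ≤ 1 / 3 := by
    rw [div_le_iff₀ (tabHeight_pos hz)]
    linarith
  exact Real.smoothTransition.zero_of_nonpos (by linarith)

lemma contDiffAt_tabTime {z : ℂ} (hz : z.re ∈ Ioo l r) : ContDiffAt ℝ 1 (tabTime l r) z := by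
  have him : ContDiffAt ℝ 1 (fun z : ℂ => z.im) z := imCLM.contDiff.contDiffAt
  have hheight : ContDiffAt ℝ 1 (fun z : ℂ => tabHeight l r z.re) z :=
    (contDiff_tabHeight.comp reCLM.contDiff).contDiffAt
  exact Real.smoothTransition.contDiffAt.comp z
    ((contDiffAt_const.mul (him.div hheight (tabHeight_pos hz).ne')).sub contDiffAt_const)

lemma fderiv_tabTime_nonneg {z V : ℂ} (hz : z.re ∈ Ioo l r) (hz0 : 0 ≤ z.im)
    (hzh : z.im ≤ tabHeight l r z.re) (hV : |V.re| ≤ V.im) : 0 ≤ fderiv ℝ (tabTime l r) z V := by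
  have hpos := tabHeight_pos hz
  obtain ⟨q, hslope, hheight⟩ := exists_hasDerivAt_tabHeight hz
  have hderiv := (hasDerivAt_smoothTransition (3 * (z.im / tabHeight l r z.re) - 1)
    ).comp_hasFDerivAt z ((((imCLM.hasFDerivAt (x := z)).mul
      ((hasDerivAt_inv hpos.ne').comp_hasFDerivAt z (hheight.comp_hasFDerivAt z
        (reCLM.hasFDerivAt (x := z))))).const_mul 3).sub_const 1)
  rw [show fderiv ℝ (tabTime l r) z = _ from hderiv.fderiv]
  have hq : z.im * (q * V.re) ≤ tabHeight l r z.re * V.im := by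
    refine mul_le_mul_of_nonneg hzh ((le_abs_self _).trans ?_) hz0 ((abs_nonneg _).trans hV)
    rw [abs_mul]
    exact (mul_le_of_le_one_left (abs_nonneg _) hslope).trans hV
  have hquot : z.im * ((tabHeight l r z.re ^ 2)⁻¹ * (q * V.re)) ≤
      (tabHeight l r z.re)⁻¹ * V.im := by
    calc _ = (tabHeight l r z.re ^ 2)⁻¹ * (z.im * (q * V.re)) := by ring
      _ ≤ (tabHeight l r z.re ^ 2)⁻¹ * (tabHeight l r z.re * V.im) := by gcongr
      _ = (tabHeight l r z.re)⁻¹ * V.im := by field_simp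
  simpa using mul_le_mul_of_nonneg_left (mul_le_mul_of_nonneg_left hquot zero_le_three)
    (Real.smoothTransition.monotone.deriv_nonneg
      (x := 3 * (z.im / tabHeight l r z.re) - 1))

lemma exists_tab (hlr : l < r) (B : AffC) : ∃ F : ℂ → ℂ,
    (∀ z : ℂ, z.re ∈ Ioo l r → min (z.re - l) (r - z.re) ≤ z.im → F z = z) ∧
    (∀ x ∈ Ioo l r, ∀ᶠ z in 𝓝 (x : ℂ), F z = B z) ∧
    (∀ z : ℂ, z.re ∈ Ioo l r → 0 < z.im →
      ∃ L : ℂ →L[ℝ] ℂ, Function.Injective L ∧ HasStrictFDerivAt F L z) := by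
  set m : ℂ := (((l + r) / 2 : ℝ) : ℂ) with hm
  obtain ⟨γ, hγ, ha₀, hc₀, ha₁, hc₁⟩ := exists_affinePath (affineEquiv_linear_one_ne_zero B)
    (B m) m (R := 2 * (r - l)) (by linarith)
  have hcont : Continuous (tabHeight l r) := contDiff_tabHeight.continuous
  have eq_self : ∀ z, tabTime l r z = 1 → γ.sweep (tabTime l r) m z = z := fun z hz => by
    simp [AffinePath.sweep, hz, ha₁, hc₁]
  have eq_B : ∀ z, tabTime l r z = 0 → γ.sweep (tabTime l r) m z = B z := fun z hz => by
    rw [AffinePath.sweep, hz, ha₀, hc₀, affineEquiv_apply B z, affineEquiv_apply B m]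
    ring
  have eventually_re : ∀ z : ℂ, z.re ∈ Ioo l r → ∀ᶠ w : ℂ in 𝓝 z, w.re ∈ Ioo l r := fun z hz =>
    continuous_re.continuousAt.preimage_mem_nhds (isOpen_Ioo.mem_nhds hz)
  refine ⟨γ.sweep (tabTime l r) m, fun z hz hle => eq_self z (tabTime_eq_one hz ?_),
    fun x hx => ?_, fun z hz hz0 => ?_⟩
  · linarith [(tabHeight_le_min hz).trans hle, tabHeight_pos hz]
  · have hlow : ∀ᶠ z : ℂ in 𝓝 (x : ℂ), 3 * z.im < tabHeight l r z.re :=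
      ContinuousAt.eventually_lt (by fun_prop) (by fun_prop) (by simpa using tabHeight_pos hx)
    filter_upwards [hlow, eventually_re x (by simpa using hx)] with z hz hzre
    exact eq_B z (tabTime_eq_zero hzre hz.le)
  rcases lt_or_ge z.im (tabHeight l r z.re) with hlt | hge
  · refine γ.exists_injective_hasStrictFDerivAt_sweep
      ((contDiffAt_tabTime hz).hasStrictFDerivAt one_ne_zero)
      (fderiv_tabTime_nonneg hz hz0.le hlt.le
        (γ.abs_re_velocity_le_im (hγ _ (tabTime_mem_Icc z)) ?_))
    have hre : |(z - m).re| ≤ (r - l) / 2 := by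
      rw [hm, sub_re, ofReal_re, abs_le]
      constructor <;> linarith [hz.1, hz.2]
    have him : |(z - m).im| ≤ (r - l) / 2 := by
      rw [hm, sub_im, ofReal_im, sub_zero, abs_of_pos hz0]
      linarith [le_min_iff.1 (tabHeight_le_min hz)]
    linarith [norm_le_abs_re_add_abs_im (z - m)]
  · have hhigh : ∀ᶠ w : ℂ in 𝓝 z, 2 * tabHeight l r w.re < 3 * w.im :=
      ContinuousAt.eventually_lt (by fun_prop) (by fun_prop) (by linarith [tabHeight_pos hz])
    refine ⟨ContinuousLinearMap.id ℝ ℂ, Function.injective_id,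
      (hasStrictFDerivAt_id z).congr_of_eventuallyEq ?_⟩
    filter_upwards [hhigh, eventually_re z hz] with w hw hwre
    exact (eq_self w (tabTime_eq_one hwre hw.le)).symm

end Tab

section Gap

/-- The interval `(l, r)` is a bounded component of the complement of `Q`. -/
structure IsGap (Q : Set ℝ) (l r : ℝ) : Prop where
  left_mem : l ∈ Q
  right_mem : r ∈ Q
  lt : l < r
  disjoint : Disjoint Q (Ioo l r)

variable {Q : Set ℝ}

lemma exists_isGap (hQ : Q.Finite) {x a b : ℝ} (ha : a ∈ Q) (hb : b ∈ Q) (hx : x ∈ Ioo a b)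
    (hxQ : x ∉ Q) : ∃ l r, IsGap Q l r ∧ x ∈ Ioo l r := by
  obtain ⟨l, ⟨hl, hlx⟩, hlmax⟩ := exists_max_image (Q ∩ Iio x) id
    (hQ.subset inter_subset_left) ⟨a, ha, hx.1⟩
  obtain ⟨r, ⟨hr, hxr⟩, hrmin⟩ := exists_min_image (Q ∩ Ioi x) id
    (hQ.subset inter_subset_left) ⟨b, hb, hx.2⟩
  rw [mem_Iio] at hlx
  rw [mem_Ioi] at hxr
  refine ⟨l, r, ⟨hl, hr, hlx.trans hxr, disjoint_left.2 ?_⟩, hlx, hxr⟩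
  rintro q hq ⟨hlq, hqr⟩
  rcases lt_trichotomy q x with h | rfl | h
  · exact absurd (hlmax q ⟨hq, h⟩) (not_le.2 hlq)
  · exact hxQ hq
  · exact absurd (hrmin q ⟨hq, h⟩) (not_le.2 hqr)

lemma IsGap.left_le {l r l' r' x : ℝ} (h : IsGap Q l r) (h' : IsGap Q l' r')
    (hx : x ∈ Ioo l r) (hx' : x ∈ Ioo l' r') : l ≤ l' :=
  not_lt.1 fun hlt => disjoint_left.1 h'.disjoint h.left_mem ⟨hlt, hx.1.trans hx'.2⟩

lemma IsGap.le_right {l r l' r' x : ℝ} (h : IsGap Q l r) (h' : IsGap Q l' r')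
    (hx : x ∈ Ioo l r) (hx' : x ∈ Ioo l' r') : r ≤ r' :=
  not_lt.1 fun hlt => disjoint_left.1 h.disjoint h'.right_mem ⟨hx.1.trans hx'.2, hlt⟩

lemma IsGap.eq_and_eq {l r l' r' x : ℝ} (h : IsGap Q l r) (h' : IsGap Q l' r')
    (hx : x ∈ Ioo l r) (hx' : x ∈ Ioo l' r') : l = l' ∧ r = r' :=
  ⟨(h.left_le h' hx hx').antisymm (h'.left_le h hx' hx),
    (h.le_right h' hx hx').antisymm (h'.le_right h hx' hx)⟩

lemma exists_openPartialHomeomorph_of_injective {F : ℂ → ℂ} {L : ℂ →L[ℝ] ℂ} {z : ℂ}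
    (hL : Function.Injective L) (hF : HasStrictFDerivAt F L z) :
    ∃ e : OpenPartialHomeomorph ℂ ℂ, z ∈ e.source ∧ ∀ w, F w = e w := by
  let L' : ℂ ≃L[ℝ] ℂ := (LinearEquiv.ofInjectiveEndo L.toLinearMap hL).toContinuousLinearEquiv
  have hL' : (L' : ℂ →L[ℝ] ℂ) = L := by ext v; rfl
  rw [← hL'] at hF
  exact ⟨hF.toOpenPartialHomeomorph F, hF.mem_toOpenPartialHomeomorph_source, fun w => rfl⟩

open Classical in
/-- Replaces the identity by `T l r` over each gap `(l, r)` of `Q`. -/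
def overGaps (Q : Set ℝ) (T : ℝ → ℝ → ℂ → ℂ) (z : ℂ) : ℂ :=
  if h : ∃ lr : ℝ × ℝ, IsGap Q lr.1 lr.2 ∧ z.re ∈ Ioo lr.1 lr.2 then T h.choose.1 h.choose.2 z
  else z

lemma overGaps_of_mem {T : ℝ → ℝ → ℂ → ℂ} {l r : ℝ} {z : ℂ} (h : IsGap Q l r)
    (hz : z.re ∈ Ioo l r) : overGaps Q T z = T l r z := by
  have hex : ∃ lr : ℝ × ℝ, IsGap Q lr.1 lr.2 ∧ z.re ∈ Ioo lr.1 lr.2 := ⟨(l, r), h, hz⟩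
  obtain ⟨hl, hr⟩ := hex.choose_spec.1.eq_and_eq h hex.choose_spec.2 hz
  rw [overGaps, dif_pos hex, hl, hr]

lemma eventually_overGaps_eq {T : ℝ → ℝ → ℂ → ℂ} {l r : ℝ} {z : ℂ} (h : IsGap Q l r)
    (hz : z.re ∈ Ioo l r) : ∀ᶠ w in 𝓝 z, overGaps Q T w = T l r w := by
  filter_upwards [Complex.continuous_re.continuousAt.preimage_mem_nhds
    (isOpen_Ioo.mem_nhds hz)] with w hw using overGaps_of_mem h hw

lemma eventually_overGaps_eq_self {T : ℝ → ℝ → ℂ → ℂ}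
    (hT : ∀ l r, IsGap Q l r → ∀ z : ℂ, z.re ∈ Ioo l r → min (z.re - l) (r - z.re) ≤ z.im →
      T l r z = z) {z : ℂ} (hzQ : z.re ∈ Q) (hz0 : 0 < z.im) :
    ∀ᶠ w in 𝓝 z, overGaps Q T w = w := by
  have habove : ∀ᶠ w : ℂ in 𝓝 z, |w.re - z.re| < w.im :=
    ContinuousAt.eventually_lt (by fun_prop) (by fun_prop) (by simpa using hz0)
  filter_upwards [habove] with w hw
  by_cases h : ∃ lr : ℝ × ℝ, IsGap Q lr.1 lr.2 ∧ w.re ∈ Ioo lr.1 lr.2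
  · obtain ⟨⟨l, r⟩, hgap, hlr⟩ := h
    rw [overGaps_of_mem hgap hlr]
    refine hT l r hgap w hlr ?_
    rw [abs_lt] at hw
    by_contra! hlt
    rw [lt_min_iff] at hlt
    exact disjoint_left.1 hgap.disjoint hzQ ⟨by linarith, by linarith⟩
  · exact dif_neg h

lemma exists_immersion_halfPlane (B : ℝ → AffC)
    (hB : ∀ l r, IsGap Q l r → ∀ x ∈ Ioo l r, ∀ y ∈ Ioo l r, B x = B y) (hQ : Q.Finite) :
    ∃ F : ℂ → ℂ, (∀ a ∈ Q, ∀ b ∈ Q, ∀ x ∈ Ioo a b, x ∉ Q → ∀ᶠ z in 𝓝 (x : ℂ), F z = B x z) ∧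
      ∀ a ∈ Q, ∀ b ∈ Q, ∀ z : ℂ, z.re ∈ Ioo a b → 0 < z.im →
        ∃ e : OpenPartialHomeomorph ℂ ℂ, z ∈ e.source ∧ ∀ᶠ w in 𝓝 z, F w = e w := by
  choose! T hT_self hT_affine hT_deriv using
    fun l r (h : IsGap Q l r) => exists_tab h.lt (B ((l + r) / 2))
  refine ⟨overGaps Q T, fun a ha b hb x hx hxQ => ?_, fun a ha b hb z hz hz0 => ?_⟩
  · obtain ⟨l, r, hgap, hlr⟩ := exists_isGap hQ ha hb hx hxQ
    have hlt := hgap.lt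
    rw [hB l r hgap x hlr ((l + r) / 2) ⟨by linarith, by linarith⟩]
    filter_upwards [eventually_overGaps_eq (T := T) hgap (z := x) (by simpa using hlr),
      hT_affine l r hgap x hlr] with z hz hTz
    rw [hz, hTz]
  by_cases hzQ : z.re ∈ Q
  · exact ⟨.refl ℂ, mem_univ z, eventually_overGaps_eq_self hT_self hzQ hz0⟩
  · obtain ⟨l, r, hgap, hlr⟩ := exists_isGap hQ ha hb hz hzQ
    obtain ⟨L, hL, hTL⟩ := hT_deriv l r hgap z hlr hz0
    obtain ⟨e, he, hTe⟩ := exists_openPartialHomeomorph_of_injective hL hTL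
    exact ⟨e, he, (eventually_overGaps_eq hgap hlr).mono fun w hw => hw.trans (hTe w)⟩

end Gap

section Arc

/-- The point at parameter `t` of the boundary of the disc, divided into `M` equal arcs. -/
def arc (M : ℕ) (t : ℝ) : UnitDisc :=
  ⟨Complex.exp ((2 * Real.pi * t / M : ℝ) * Complex.I), by
    rw [mem_closedBall_zero_iff, Complex.norm_exp_ofReal_mul_I]⟩

/-- The vertices of the polygon with `M` sides. -/
def IsVertex (M : ℕ) (z : UnitDisc) : Prop := ∃ n : ℤ, z = arc M n

lemma boundaryPoint_eq_arc (g : ℕ) (t : ℝ) : boundaryPoint g t = arc (4 * g) t := by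
  simp [boundaryPoint, arc]

lemma norm_arc (M : ℕ) (t : ℝ) : ‖(arc M t : ℂ)‖ = 1 := Complex.norm_exp_ofReal_mul_I _

lemma continuous_arc (M : ℕ) : Continuous (arc M) := by
  apply Continuous.subtype_mk
  fun_prop

variable {M : ℕ}

lemma arc_eq_arc_iff (hM : 0 < M) {t t' : ℝ} :
    arc M t = arc M t' ↔ ∃ k : ℤ, t = t' + k * M := by
  have hM' : (M : ℝ) ≠ 0 := by positivity
  rw [Subtype.ext_iff]
  simp only [arc]
  rw [Complex.exp_eq_exp_iff_exists_int]
  refine exists_congr fun k => ?_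
  have hshift : (((2 * Real.pi * t' / M : ℝ) : ℂ) * Complex.I + k * (2 * Real.pi * Complex.I)) =
      ((2 * Real.pi * (t' + k * M) / M : ℝ) : ℂ) * Complex.I := by
    have : (M : ℂ) ≠ 0 := by exact_mod_cast hM'
    push_cast
    field_simp
  rw [hshift, mul_left_inj' Complex.I_ne_zero, Complex.ofReal_inj, div_left_inj' hM',
    mul_right_inj' Real.two_pi_pos.ne']

lemma exists_eq_arc (hM : 0 < M) {z : UnitDisc} (hz : ‖(z : ℂ)‖ = 1) :
    ∃ t ∈ Ico (0 : ℝ) M, z = arc M t := by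
  have hM' : (0 : ℝ) < M := by positivity
  obtain ⟨θ, hθ⟩ := (Complex.norm_eq_one_iff _).1 hz
  have hz_eq : z = arc M (M * θ / (2 * Real.pi)) := by
    apply Subtype.ext
    rw [← hθ]
    simp only [arc]
    congr 3
    have := Real.pi_ne_zero
    field_simp
  refine ⟨toIcoMod hM' 0 (M * θ / (2 * Real.pi)),
    by simpa using toIcoMod_mem_Ico hM' 0 (M * θ / (2 * Real.pi)),
    hz_eq.trans ((arc_eq_arc_iff hM).2 ⟨toIcoDiv hM' 0 (M * θ / (2 * Real.pi)), ?_⟩)⟩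
  rw [← zsmul_eq_mul]
  exact (toIcoMod_add_toIcoDiv_zsmul hM' 0 _).symm

lemma isVertex_arc_iff (hM : 0 < M) {t : ℝ} : IsVertex M (arc M t) ↔ ∃ k : ℤ, t = k := by
  constructor
  · rintro ⟨n, hn⟩
    obtain ⟨k, rfl⟩ := (arc_eq_arc_iff hM).1 hn
    exact ⟨n + k * M, by push_cast; ring⟩
  · rintro ⟨k, rfl⟩
    exact ⟨k, rfl⟩

lemma IsVertex.exists_lt_eq_arc (hM : 0 < M) {z : UnitDisc} (hz : IsVertex M z) :
    ∃ n < M, z = arc M n := by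
  obtain ⟨t, ht, rfl⟩ := exists_eq_arc hM (z := z) (by obtain ⟨n, rfl⟩ := hz; exact norm_arc M n)
  obtain ⟨k, rfl⟩ := (isVertex_arc_iff hM).1 hz
  lift k to ℕ using by exact_mod_cast ht.1
  exact ⟨k, by exact_mod_cast ht.2, by simp⟩

lemma eq_and_eq_of_arc_eq_arc {n n' : ℕ} {t t' : ℝ} (hn : n < M) (hn' : n' < M)
    (ht : t ∈ Icc (n : ℝ) (n + 1)) (ht' : t' ∈ Icc (n' : ℝ) (n' + 1)) (h : arc M t = arc M t')
    (hv : ¬IsVertex M (arc M t)) : n = n' ∧ t = t' := by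
  have hM : 0 < M := by lia
  obtain ⟨k, hk⟩ := (arc_eq_arc_iff hM).1 h
  rw [isVertex_arc_iff hM] at hv
  have hfloor : ⌊t⌋ = n := Int.floor_eq_iff.2
    ⟨ht.1, lt_of_le_of_ne ht.2 fun h => hv ⟨n + 1, by push_cast; exact h⟩⟩
  have hfloor' : ⌊t⌋ = n' + k * M := by
    refine Int.floor_eq_iff.2 ⟨by push_cast; linarith [ht'.1],
      lt_of_le_of_ne (by push_cast; linarith [ht'.2]) fun h => hv ⟨n' + k * M + 1, ?_⟩⟩
    rw [h]
    push_cast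
    ring
  have hk0 : k = 0 := by
    have hlt : k * M < 1 * M := by lia
    have hgt : -1 * M < k * M := by lia
    have hM' : (0 : ℤ) ≤ M := Int.natCast_nonneg M
    have := lt_of_mul_lt_mul_right hlt hM'
    have := lt_of_mul_lt_mul_right hgt hM'
    lia
  subst hk0
  exact ⟨by lia, by simpa using hk⟩

end Arc

section PolygonGluing

/-- The gluing of each side `n` of the polygon with `M` sides to the side `ν n` under reversal of
the direction.  If `V` holds, all vertices are identified. -/
def SideRel (M : ℕ) (ν : ℕ → ℕ) (V : Prop) (z w : UnitDisc) : Prop :=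
  z = w ∨ (∃ n < M, ∃ t ∈ Icc (n : ℝ) (n + 1), z = arc M t ∧ w = arc M (n + ν n + 1 - t)) ∨
    (V ∧ IsVertex M z ∧ IsVertex M w)

/-- The map `q` exhibits `X` as the space obtained from the polygon with `M` sides by the gluing
`SideRel`. -/
structure IsPolygonGluing {X : Type*} [TopologicalSpace X] (M : ℕ) (ν : ℕ → ℕ) (V : Prop)
    (q : UnitDisc → X) : Prop where
  pos : 0 < M
  isQuotientMap : IsQuotientMap q
  lt : ∀ n < M, ν n < M
  invol : ∀ n < M, ν (ν n) = n
  ne : ∀ n < M, ν n ≠ n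
  eq_iff : ∀ z w, q z = q w ↔ SideRel M ν V z w

variable {M : ℕ} {ν : ℕ → ℕ}

lemma SideRel.symm {V : Prop} (hlt : ∀ n < M, ν n < M) (hν : ∀ n < M, ν (ν n) = n)
    {z w : UnitDisc} (h : SideRel M ν V z w) : SideRel M ν V w z := by
  rcases h with rfl | ⟨n, hn, t, ht, rfl, rfl⟩ | ⟨hV, hz, hw⟩
  · exact Or.inl rfl
  · refine Or.inr (Or.inl ⟨ν n, hlt n hn, n + ν n + 1 - t, ⟨?_, ?_⟩, rfl, ?_⟩)
    · linarith [ht.2]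
    · linarith [ht.1]
    · rw [hν n hn]
      congr 1
      ring
  · exact Or.inr (Or.inr ⟨hV, hw, hz⟩)

lemma SideRel.isVertex {V : Prop} {z w : UnitDisc} (hM : 0 < M) (h : SideRel M ν V z w)
    (hz : IsVertex M z) : IsVertex M w := by
  rcases h with rfl | ⟨n, -, t, -, rfl, rfl⟩ | ⟨-, -, hw⟩
  · exact hz
  · obtain ⟨k, rfl⟩ := (isVertex_arc_iff hM).1 hz
    exact (isVertex_arc_iff hM).2 ⟨n + ν n + 1 - k, by push_cast; ring⟩
  · exact hw

lemma SideRel.eq_or_eq {V : Prop} {z w u : UnitDisc} (hν : ∀ n < M, ν (ν n) = n)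
    (hlt : ∀ n < M, ν n < M) (h : SideRel M ν V z w) (h' : SideRel M ν V w u)
    (hw : ¬IsVertex M w) : z = w ∨ w = u ∨ z = u := by
  rcases h with rfl | ⟨n, hn, t, ht, rfl, rfl⟩ | ⟨-, -, hw'⟩
  · exact Or.inl rfl
  · rcases h' with rfl | ⟨n', hn', t', ht', hw_eq, rfl⟩ | ⟨-, hw', -⟩
    · exact Or.inr (Or.inl rfl)
    · obtain ⟨rfl, rfl⟩ := eq_and_eq_of_arc_eq_arc (hlt n hn) hn'
        ⟨by linarith [ht.2], by linarith [ht.1]⟩ ht' hw_eq hw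
      refine Or.inr (Or.inr ?_)
      rw [hν n hn]
      congr 1
      ring
    · exact absurd hw' hw
  · exact absurd hw' hw

lemma equivalence_sideRel_true (hM : 0 < M) (hlt : ∀ n < M, ν n < M)
    (hν : ∀ n < M, ν (ν n) = n) : Equivalence (SideRel M ν True) where
  refl _ := Or.inl rfl
  symm := SideRel.symm hlt hν
  trans {z w u} h h' := by
    by_cases hw : IsVertex M w
    · exact Or.inr (Or.inr ⟨trivial, (h.symm hlt hν).isVertex hM hw, h'.isVertex hM hw⟩)
    · rcases h.eq_or_eq hν hlt h' hw with rfl | rfl | rfl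
      exacts [h', h, Or.inl rfl]

lemma quot_mk_eq_iff {α : Type*} {r R : α → α → Prop} (hR : Equivalence R)
    (hrR : ∀ a b, r a b → R a b) (hRr : ∀ a b, R a b → Quot.mk r a = Quot.mk r b) (a b : α) :
    Quot.mk r a = Quot.mk r b ↔ R a b :=
  ⟨fun h => hR.eqvGen_iff.1 (Relation.EqvGen.mono hrR _ _ (Quot.eqvGen_exact h)), hRr a b⟩

lemma arc_two_reflect {n : ℕ} (hn : n < 2) (t : ℝ) :
    (arc 2 (n + ((1 - n : ℕ) : ℝ) + 1 - t) : ℂ) = (starRingEnd ℂ) (arc 2 t) := by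
  have hsum : (n : ℝ) + ((1 - n : ℕ) : ℝ) + 1 - t = -t + (1 : ℤ) * (2 : ℕ) := by
    interval_cases n <;> norm_num <;> ring
  rw [(arc_eq_arc_iff two_pos).2 ⟨1, hsum⟩]
  simp only [arc, ← Complex.exp_conj, map_mul, Complex.conj_I, Complex.conj_ofReal]
  congr 1
  push_cast
  ring

lemma sideRel_two_iff {z w : UnitDisc} : SideRel 2 (fun n => 1 - n) False z w ↔
    z = w ∨ ‖(z : ℂ)‖ = 1 ∧ (w : ℂ) = (starRingEnd ℂ) (z : ℂ) := by
  constructor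
  · rintro (rfl | ⟨n, hn, t, -, rfl, rfl⟩ | ⟨h, -⟩)
    · exact Or.inl rfl
    · exact Or.inr ⟨norm_arc _ _, arc_two_reflect hn t⟩
    · exact h.elim
  · rintro (rfl | ⟨hz, hw⟩)
    · exact Or.inl rfl
    · obtain ⟨t, ht, rfl⟩ := exists_eq_arc two_pos hz
      have hlt : ⌊t⌋₊ < 2 := (Nat.floor_lt ht.1).2 ht.2
      refine Or.inr (Or.inl ⟨⌊t⌋₊, hlt, t, ⟨Nat.floor_le ht.1, (Nat.lt_floor_add_one t).le⟩, rfl,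
        Subtype.ext ?_⟩)
      rw [arc_two_reflect hlt, hw]

lemma isPolygonGluing_zero : IsPolygonGluing 2 (fun n => 1 - n) False
    (Quot.mk (SideGluing 0) : UnitDisc → ClosedSurface 0) where
  pos := two_pos
  isQuotientMap := isQuotientMap_quot_mk
  lt n _ := by lia
  invol n hn := by lia
  ne n _ := by lia
  eq_iff z w := by
    rw [sideRel_two_iff]
    refine quot_mk_eq_iff (R := fun z w : UnitDisc => z = w ∨ ‖(z : ℂ)‖ = 1 ∧
      (w : ℂ) = (starRingEnd ℂ) (z : ℂ)) ⟨fun _ => Or.inl rfl, ?_, ?_⟩ ?_ ?_ z w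
    · rintro z w (rfl | ⟨hz, hw⟩)
      · exact Or.inl rfl
      · exact Or.inr ⟨by rw [hw, RCLike.norm_conj, hz], by rw [hw, Complex.conj_conj]⟩
    · rintro z w u (rfl | ⟨hz, hw⟩) (rfl | ⟨hw', hu⟩)
      · exact Or.inl rfl
      · exact Or.inr ⟨hw', hu⟩
      · exact Or.inr ⟨hz, hw⟩
      · exact Or.inl (Subtype.ext (by rw [hu, hw, Complex.conj_conj]))
    · rintro _ _ (⟨_, z, w, hz, hw⟩ | ⟨j, hj, _⟩)
      · exact Or.inr ⟨hz, hw⟩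
      · exact absurd hj (Nat.not_lt_zero _)
    · rintro z w (rfl | ⟨hz, hw⟩)
      · rfl
      · exact Quot.sound (SideGluing.sphere rfl z w hz hw)

/-- The side to which the side `n` of the standard polygon of positive genus is glued. -/
def partner (n : ℕ) : ℕ := if n % 4 < 2 then n + 2 else n - 2

lemma partner_lt {g n : ℕ} (hn : n < 4 * g) : partner n < 4 * g := by
  unfold partner
  split_ifs <;> lia

lemma partner_partner (n : ℕ) : partner (partner n) = n := by
  unfold partner
  split_ifs <;> lia

lemma partner_ne (n : ℕ) : partner n ≠ n := by
  unfold partner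
  split_ifs <;> lia

lemma partner_four_mul_add (j : ℕ) {i : ℕ} (hi : i < 2) : partner (4 * j + i) = 4 * j + i + 2 := by
  unfold partner
  rw [if_pos (by lia)]

lemma partner_four_mul_add_two_add (j : ℕ) {i : ℕ} (hi : i < 2) :
    partner (4 * j + 2 + i) = 4 * j + i := by
  unfold partner
  rw [if_neg (by lia)]
  lia

variable {g : ℕ}

lemma quot_mk_arc_eq {n : ℕ} (hn : n < 4 * g) {t : ℝ} (ht : t ∈ Icc (n : ℝ) (n + 1)) :
    (Quot.mk (SideGluing g) (arc (4 * g) t) : ClosedSurface g) =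
      Quot.mk (SideGluing g) (arc (4 * g) (n + partner n + 1 - t)) := by
  have handle : ∀ j < g, ∀ i : ℕ, i < 2 → ∀ s ∈ Icc (0 : ℝ) 1,
      (Quot.mk (SideGluing g) (arc (4 * g) (4 * j + i + s)) : ClosedSurface g) =
        Quot.mk (SideGluing g) (arc (4 * g) (4 * j + i + 2 + (1 - s))) := fun j hj i hi s hs => by
    simpa only [boundaryPoint_eq_arc] using Quot.sound (SideGluing.handle j hj i hi s hs)
  obtain ⟨j, i, hi, rfl | rfl⟩ : ∃ j i, i < 2 ∧ (n = 4 * j + i ∨ n = 4 * j + 2 + i) :=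
    ⟨n / 4, n % 4 % 2, by lia, by lia⟩
  · rw [partner_four_mul_add j hi]
    push_cast at ht ⊢
    convert handle j (by lia) i hi (t - (4 * j + i))
      ⟨by linarith [ht.1], by linarith [ht.2]⟩ using 3 <;> ring
  · rw [partner_four_mul_add_two_add j hi, eq_comm]
    push_cast at ht ⊢
    convert handle j (by lia) i hi (4 * j + i + 3 - t)
      ⟨by linarith [ht.2], by linarith [ht.1]⟩ using 3 <;> ring

/-- The corners of the handle `j` are glued in the order `4j, 4j + 3, 4j + 2, 4j + 1, 4j + 4`. -/
lemma quot_mk_eq_of_isVertex (hg : 0 < g) {z : UnitDisc} (hz : IsVertex (4 * g) z) :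
    (Quot.mk (SideGluing g) z : ClosedSurface g) = Quot.mk (SideGluing g) (arc (4 * g) 0) := by
  let f : ℕ → ClosedSurface g := fun n => Quot.mk (SideGluing g) (arc (4 * g) n)
  have start : ∀ {n}, n < 4 * g → f n = f (partner n + 1) := fun {n} hn => by
    refine (quot_mk_arc_eq hn ⟨le_rfl, by linarith⟩).trans ?_
    simp only [f]
    congr 2
    push_cast
    ring
  have finish : ∀ {n}, n < 4 * g → f (n + 1) = f (partner n) := fun {n} hn => by
    have h := quot_mk_arc_eq hn (t := n + 1) ⟨by linarith, le_rfl⟩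
    simp only [f]
    push_cast
    rw [h]
    congr 2
    ring
  have hcorner : ∀ j < g, f (4 * j + 3) = f (4 * j) ∧ f (4 * j + 2) = f (4 * j) ∧
      f (4 * j + 1) = f (4 * j) ∧ f (4 * (j + 1)) = f (4 * j) := by
    intro j hj
    have hpartner := partner_four_mul_add j (i := 0) two_pos
    have hpartner' := partner_four_mul_add j (i := 1) one_lt_two
    have h₃ := start (n := 4 * j) (by lia)
    have h₂ := finish (n := 4 * j + 1) (by lia)
    have h₁ := finish (n := 4 * j) (by lia)
    have h₄ := start (n := 4 * j + 1) (by lia)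
    rw [add_zero] at hpartner
    rw [hpartner] at h₃ h₁
    rw [hpartner'] at h₂ h₄
    exact ⟨h₃.symm, h₂.trans h₃.symm, h₁.trans (h₂.trans h₃.symm),
      h₄.symm.trans (h₁.trans (h₂.trans h₃.symm))⟩
  have hstart : ∀ j ≤ g, f (4 * j) = f 0 := by
    intro j
    induction j with
    | zero => exact fun _ => rfl
    | succ j ih => exact fun hj => (hcorner j hj).2.2.2.trans (ih (by lia))
  obtain ⟨n, hn, rfl⟩ := hz.exists_lt_eq_arc (by lia)
  obtain ⟨j, i, hi, rfl⟩ : ∃ j i, i < 4 ∧ n = 4 * j + i := ⟨n / 4, n % 4, by lia, by lia⟩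
  have hj : j < g := by lia
  have hf0 : f 0 = Quot.mk (SideGluing g) (arc (4 * g) 0) :=
    congrArg (fun t => Quot.mk (SideGluing g) (arc (4 * g) t)) Nat.cast_zero
  refine Eq.trans (?_ : f (4 * j + i) = f (4 * j)) ((hstart j hj.le).trans hf0)
  interval_cases i
  exacts [rfl, (hcorner j hj).2.2.1, (hcorner j hj).2.1, (hcorner j hj).1]

lemma sideRel_of_sideGluing (hg : 0 < g) {z w : UnitDisc} (h : SideGluing g z w) :
    SideRel (4 * g) partner True z w := by
  rcases h with ⟨hg0, _⟩ | ⟨j, hj, i, hi, s, hs⟩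
  · exact absurd hg0 hg.ne'
  · refine Or.inr (Or.inl ⟨4 * j + i, by lia, 4 * j + i + s, ⟨?_, ?_⟩,
      boundaryPoint_eq_arc _ _, ?_⟩)
    · push_cast
      linarith [hs.1]
    · push_cast
      linarith [hs.2]
    · rw [boundaryPoint_eq_arc, partner_four_mul_add j hi]
      congr 1
      push_cast
      ring

lemma isPolygonGluing_of_pos (hg : 0 < g) : IsPolygonGluing (4 * g) partner True
    (Quot.mk (SideGluing g) : UnitDisc → ClosedSurface g) where
  pos := by lia
  isQuotientMap := isQuotientMap_quot_mk
  lt _ := partner_lt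
  invol n _ := partner_partner n
  ne n _ := partner_ne n
  eq_iff := by
    refine quot_mk_eq_iff (equivalence_sideRel_true (by lia) (fun _ => partner_lt)
      fun n _ => partner_partner n) (fun _ _ => sideRel_of_sideGluing hg) ?_
    rintro z w (rfl | ⟨n, hn, t, ht, rfl, rfl⟩ | ⟨-, hz, hw⟩)
    · rfl
    · exact quot_mk_arc_eq hn ht
    · rw [quot_mk_eq_of_isVertex hg hz, quot_mk_eq_of_isVertex hg hw]

end PolygonGluing

section DiscChart

variable {X : Type*} [TopologicalSpace X]

lemma continuousOn_image_of_isCompact {A Y : Type*} [TopologicalSpace A] [TopologicalSpace Y]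
    [T2Space X] {K : Set A} (hK : IsCompact K) {V : A → X} (hV : ContinuousOn V K) {f : X → Y}
    (hf : ContinuousOn (f ∘ V) K) : ContinuousOn f (V '' K) := by
  rw [continuousOn_iff_isClosed]
  intro t ht
  obtain ⟨u, hu, hut⟩ := continuousOn_iff_isClosed.1 hf t ht
  refine ⟨V '' (K ∩ u), ((hK.inter_right hu).image_of_continuousOn
    (hV.mono inter_subset_left)).isClosed, ?_⟩
  ext x
  constructor
  · rintro ⟨hx, a, ha, rfl⟩
    have hau : a ∈ u ∩ K := hut ▸ (⟨hx, ha⟩ : a ∈ f ∘ V ⁻¹' t ∩ K)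
    exact ⟨⟨a, ⟨ha, hau.1⟩, rfl⟩, a, ha, rfl⟩
  · rintro ⟨⟨a, ⟨ha, hau⟩, rfl⟩, haV⟩
    have hat : a ∈ f ∘ V ⁻¹' t ∩ K := hut ▸ (⟨hau, ha⟩ : a ∈ u ∩ K)
    exact ⟨hat.1, haV⟩

/-- The map `V` restricts to an embedding of the closed unit disc whose restriction to the open
unit disc is an open embedding. -/
structure IsDiscChart (V : ℂ → X) : Prop where
  continuousOn : ContinuousOn V (Metric.closedBall 0 1)
  injOn : InjOn V (Metric.closedBall 0 1)
  isOpen : IsOpen (V '' Metric.ball 0 1)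

open Classical in
/-- The self-map of `X` that is given by `h` in a disc chart and is the identity elsewhere. -/
def discExtend (V : ℂ → X) (h : ℂ → ℂ) (x : X) : X :=
  if x ∈ V '' Metric.ball 0 1 then V (h (Function.invFunOn V (Metric.closedBall 0 1) x)) else x

omit [TopologicalSpace X] in
lemma discExtend_of_notMem {V : ℂ → X} {h : ℂ → ℂ} {x : X} (hx : x ∉ V '' Metric.ball 0 1) :
    discExtend V h x = x := if_neg hx

lemma mapsTo_closedBall_of_eq_self (h : ℂ ≃ₜ ℂ) (hh : ∀ z, 1 ≤ ‖z‖ → h z = z) :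
    MapsTo h (Metric.closedBall 0 1) (Metric.closedBall 0 1) := by
  intro z hz
  rw [mem_closedBall_zero_iff] at hz ⊢
  by_contra! hlt
  have hfix : h z = z := h.injective (hh _ hlt.le)
  rw [hfix] at hlt
  exact hlt.not_ge hz

namespace IsDiscChart

variable {V : ℂ → X}

lemma isOpen_image [T2Space X] (hV : IsDiscChart V) {W : Set ℂ} (hW : IsOpen W)
    (hWb : W ⊆ Metric.ball 0 1) : IsOpen (V '' W) := by
  have himage : V '' W = V '' Metric.ball 0 1 ∩ (V '' (Metric.closedBall 0 1 \ W))ᶜ := by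
    ext x
    constructor
    · rintro ⟨a, ha, rfl⟩
      refine ⟨⟨a, hWb ha, rfl⟩, ?_⟩
      rintro ⟨b, ⟨hb, hbW⟩, hab⟩
      exact hbW (hV.injOn hb (Metric.ball_subset_closedBall (hWb ha)) hab ▸ ha)
    · rintro ⟨⟨a, ha, rfl⟩, hx⟩
      by_contra haW
      exact hx ⟨a, ⟨Metric.ball_subset_closedBall ha, fun h => haW ⟨a, h, rfl⟩⟩, rfl⟩
  rw [himage]
  exact hV.isOpen.inter (((isCompact_closedBall 0 1).diff hW).image_of_continuousOn
    (hV.continuousOn.mono sdiff_subset)).isClosed.isOpen_compl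

lemma comp_mul [T2Space X] (hV : IsDiscChart V) {r : ℝ} (hr : 0 < r) (hr1 : r ≤ 1) :
    IsDiscChart fun z => V (r * z) := by
  have hnorm : ∀ z : ℂ, ‖(r : ℂ) * z‖ = r * ‖z‖ := fun z => by
    rw [norm_mul, Complex.norm_of_nonneg hr.le]
  have hmaps : MapsTo (fun z : ℂ => (r : ℂ) * z) (Metric.closedBall 0 1)
      (Metric.closedBall 0 1) := fun z hz => by
    rw [mem_closedBall_zero_iff] at hz ⊢
    rw [hnorm]
    exact mul_le_one₀ hr1 (norm_nonneg z) hz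
  have hrC : (r : ℂ) ≠ 0 := by exact_mod_cast hr.ne'
  refine ⟨hV.continuousOn.comp (by fun_prop) hmaps, fun z hz w hw h =>
    mul_left_cancel₀ hrC (hV.injOn (hmaps hz) (hmaps hw) h), ?_⟩
  rw [show (fun z : ℂ => V (r * z)) = V ∘ (fun z : ℂ => r * z) from rfl, image_comp]
  refine hV.isOpen_image ((Homeomorph.mulLeft₀ _ hrC).isOpenMap _ Metric.isOpen_ball) ?_
  rintro _ ⟨z, hz, rfl⟩
  rw [mem_ball_zero_iff] at hz ⊢
  rw [hnorm]
  exact mul_lt_one_of_nonneg_of_lt_one_right hr1 (norm_nonneg z) hz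

lemma exists_subset [T2Space X] (hV : IsDiscChart V) {U : Set X} (hU : IsOpen U) (h0 : V 0 ∈ U) :
    ∃ V' : ℂ → X, IsDiscChart V' ∧ V' 0 = V 0 ∧ V' '' Metric.closedBall 0 1 ⊆ U := by
  have hnhds : V ⁻¹' U ∈ 𝓝 (0 : ℂ) :=
    (hV.continuousOn.continuousAt (Metric.closedBall_mem_nhds 0 one_pos)).preimage_mem_nhds
      (hU.mem_nhds h0)
  obtain ⟨ε, hε, hball⟩ := Metric.mem_nhds_iff.1 hnhds
  obtain ⟨r, hr0, hr⟩ := exists_between (lt_min hε one_pos)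
  rw [lt_min_iff] at hr
  refine ⟨fun z => V (r * z), hV.comp_mul hr0 hr.2.le, by simp, ?_⟩
  rintro _ ⟨z, hz, rfl⟩
  apply hball
  rw [mem_closedBall_zero_iff] at hz
  rw [mem_ball_zero_iff, norm_mul, Complex.norm_of_nonneg hr0.le]
  exact (mul_le_of_le_one_right hr0.le hz).trans_lt hr.1

lemma discExtend_apply (hV : IsDiscChart V) {h : ℂ → ℂ} (hh : ∀ z, 1 ≤ ‖z‖ → h z = z) {z : ℂ}
    (hz : z ∈ Metric.closedBall (0 : ℂ) 1) : discExtend V h (V z) = V (h z) := by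
  unfold discExtend
  split_ifs with hmem
  · rw [hV.injOn.leftInvOn_invFunOn hz]
  · rw [hh]
    by_contra! hlt
    exact hmem ⟨z, mem_ball_zero_iff.2 hlt, rfl⟩

lemma continuous_discExtend [T2Space X] (hV : IsDiscChart V) (h : ℂ ≃ₜ ℂ)
    (hh : ∀ z, 1 ≤ ‖z‖ → h z = z) : Continuous (discExtend V h) := by
  have hclosed : ContinuousOn (discExtend V h) (V '' Metric.closedBall 0 1) :=
    continuousOn_image_of_isCompact (isCompact_closedBall 0 1) hV.continuousOn
      ((hV.continuousOn.comp h.continuous.continuousOn (mapsTo_closedBall_of_eq_self h hh)).congr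
        fun z hz => hV.discExtend_apply hh hz)
  have hcompl : ContinuousOn (discExtend V h) (V '' Metric.ball 0 1)ᶜ :=
    continuousOn_id.congr fun x hx => discExtend_of_notMem hx
  have hcover : V '' Metric.closedBall 0 1 ∪ (V '' Metric.ball 0 1)ᶜ = univ :=
    eq_univ_of_forall fun x => (em (x ∈ V '' Metric.ball 0 1)).imp
      (fun hx => image_mono Metric.ball_subset_closedBall hx) id
  rw [← continuousOn_univ, ← hcover]
  exact hclosed.union_of_isClosed hcompl
    ((isCompact_closedBall 0 1).image_of_continuousOn hV.continuousOn).isClosed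
    hV.isOpen.isClosed_compl

lemma leftInverse_discExtend (hV : IsDiscChart V) (h : ℂ ≃ₜ ℂ) {k : ℂ → ℂ}
    (hh : ∀ z, 1 ≤ ‖z‖ → h z = z) (hk : ∀ z, 1 ≤ ‖z‖ → k z = z) (hkh : Function.LeftInverse k h) :
    Function.LeftInverse (discExtend V k) (discExtend V h) := by
  intro x
  by_cases hx : x ∈ V '' Metric.ball 0 1
  · obtain ⟨z, hz, rfl⟩ := hx
    have hz' := Metric.ball_subset_closedBall hz
    rw [hV.discExtend_apply hh hz', hV.discExtend_apply hk (mapsTo_closedBall_of_eq_self h hh hz'),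
      hkh]
  · rw [discExtend_of_notMem hx, discExtend_of_notMem hx]

end IsDiscChart

end DiscChart

section Homogeneity

lemma exists_homeomorph_disc {b : ℂ} (hb : ‖b‖ < 1) :
    ∃ h : ℂ ≃ₜ ℂ, h 0 = b ∧ ∀ z, 1 ≤ ‖z‖ → h z = z := by
  -- The displacement `max (1 - ‖z‖) 0 * b` is a contraction.
  let f : ℂ → ℂ := fun z => z + (max (1 - ‖z‖) 0 : ℝ) * b
  have hf : ApproximatesLinearOn f ((ContinuousLinearEquiv.refl ℝ ℂ : ℂ ≃L[ℝ] ℂ) : ℂ →L[ℝ] ℂ) univ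
      ‖b‖₊ := by
    intro x _ y _
    have hdiff : f x - f y - ((ContinuousLinearEquiv.refl ℝ ℂ : ℂ ≃L[ℝ] ℂ) : ℂ →L[ℝ] ℂ) (x - y) =
        ((max (1 - ‖x‖) 0 - max (1 - ‖y‖) 0 : ℝ) : ℂ) * b := by
      simp [f]
      ring
    rw [hdiff, norm_mul, Complex.norm_real, mul_comm, coe_nnnorm]
    refine mul_le_mul_of_nonneg_left ?_ (norm_nonneg _)
    calc ‖max (1 - ‖x‖) 0 - max (1 - ‖y‖) 0‖ ≤ |1 - ‖x‖ - (1 - ‖y‖)| :=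
          abs_max_sub_max_le_abs _ _ 0
      _ = |‖y‖ - ‖x‖| := by ring_nf
      _ ≤ ‖x - y‖ := norm_sub_rev x y ▸ abs_norm_sub_norm_le y x
  have hid : ‖(((ContinuousLinearEquiv.refl ℝ ℂ).symm : ℂ ≃L[ℝ] ℂ) : ℂ →L[ℝ] ℂ)‖₊ = 1 :=
    NNReal.coe_injective ContinuousLinearMap.norm_id
  refine ⟨hf.toHomeomorph f (Or.inr ?_), ?_, fun z hz => ?_⟩
  · rw [hid, inv_one]
    exact_mod_cast hb
  · change f 0 = b
    simp [f]
  · change f z = z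
    simp only [f]
    rw [max_eq_right (by linarith), Complex.ofReal_zero, zero_mul, add_zero]

variable {X : Type*} [TopologicalSpace X] [T2Space X]

lemma IsDiscChart.exists_homeomorph {V : ℂ → X} (hV : IsDiscChart V) {b : ℂ}
    (hb : b ∈ Metric.ball (0 : ℂ) 1) :
    ∃ H : X ≃ₜ X, H (V 0) = V b ∧ ∀ x, x ∉ V '' Metric.ball 0 1 → H x = x := by
  obtain ⟨h, h0, hh⟩ := exists_homeomorph_disc (mem_ball_zero_iff.1 hb)
  have hh' : ∀ z, 1 ≤ ‖z‖ → h.symm z = z := fun z hz => by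
    rw [Homeomorph.symm_apply_eq, hh z hz]
  refine ⟨⟨⟨discExtend V h, discExtend V h.symm,
    hV.leftInverse_discExtend h hh hh' h.symm_apply_apply,
    hV.leftInverse_discExtend h.symm hh' hh h.apply_symm_apply⟩, hV.continuous_discExtend h hh,
    hV.continuous_discExtend h.symm hh'⟩, ?_, fun x hx => discExtend_of_notMem hx⟩
  change discExtend V h (V 0) = V b
  rw [hV.discExtend_apply hh (by simp), h0]

variable (hch : ∀ x : X, ∃ V, IsDiscChart V ∧ V 0 = x)
  (hconn : ∀ F : Set X, F.Finite → IsPreconnected Fᶜ)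

include hch hconn

lemma exists_homeomorph_apply_eq {F : Set X} (hF : F.Finite) {x y : X} (hx : x ∉ F) (hy : y ∉ F) :
    ∃ H : X ≃ₜ X, H x = y ∧ ∀ f ∈ F, H f = f := by
  refine (hconn F hF).induction₂ (fun x y => ∃ H : X ≃ₜ X, H x = y ∧ ∀ f ∈ F, H f = f)
    ?_ ?_ ?_ hx hy
  · intro x hx
    obtain ⟨V, hV, rfl⟩ := hch x
    obtain ⟨V', hV', h0, hsub⟩ := hV.exists_subset hF.isClosed.isOpen_compl hx
    apply Filter.Eventually.filter_mono nhdsWithin_le_nhds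
    filter_upwards [hV'.isOpen.mem_nhds ⟨0, by simp, h0⟩]
    rintro _ ⟨b, hb, rfl⟩
    obtain ⟨H, hH0, hH⟩ := hV'.exists_homeomorph hb
    exact ⟨H, by rw [← h0, hH0], fun f hf => hH f fun h =>
      hsub (image_mono Metric.ball_subset_closedBall h) hf⟩
  · rintro x y z - - - ⟨H, rfl, hH⟩ ⟨K, rfl, hK⟩
    exact ⟨H.trans K, rfl, fun f hf => by rw [Homeomorph.trans_apply, hH f hf, hK f hf]⟩
  · rintro x y - - ⟨H, rfl, hH⟩
    exact ⟨H.symm, by simp, fun f hf => by rw [Homeomorph.symm_apply_eq, hH f hf]⟩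

lemma exists_homeomorph_image_eq_of_encard_eq {A B : Set X} (hA : A.Finite)
    (hAB : A.encard = B.encard) : ∃ H : X ≃ₜ X, H '' A = B := by
  induction A, hA using Set.Finite.induction_on generalizing B with
  | empty =>
    rw [encard_empty] at hAB
    rw [encard_eq_zero.1 hAB.symm]
    exact ⟨Homeomorph.refl X, by simp⟩
  | @insert a A ha hA ih =>
    rw [encard_insert_of_notMem ha] at hAB
    obtain ⟨b, hb⟩ : B.Nonempty := by
      rw [← encard_pos, ← hAB]
      simp
    have hcard : A.encard = (B \ {b}).encard := by
      rw [← encard_sdiff_singleton_add_one hb] at hAB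
      exact ENat.add_left_injective_of_ne_top (by simp) hAB
    obtain ⟨H, hH⟩ := ih hcard
    have hHa : H a ∉ B \ {b} := by
      rwa [← hH, H.injective.mem_set_image]
    obtain ⟨K, hK, hKfix⟩ := exists_homeomorph_apply_eq hch hconn (hH ▸ hA.image H) hHa (y := b)
      (by simp)
    have hKB : K '' (B \ {b}) = B \ {b} :=
      (image_congr hKfix).trans (image_id' _)
    refine ⟨H.trans K, ?_⟩
    change K ∘ H '' insert a A = B
    rw [image_comp, image_insert_eq, hH, image_insert_eq, hK, hKB,
      insert_sdiff_singleton, insert_eq_of_mem hb]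

end Homogeneity

section GluingTopology

lemma t2Space_of_isClosedMap {A X : Type*} [TopologicalSpace A] [TopologicalSpace X] [T4Space A]
    {q : A → X} (hclosed : IsClosedMap q) (hcont : Continuous q)
    (hsurj : Function.Surjective q) : T2Space X := by
  have hsingleton : ∀ x : X, IsClosed ({x} : Set X) := fun x => by
    obtain ⟨z, rfl⟩ := hsurj x
    rw [← image_singleton]
    exact hclosed _ isClosed_singleton
  refine ⟨fun x y hxy => ?_⟩
  obtain ⟨U, W, hU, hW, hxU, hyW, hUW⟩ := normal_separation ((hsingleton x).preimage hcont)
    ((hsingleton y).preimage hcont) ((disjoint_singleton.2 hxy).preimage q)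
  refine ⟨kernImage q U, kernImage q W, isClosedMap_iff_kernImage.1 hclosed hU,
    isClosedMap_iff_kernImage.1 hclosed hW, fun z hz => hxU hz, fun z hz => hyW hz, ?_⟩
  rw [disjoint_left]
  intro w hwU hwW
  obtain ⟨z, rfl⟩ := hsurj w
  exact disjoint_left.1 hUW (hwU rfl) (hwW rfl)

lemma finite_isVertex {M : ℕ} (hM : 0 < M) : {z | IsVertex M z}.Finite := by
  refine ((Set.finite_Iio M).image fun n : ℕ => arc M n).subset fun z hz => ?_
  obtain ⟨n, hn, rfl⟩ := IsVertex.exists_lt_eq_arc hM hz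
  exact ⟨n, hn, rfl⟩

lemma dense_norm_lt_one : Dense {z : UnitDisc | ‖(z : ℂ)‖ < 1} := by
  have himage : ((↑) : UnitDisc → ℂ) '' {z : UnitDisc | ‖(z : ℂ)‖ < 1} = Metric.ball 0 1 := by
    ext z
    rw [mem_ball_zero_iff]
    exact ⟨by rintro ⟨z, hz, rfl⟩; exact hz,
      fun hz => ⟨⟨z, mem_closedBall_zero_iff.2 hz.le⟩, hz, rfl⟩⟩
  rw [Subtype.dense_iff, himage, closure_ball _ one_ne_zero]

/-- The parametrization of the open disc by the plane. -/
def planeToDisc (w : ℂ) : UnitDisc :=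
  ⟨OpenPartialHomeomorph.univUnitBall w, Metric.ball_subset_closedBall
    (OpenPartialHomeomorph.univUnitBall.map_source (mem_univ w))⟩

lemma continuous_planeToDisc : Continuous planeToDisc :=
  Continuous.subtype_mk (continuousOn_univ.1 OpenPartialHomeomorph.univUnitBall.continuousOn) _

lemma injective_planeToDisc : Function.Injective planeToDisc := fun _ _ h =>
  OpenPartialHomeomorph.univUnitBall.injOn (mem_univ _) (mem_univ _) (congrArg Subtype.val h)

lemma range_planeToDisc : range planeToDisc = {z : UnitDisc | ‖(z : ℂ)‖ < 1} := by
  ext z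
  constructor
  · rintro ⟨w, rfl⟩
    exact mem_ball_zero_iff.1 (OpenPartialHomeomorph.univUnitBall.map_source (mem_univ w))
  · intro hz
    exact ⟨OpenPartialHomeomorph.univUnitBall.symm z, Subtype.ext
      (OpenPartialHomeomorph.univUnitBall.right_inv (mem_ball_zero_iff.2 hz))⟩

namespace IsPolygonGluing

variable {X : Type*} [TopologicalSpace X] {M : ℕ} {ν : ℕ → ℕ} {V : Prop} {q : UnitDisc → X}

lemma preimage_image (h : IsPolygonGluing M ν V q) (C : Set UnitDisc) :
    q ⁻¹' (q '' C) = C ∪ (⋃ n ∈ Finset.range M,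
      (fun t : ℝ => arc M (n + ν n + 1 - t)) '' (Icc (n : ℝ) (n + 1) ∩ arc M ⁻¹' C)) ∪
      {w | V ∧ IsVertex M w ∧ ∃ z ∈ C, IsVertex M z} := by
  ext w
  simp only [mem_preimage, mem_image, mem_union, mem_iUnion, Finset.mem_range, mem_inter_iff,
    mem_ofPred_eq]
  constructor
  · rintro ⟨z, hz, hzw⟩
    rcases (h.eq_iff z w).1 hzw with rfl | ⟨n, hn, t, ht, rfl, rfl⟩ | ⟨hV, hvz, hvw⟩
    · exact Or.inl (Or.inl hz)
    · exact Or.inl (Or.inr ⟨n, hn, t, ⟨ht, hz⟩, rfl⟩)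
    · exact Or.inr ⟨hV, hvw, z, hz, hvz⟩
  · rintro ((hw | ⟨n, hn, t, ⟨ht, hz⟩, rfl⟩) | ⟨hV, hvw, z, hz, hvz⟩)
    · exact ⟨w, hw, rfl⟩
    · exact ⟨_, hz, (h.eq_iff _ _).2 (Or.inr (Or.inl ⟨n, hn, t, ht, rfl, rfl⟩))⟩
    · exact ⟨z, hz, (h.eq_iff _ _).2 (Or.inr (Or.inr ⟨hV, hvz, hvw⟩))⟩

lemma isClosedMap (h : IsPolygonGluing M ν V q) : IsClosedMap q := by
  intro C hC
  rw [← h.isQuotientMap.isClosed_preimage, h.preimage_image]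
  refine (hC.union (isClosed_biUnion_finset fun n _ => IsCompact.isClosed ?_)).union ?_
  · exact (isCompact_Icc.inter_right (hC.preimage (continuous_arc M))).image
      ((continuous_arc M).comp (by fun_prop))
  · exact ((finite_isVertex h.pos).subset fun w hw => hw.2.1).isClosed

lemma t2Space (h : IsPolygonGluing M ν V q) : T2Space X :=
  t2Space_of_isClosedMap h.isClosedMap h.isQuotientMap.continuous h.isQuotientMap.surjective

lemma eq_of_norm_lt (h : IsPolygonGluing M ν V q) {z w : UnitDisc} (hz : ‖(z : ℂ)‖ < 1)
    (hzw : q z = q w) : z = w := by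
  rcases (h.eq_iff z w).1 hzw with heq | ⟨n, -, t, -, rfl, -⟩ | ⟨-, ⟨n, rfl⟩, -⟩
  · exact heq
  · exact absurd hz (norm_arc M t).not_lt
  · exact absurd hz (norm_arc M n).not_lt

lemma isPreconnected_compl (h : IsPolygonGluing M ν V q) {F : Set X} (hF : F.Finite) :
    IsPreconnected Fᶜ := by
  have hcont : Continuous (q ∘ planeToDisc) :=
    h.isQuotientMap.continuous.comp continuous_planeToDisc
  have hinj : Function.Injective (q ∘ planeToDisc) := fun w w' hw =>
    injective_planeToDisc (h.eq_of_norm_lt (range_planeToDisc.subset ⟨w, rfl⟩) hw)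
  have hdense : DenseRange (q ∘ planeToDisc) := by
    refine h.isQuotientMap.surjective.denseRange.comp ?_ h.isQuotientMap.continuous
    rw [DenseRange, range_planeToDisc]
    exact dense_norm_lt_one
  have hcountable : ((q ∘ planeToDisc) ⁻¹' F).Countable := (hF.preimage hinj.injOn).countable
  have hrank : 1 < Module.rank ℝ ℂ := by rw [Complex.rank_real_complex]; norm_num
  refine ((hcountable.isConnected_compl_of_one_lt_rank hrank).isPreconnected.image _
    hcont.continuousOn).subset_closure (image_subset_iff.2 subset_rfl) ?_
  rw [(hdense.dense_image hcont (hcountable.dense_compl ℝ)).closure_eq]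
  exact subset_univ _

end IsPolygonGluing

end GluingTopology

section CyclicGluing

lemma exists_injOn_of_eq_iff {A X Y : Type*} [TopologicalSpace A] [Nonempty A]
    [TopologicalSpace X] [TopologicalSpace Y] [T2Space Y] {K : Set A} (hK : IsCompact K)
    {p : A → Y} {W : A → X} (hp : ContinuousOn p K) (hW : ContinuousOn W K)
    (hpW : ∀ k ∈ K, ∀ k' ∈ K, W k = W k' ↔ p k = p k') :
    ∃ V : Y → X, ContinuousOn V (p '' K) ∧ InjOn V (p '' K) ∧ ∀ k ∈ K, V (p k) = W k := by
  have hV : ∀ k ∈ K, W (Function.invFunOn p K (p k)) = W k := fun k hk =>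
    (hpW _ (Function.invFunOn_mem ⟨k, hk, rfl⟩) k hk).2 (Function.invFunOn_eq ⟨k, hk, rfl⟩)
  refine ⟨W ∘ Function.invFunOn p K, continuousOn_image_of_isCompact hK hp (hW.congr hV), ?_, hV⟩
  rintro _ ⟨k, hk, rfl⟩ _ ⟨k', hk', rfl⟩ h
  exact (hpW k hk k' hk').1 ((hV k hk).symm.trans (h.trans (hV k' hk')))

/-- The closed upper half disc without the right half of its diameter. -/
def cutHalfDisc : Set ℂ := {x | ‖x‖ ≤ 1 ∧ 0 ≤ x.im ∧ (x.im = 0 → x.re ≤ 0)}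

lemma circleMap_mem_cutHalfDisc {ρ s : ℝ} (hρ : ρ ∈ Icc (0 : ℝ) 1) (hs : s ∈ Ico (0 : ℝ) 1) :
    circleMap 0 ρ (Real.pi * (1 - s)) ∈ cutHalfDisc := by
  have him : (circleMap 0 ρ (Real.pi * (1 - s))).im = ρ * Real.sin (Real.pi * s) := by
    rw [circleMap_zero_im, mul_sub, mul_one, Real.sin_pi_sub]
  have hre : (circleMap 0 ρ (Real.pi * (1 - s))).re = -(ρ * Real.cos (Real.pi * s)) := by
    rw [circleMap_zero_re, mul_sub, mul_one, Real.cos_pi_sub, mul_neg]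
  have hpi := Real.pi_pos
  have hle : Real.pi * s ≤ Real.pi := by nlinarith [hs.2]
  refine ⟨by rw [norm_circleMap_zero, abs_of_nonneg hρ.1]; exact hρ.2, ?_, ?_⟩
  · rw [him]
    exact mul_nonneg hρ.1 (Real.sin_nonneg_of_nonneg_of_le_pi (mul_nonneg hpi.le hs.1) hle)
  · rw [him, hre, mul_eq_zero]
    rintro (h | h)
    · simp [h]
    · rcases hs.1.eq_or_lt with rfl | hs0
      · simpa using hρ.1
      · exact absurd h (Real.sin_pos_of_pos_of_lt_pi (by positivity) (by nlinarith [hs.2])).ne'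

variable {X : Type*} [TopologicalSpace X]

/-- The closed half discs `h m`, where `m` is taken modulo `N`, are glued cyclically along the
halves of their diameters, and together their interiors form an open set. -/
structure IsCyclicGluing (N : ℕ) (h : ℕ → ℂ → X) : Prop where
  pos : 0 < N
  continuous : ∀ m, Continuous (h m)
  periodic : Function.Periodic h N
  glue : ∀ m, ∀ ρ ∈ Icc (0 : ℝ) 1, h m ρ = h (m + 1) (-ρ)
  eq_and_eq : ∀ m < N, ∀ m' < N, ∀ x ∈ cutHalfDisc, ∀ x' ∈ cutHalfDisc, h m x = h m' x' →
    x = x' ∧ (x = 0 ∨ m = m')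
  isOpen : IsOpen (⋃ m, h m '' {x | ‖x‖ < 1 ∧ 0 ≤ x.im})

/-- Polar coordinates `(ρ, a)` of the plane in which the full angle is `N`. -/
def polar (N : ℕ) (k : ℝ × ℝ) : ℂ := circleMap 0 k.1 (2 * Real.pi * k.2 / N)

/-- Polar coordinates `(ρ, a)` of cyclically glued half discs: the angle `a` runs through the half
disc `h m` clockwise while `m ≤ a ≤ m + 1`. -/
def cyclicPolar (h : ℕ → ℂ → X) (k : ℝ × ℝ) : X :=
  h ⌊k.2⌋₊ (circleMap 0 k.1 (Real.pi * (1 - (k.2 - ⌊k.2⌋₊))))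

lemma continuous_polar (N : ℕ) : Continuous (polar N) := by
  unfold polar circleMap
  fun_prop

lemma norm_polar (N : ℕ) {k : ℝ × ℝ} (hk : 0 ≤ k.1) : ‖polar N k‖ = k.1 := by
  rw [polar, norm_circleMap_zero, abs_of_nonneg hk]

lemma image_polar {N : ℕ} (hN : 0 < N) {S : Set ℝ} (hS : S ⊆ Ici 0) :
    polar N '' (S ×ˢ Icc 0 (N : ℝ)) = {z | ‖z‖ ∈ S} := by
  have hN' : (0 : ℝ) < N := by exact_mod_cast hN
  ext z
  constructor
  · rintro ⟨k, hk, rfl⟩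
    rw [mem_ofPred_eq, norm_polar N (hS hk.1)]
    exact hk.1
  · intro hz
    obtain ⟨θ, hθ, hzθ⟩ := (periodic_circleMap 0 ‖z‖).exists_mem_Ico₀ Real.two_pi_pos z.arg
    refine ⟨(‖z‖, N * θ / (2 * Real.pi)), ⟨hz, ?_, ?_⟩, ?_⟩
    · have := hθ.1
      positivity
    · rw [div_le_iff₀ Real.two_pi_pos]
      exact mul_le_mul_of_nonneg_left hθ.2.le hN'.le
    · rw [polar, show 2 * Real.pi * (N * θ / (2 * Real.pi)) / N = θ by field_simp, ← hzθ,
        circleMap_zero, Complex.norm_mul_exp_arg_mul_I]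

namespace IsCyclicGluing

variable {N : ℕ} {h : ℕ → ℂ → X}

lemma apply_zero (H : IsCyclicGluing N h) (m : ℕ) : h m 0 = h 0 0 := by
  induction m with
  | zero => rfl
  | succ m ih => simpa [← ih] using (H.glue m 0 ⟨le_rfl, zero_le_one⟩).symm

lemma cyclicPolar_apply (H : IsCyclicGluing N h) {m : ℕ} {ρ a : ℝ} (hρ : ρ ∈ Icc (0 : ℝ) 1)
    (ha : a ∈ Icc (m : ℝ) (m + 1)) :
    cyclicPolar h (ρ, a) = h m (circleMap 0 ρ (Real.pi * (1 - (a - m)))) := by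
  rcases ha.2.eq_or_lt with rfl | ha2
  · have hfloor : ⌊(m : ℝ) + 1⌋₊ = m + 1 := by exact_mod_cast Nat.floor_natCast (R := ℝ) (m + 1)
    simp only [cyclicPolar, hfloor]
    simpa [circleMap_zero] using (H.glue m ρ hρ).symm
  · have hfloor : ⌊a⌋₊ = m := (Nat.floor_eq_iff (m.cast_nonneg.trans ha.1)).2 ⟨ha.1, ha2⟩
    simp only [cyclicPolar, hfloor]

lemma cyclicPolar_zero (H : IsCyclicGluing N h) (a : ℝ) : cyclicPolar h (0, a) = h 0 0 := by
  simp [cyclicPolar, H.apply_zero]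

lemma continuousOn_cyclicPolar (H : IsCyclicGluing N h) :
    ContinuousOn (cyclicPolar h) (Icc 0 1 ×ˢ Icc 0 (N : ℝ)) := by
  have hcover : Icc 0 1 ×ˢ Icc 0 (N : ℝ) ⊆
      ⋃ m : Fin (N + 1), Icc (0 : ℝ) 1 ×ˢ Icc ((m : ℕ) : ℝ) ((m : ℕ) + 1) := by
    rintro ⟨ρ, a⟩ ⟨hρ, ha⟩
    exact mem_iUnion.2 ⟨⟨⌊a⌋₊, Nat.lt_succ_of_le (Nat.floor_le_of_le ha.2)⟩, hρ,
      Nat.floor_le ha.1, (Nat.lt_floor_add_one a).le⟩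
  refine ContinuousOn.mono ?_ hcover
  refine (locallyFinite_of_finite _).continuousOn_iUnion
    (fun m => isClosed_Icc.prod isClosed_Icc) fun m => ?_
  refine ContinuousOn.congr
    (f := fun k : ℝ × ℝ => h m (circleMap 0 k.1 (Real.pi * (1 - (k.2 - (m : ℕ)))))) ?_ ?_
  · refine ((H.continuous m).comp ?_).continuousOn
    unfold circleMap
    fun_prop
  · rintro ⟨ρ, a⟩ ⟨hρ, ha⟩
    exact H.cyclicPolar_apply hρ ha

lemma exists_lt_cyclicPolar_eq (H : IsCyclicGluing N h) (ρ : ℝ) {a : ℝ} (ha : a ∈ Icc 0 (N : ℝ)) :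
    ∃ a' ∈ Ico 0 (N : ℝ), cyclicPolar h (ρ, a) = cyclicPolar h (ρ, a') ∧
      polar N (ρ, a) = polar N (ρ, a') := by
  have hN : (0 : ℝ) < N := by exact_mod_cast H.pos
  rcases ha.2.eq_or_lt with rfl | haN
  · refine ⟨0, ⟨le_rfl, hN⟩, ?_, ?_⟩
    · simp [cyclicPolar, H.periodic.eq]
    · simp [polar, circleMap_zero, mul_div_cancel_right₀ _ hN.ne']
  · exact ⟨a, ⟨ha.1, haN⟩, rfl, rfl⟩

lemma eq_and_eq_of_cyclicPolar_eq (H : IsCyclicGluing N h) {ρ ρ' a a' : ℝ}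
    (hρ : ρ ∈ Icc (0 : ℝ) 1) (hρ' : ρ' ∈ Icc (0 : ℝ) 1) (ha : a ∈ Ico 0 (N : ℝ))
    (ha' : a' ∈ Ico 0 (N : ℝ)) (heq : cyclicPolar h (ρ, a) = cyclicPolar h (ρ', a')) :
    ρ = ρ' ∧ (ρ = 0 ∨ a = a') := by
  have hfract : ∀ b ∈ Ico 0 (N : ℝ), b - ⌊b⌋₊ ∈ Ico (0 : ℝ) 1 := fun b hb =>
    ⟨sub_nonneg.2 (Nat.floor_le hb.1), by linarith [Nat.lt_floor_add_one b]⟩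
  obtain ⟨hx, hm⟩ := H.eq_and_eq _ ((Nat.floor_lt ha.1).2 ha.2) _ ((Nat.floor_lt ha'.1).2 ha'.2)
    _ (circleMap_mem_cutHalfDisc hρ (hfract a ha))
    _ (circleMap_mem_cutHalfDisc hρ' (hfract a' ha')) heq
  obtain rfl : ρ = ρ' := by
    simpa [norm_circleMap_zero, abs_of_nonneg hρ.1, abs_of_nonneg hρ'.1] using congrArg norm hx
  refine ⟨rfl, or_iff_not_imp_left.2 fun h0 => ?_⟩
  have hfloor : ⌊a⌋₊ = ⌊a'⌋₊ := hm.resolve_left (circleMap_ne_center h0)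
  have hangle := eq_of_circleMap_eq h0 ?_ hx
  · have := mul_left_cancel₀ Real.pi_ne_zero hangle
    rw [hfloor] at this
    linarith
  · have hpi := Real.pi_pos
    have hs := hfract a ha
    have hs' := hfract a' ha'
    rw [abs_lt]
    constructor <;> nlinarith [hs.1, hs.2, hs'.1, hs'.2]

lemma cyclicPolar_eq_iff (H : IsCyclicGluing N h) {k k' : ℝ × ℝ}
    (hk : k ∈ Icc (0 : ℝ) 1 ×ˢ Icc 0 (N : ℝ)) (hk' : k' ∈ Icc (0 : ℝ) 1 ×ˢ Icc 0 (N : ℝ)) :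
    cyclicPolar h k = cyclicPolar h k' ↔ polar N k = polar N k' := by
  have hN : (0 : ℝ) < N := by exact_mod_cast H.pos
  obtain ⟨ρ, b⟩ := k
  obtain ⟨ρ', b'⟩ := k'
  obtain ⟨hρ, hb⟩ := hk
  obtain ⟨hρ', hb'⟩ := hk'
  obtain ⟨a, ha, hW, hp⟩ := H.exists_lt_cyclicPolar_eq ρ hb
  obtain ⟨a', ha', hW', hp'⟩ := H.exists_lt_cyclicPolar_eq ρ' hb'
  rw [hW, hW', hp, hp']
  constructor
  · intro heq
    obtain ⟨rfl, rfl | rfl⟩ := H.eq_and_eq_of_cyclicPolar_eq hρ hρ' ha ha' heq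
    · simp [polar]
    · rfl
  · intro heq
    obtain rfl : ρ = ρ' := by
      simpa [norm_polar, hρ.1, hρ'.1] using congrArg norm heq
    rcases eq_or_ne ρ 0 with rfl | h0
    · rw [H.cyclicPolar_zero, H.cyclicPolar_zero]
    · have hangle := eq_of_circleMap_eq h0 ?_ heq
      · field_simp at hangle
        rw [hangle]
      · have hmul : ∀ b, 2 * Real.pi * b / N = 2 * Real.pi * (b / N) := fun b => mul_div_assoc _ _ _
        rw [hmul, hmul, ← mul_sub, ← sub_div, abs_mul, abs_of_pos Real.two_pi_pos, abs_div,
          abs_of_pos hN]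
        refine mul_lt_of_lt_one_right Real.two_pi_pos ((div_lt_one hN).2 (abs_lt.2 ⟨?_, ?_⟩)) <;>
          linarith [ha.1, ha.2, ha'.1, ha'.2]

lemma image_cyclicPolar (H : IsCyclicGluing N h) :
    cyclicPolar h '' (Ico 0 1 ×ˢ Icc 0 (N : ℝ)) = ⋃ m, h m '' {x | ‖x‖ < 1 ∧ 0 ≤ x.im} := by
  have hpi := Real.pi_pos
  ext y
  simp only [mem_image, mem_iUnion]
  constructor
  · rintro ⟨⟨ρ, a⟩, ⟨hρ, ha⟩, rfl⟩
    have hmem := circleMap_mem_cutHalfDisc (s := a - ⌊a⌋₊) (Ico_subset_Icc_self hρ)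
      ⟨sub_nonneg.2 (Nat.floor_le ha.1), by linarith [Nat.lt_floor_add_one a]⟩
    refine ⟨⌊a⌋₊, _, ⟨?_, hmem.2.1⟩, rfl⟩
    rw [norm_circleMap_zero, abs_of_nonneg hρ.1]
    exact hρ.2
  · rintro ⟨m, x, ⟨hx, him⟩, rfl⟩
    have hmN : ((m % N : ℕ) : ℝ) + 1 ≤ N := by exact_mod_cast Nat.mod_lt m H.pos
    have harg : x.arg / Real.pi ∈ Icc (0 : ℝ) 1 :=
      ⟨div_nonneg (Complex.arg_nonneg_iff.2 him) hpi.le, (div_le_one hpi).2 (Complex.arg_le_pi x)⟩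
    refine ⟨(‖x‖, (m % N : ℕ) + (1 - x.arg / Real.pi)), ⟨⟨norm_nonneg x, hx⟩, ?_, ?_⟩, ?_⟩
    · have := harg.2
      have : (0 : ℝ) ≤ (m % N : ℕ) := Nat.cast_nonneg _
      simp only
      linarith
    · have := harg.1
      simp only
      linarith
    · rw [H.cyclicPolar_apply (m := m % N) ⟨norm_nonneg x, hx.le⟩
        ⟨by linarith [harg.2], by linarith [harg.1]⟩, H.periodic.map_mod_nat,
        show Real.pi * (1 - (((m % N : ℕ) : ℝ) + (1 - x.arg / Real.pi) - (m % N : ℕ))) = x.arg by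
          field_simp; ring, circleMap_zero, Complex.norm_mul_exp_arg_mul_I]

lemma exists_isDiscChart (H : IsCyclicGluing N h) : ∃ V : ℂ → X, IsDiscChart V ∧ V 0 = h 0 0 := by
  have himage : polar N '' (Icc 0 1 ×ˢ Icc 0 (N : ℝ)) = Metric.closedBall 0 1 := by
    rw [image_polar H.pos fun x hx => hx.1]
    ext z
    simp
  have himage' : polar N '' (Ico 0 1 ×ˢ Icc 0 (N : ℝ)) = Metric.ball 0 1 := by
    rw [image_polar H.pos fun x hx => hx.1]
    ext z
    simp
  obtain ⟨V, hcont, hinj, hV⟩ := exists_injOn_of_eq_iff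
    (isCompact_Icc.prod isCompact_Icc) (continuous_polar N).continuousOn H.continuousOn_cyclicPolar
    fun k hk k' hk' => H.cyclicPolar_eq_iff hk hk'
  rw [himage] at hcont hinj
  refine ⟨V, ⟨hcont, hinj, ?_⟩, ?_⟩
  · rw [← himage', image_image, image_congr fun k hk => hV k ⟨Ico_subset_Icc_self hk.1, hk.2⟩,
      H.image_cyclicPolar]
    exact H.isOpen
  · simpa [polar, H.cyclicPolar_zero] using hV (0, 0) (by simp)

end IsCyclicGluing

end CyclicGluing

section VertexChart

/-- The exponential map from the upper half plane to the disc divided into `M` equal sectors,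
extended symmetrically to the lower half plane. -/
def expArc (M : ℕ) (x : ℂ) : UnitDisc :=
  ⟨Real.exp (-(2 * Real.pi / M * |x.im|)) * arc M x.re, by
    have := Real.pi_pos
    rw [mem_closedBall_zero_iff, norm_mul, norm_arc, mul_one, Complex.norm_of_nonneg
      (Real.exp_nonneg _), Real.exp_le_one_iff, neg_nonpos]
    positivity⟩

lemma continuous_expArc (M : ℕ) : Continuous (expArc M) := by
  apply Continuous.subtype_mk
  have := continuous_arc M
  fun_prop

lemma expArc_ofReal (M : ℕ) (t : ℝ) : expArc M t = arc M t := by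
  simp [expArc]

lemma norm_exp_mul (M : ℕ) (x : ℂ) :
    ‖Complex.exp (2 * Real.pi / M * x * Complex.I)‖ = Real.exp (-(2 * Real.pi / M * x.im)) := by
  rw [Complex.norm_exp]
  congr 1
  have hreal : (2 * Real.pi / M * x * Complex.I : ℂ) =
      ((2 * Real.pi / M : ℝ) : ℂ) * (x * Complex.I) := by
    push_cast
    ring
  rw [hreal, Complex.re_ofReal_mul, Complex.mul_I_re, mul_neg]

variable {M : ℕ}

lemma coe_expArc {x : ℂ} (hx : 0 ≤ x.im) :
    (expArc M x : ℂ) = Complex.exp (2 * Real.pi / M * x * Complex.I) := by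
  simp only [expArc, arc]
  rw [abs_of_nonneg hx, Complex.ofReal_exp, ← Complex.exp_add]
  congr 1
  conv_rhs => rw [← Complex.re_add_im x]
  push_cast
  linear_combination (-(2 * Real.pi / M * x.im) : ℂ) * Complex.I_sq

lemma norm_expArc_lt (hM : 0 < M) {x : ℂ} (hx : 0 < x.im) : ‖(expArc M x : ℂ)‖ < 1 := by
  have := Real.pi_pos
  rw [coe_expArc hx.le, norm_exp_mul, Real.exp_lt_one_iff, neg_lt_zero]
  positivity

lemma expArc_eq_iff (hM : 0 < M) {x y : ℂ} (hx : 0 ≤ x.im) (hy : 0 ≤ y.im) :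
    expArc M x = expArc M y ↔ ∃ k : ℤ, x = y + k * M := by
  have hM' : (M : ℂ) ≠ 0 := by exact_mod_cast hM.ne'
  have hpi : (Real.pi : ℂ) ≠ 0 := Complex.ofReal_ne_zero.2 Real.pi_ne_zero
  rw [Subtype.ext_iff, coe_expArc hx, coe_expArc hy, Complex.exp_eq_exp_iff_exists_int]
  refine exists_congr fun k => ?_
  have hshift : (2 * Real.pi / M * y * Complex.I : ℂ) + k * (2 * Real.pi * Complex.I) =
      2 * Real.pi / M * (y + k * M) * Complex.I := by
    field_simp
  rw [hshift, mul_left_inj' Complex.I_ne_zero,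
    mul_right_inj' (div_ne_zero (mul_ne_zero two_ne_zero hpi) hM')]

lemma isOpenMap_exp_mul {c : ℂ} (hc : c ≠ 0) :
    IsOpenMap fun x : ℂ => Complex.exp (c * x * Complex.I) := by
  refine isOpenMap_of_hasStrictDerivAt (f' := fun x =>
    Complex.exp (c * x * Complex.I) * (c * Complex.I)) (fun x => ?_) fun x =>
      mul_ne_zero (Complex.exp_ne_zero _) (mul_ne_zero hc Complex.I_ne_zero)
  have hlinear : HasStrictDerivAt (fun x : ℂ => c * x * Complex.I) (c * Complex.I) x := by
    simpa using ((hasStrictDerivAt_id x).const_mul c).mul_const Complex.I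
  exact hlinear.cexp

lemma isOpen_image_expArc (hM : 0 < M) {W : Set ℂ} (hW : IsOpen W) :
    IsOpen (expArc M '' (W ∩ {x | 0 ≤ x.im})) := by
  have hM' : (0 : ℝ) < M := by exact_mod_cast hM
  have hscale : 0 < 2 * Real.pi / M := div_pos Real.two_pi_pos hM'
  have hscale' : (2 * Real.pi / M : ℂ) ≠ 0 := by exact_mod_cast hscale.ne'
  have himage : expArc M '' (W ∩ {x | 0 ≤ x.im}) =
      Subtype.val ⁻¹' ((fun x : ℂ => Complex.exp (2 * Real.pi / M * x * Complex.I)) '' W) := by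
    ext z
    constructor
    · rintro ⟨x, ⟨hx, hx0⟩, rfl⟩
      exact ⟨x, hx, (coe_expArc hx0).symm⟩
    · rintro ⟨x, hx, hxz⟩
      have hnorm := mem_closedBall_zero_iff.1 z.2
      rw [← hxz, norm_exp_mul, Real.exp_le_one_iff, neg_nonpos] at hnorm
      have hx0 : 0 ≤ x.im := nonneg_of_mul_nonneg_right hnorm hscale
      exact ⟨x, ⟨hx, hx0⟩, Subtype.ext ((coe_expArc hx0).trans hxz)⟩
  rw [himage]
  exact (isOpenMap_exp_mul hscale' _ hW).preimage continuous_subtype_val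

variable {X : Type*} {ν : ℕ → ℕ} {V : Prop} {q : UnitDisc → X}

/-- The corners `e m`, where `m` is taken modulo `N`, are those met in this order on a turn around
a vertex of the glued polygon. -/
structure IsCornerCycle (M : ℕ) (ν : ℕ → ℕ) (q : UnitDisc → X) (N : ℕ) (e : ℕ → ℕ) : Prop where
  pos : 0 < N
  periodic : Function.Periodic e N
  lt : ∀ m, e m < M
  eq_of_eq : ∀ m < N, ∀ m' < N, e m = e m' → m = m'
  succ : ∀ m, ∃ k : ℤ, (e (m + 1) : ℝ) = ν (e m) + 1 + k * M
  exists_eq : ∀ m w, q (arc M (e m)) = q w → ∃ m', w = arc M (e m')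

/-- The parametrization of a neighbourhood of the corner `n` by the closed upper half disc. -/
def cornerChart (M n : ℕ) (x : ℂ) : UnitDisc := expArc M (n + x / 4)

lemma continuous_cornerChart (M n : ℕ) : Continuous (cornerChart M n) :=
  (continuous_expArc M).comp (by fun_prop)

lemma cornerChart_ofReal (M n : ℕ) (y : ℝ) : cornerChart M n y = arc M (n + y / 4) := by
  rw [cornerChart, ← expArc_ofReal]
  push_cast
  rfl

lemma norm_cornerChart_lt (hM : 0 < M) (n : ℕ) {x : ℂ} (hx : 0 < x.im) :
    ‖(cornerChart M n x : ℂ)‖ < 1 :=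
  norm_expArc_lt hM (by simpa using hx)

lemma im_add_div_four_nonneg {n : ℕ} {x : ℂ} (hx : 0 ≤ x.im) : 0 ≤ (n + x / 4 : ℂ).im := by
  simpa using div_nonneg hx zero_le_four

lemma eq_and_eq_of_cornerChart_eq {n n' : ℕ} (hn : n < M) (hn' : n' < M) {x x' : ℂ}
    (hx : ‖x‖ ≤ 1) (hx' : ‖x'‖ ≤ 1) (him : 0 ≤ x.im) (him' : 0 ≤ x'.im)
    (h : cornerChart M n x = cornerChart M n' x') : n = n' ∧ x = x' := by
  obtain ⟨k, hk⟩ := (expArc_eq_iff (by lia) (im_add_div_four_nonneg him)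
    (im_add_div_four_nonneg him')).1 h
  have hre : (n : ℝ) + x.re / 4 = n' + x'.re / 4 + k * M := by
    simpa using congrArg Complex.re hk
  have hxre := abs_le.1 ((Complex.abs_re_le_norm x).trans hx)
  have hxre' := abs_le.1 ((Complex.abs_re_le_norm x').trans hx')
  have hlt : (n : ℤ) < n' + k * M + 1 := by
    have : (n : ℝ) < n' + k * M + 1 := by linarith
    exact_mod_cast this
  have hgt : (n' : ℤ) + k * M < n + 1 := by
    have : (n' : ℝ) + k * M < n + 1 := by linarith
    exact_mod_cast this
  obtain rfl : k = 0 := by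
    have hk1 : -1 < k := by nlinarith
    have hk2 : k < 1 := by nlinarith
    lia
  obtain rfl : n = n' := by lia
  refine ⟨rfl, ?_⟩
  push_cast at hk
  linear_combination 4 * hk

lemma isOpen_image_cornerChart (hM : 0 < M) (n : ℕ) :
    IsOpen (cornerChart M n '' {x | ‖x‖ < 1 ∧ 0 ≤ x.im}) := by
  have himage : cornerChart M n '' {x | ‖x‖ < 1 ∧ 0 ≤ x.im} =
      expArc M '' ((fun x => 4 * (x - n)) ⁻¹' Metric.ball 0 1 ∩ {x | 0 ≤ x.im}) := by
    ext w
    constructor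
    · rintro ⟨x, ⟨hx, him⟩, rfl⟩
      exact ⟨n + x / 4, ⟨by simpa [mul_div_cancel₀] using hx,
        im_add_div_four_nonneg him⟩, rfl⟩
    · rintro ⟨x, ⟨hx, him⟩, rfl⟩
      exact ⟨4 * (x - n), ⟨mem_ball_zero_iff.1 hx, by simpa using him⟩, by simp [cornerChart]⟩
  rw [himage]
  exact isOpen_image_expArc hM (Metric.isOpen_ball.preimage (by fun_prop))

namespace IsCornerCycle

variable {N : ℕ} {e : ℕ → ℕ}

lemma apply_pred_succ (he : IsCornerCycle M ν q N e) (m : ℕ) : e (m + (N - 1) + 1) = e m := by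
  have := he.pos
  rw [show m + (N - 1) + 1 = m + N by lia, he.periodic]

lemma cornerChart_succ (he : IsCornerCycle M ν q N e) (m : ℕ) (y : ℝ) :
    cornerChart M (e (m + 1)) (-y) = arc M (e m + ν (e m) + 1 - (e m + y / 4)) := by
  have hM : 0 < M := (Nat.zero_le _).trans_lt (he.lt 0)
  obtain ⟨k, hk⟩ := he.succ m
  rw [← Complex.ofReal_neg, cornerChart_ofReal, arc_eq_arc_iff hM]
  exact ⟨k, by rw [hk]; ring⟩

end IsCornerCycle

variable [TopologicalSpace X]

lemma IsPolygonGluing.arc_eq_iff (h : IsPolygonGluing M ν V q) {n : ℕ} (hn : n < M) {t : ℝ}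
    (ht : t ∈ Ioo (n : ℝ) (n + 1)) (w : UnitDisc) :
    q (arc M t) = q w ↔ arc M t = w ∨ arc M (n + ν n + 1 - t) = w := by
  have hv : ¬IsVertex M (arc M t) := by
    rw [isVertex_arc_iff h.pos]
    rintro ⟨k, rfl⟩
    have : (n : ℤ) < k := by exact_mod_cast ht.1
    have : k < (n : ℤ) + 1 := by exact_mod_cast ht.2
    lia
  have ht' := Ioo_subset_Icc_self ht
  rw [h.eq_iff]
  constructor
  · rintro (rfl | ⟨m, hm, s, hs, hts, rfl⟩ | ⟨-, hvt, -⟩)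
    · exact Or.inl rfl
    · obtain ⟨rfl, rfl⟩ := eq_and_eq_of_arc_eq_arc hn hm ht' hs hts hv
      exact Or.inr rfl
    · exact absurd hvt hv
  · rintro (rfl | rfl)
    · exact Or.inl rfl
    · exact Or.inr (Or.inl ⟨n, hn, t, ht', rfl, rfl⟩)

lemma IsPolygonGluing.apply_arc (h : IsPolygonGluing M ν V q) {n : ℕ} (hn : n < M) {t : ℝ}
    (ht : t ∈ Icc (n : ℝ) (n + 1)) : q (arc M t) = q (arc M (n + ν n + 1 - t)) :=
  (h.eq_iff _ _).2 (Or.inr (Or.inl ⟨n, hn, t, ht, rfl, rfl⟩))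

namespace IsCornerCycle

variable {N : ℕ} {e : ℕ → ℕ}

lemma apply_cornerChart (he : IsCornerCycle M ν q N e) (h : IsPolygonGluing M ν V q) (m : ℕ)
    {y : ℝ} (hy : y ∈ Icc (0 : ℝ) 1) :
    q (cornerChart M (e m) y) = q (cornerChart M (e (m + 1)) (-y)) := by
  rw [he.cornerChart_succ, cornerChart_ofReal,
    h.apply_arc (he.lt m) ⟨by linarith [hy.1], by linarith [hy.2]⟩]

lemma cornerChart_eq_iff (he : IsCornerCycle M ν q N e) (h : IsPolygonGluing M ν V q) (m : ℕ)
    {y : ℝ} (hy : y ∈ Ioc (0 : ℝ) 1) (w : UnitDisc) :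
    q (cornerChart M (e m) y) = q w ↔
      cornerChart M (e m) y = w ∨ cornerChart M (e (m + 1)) (-y) = w := by
  rw [he.cornerChart_succ, cornerChart_ofReal,
    h.arc_eq_iff (he.lt m) ⟨by linarith [hy.1], by linarith [hy.2]⟩]

lemma eq_or_eq_of_cornerChart (he : IsCornerCycle M ν q N e) (h : IsPolygonGluing M ν V q)
    (m : ℕ) {x : ℂ} (hx : ‖x‖ ≤ 1) (him : 0 ≤ x.im) {w : UnitDisc}
    (hw : q (cornerChart M (e m) x) = q w) :
    cornerChart M (e m) x = w ∨
      x.im = 0 ∧ 0 < x.re ∧ cornerChart M (e (m + 1)) (-x) = w ∨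
      x.im = 0 ∧ x.re < 0 ∧ cornerChart M (e (m + (N - 1))) (-x) = w ∨
      x = 0 ∧ ∃ m', cornerChart M (e m') 0 = w := by
  rcases him.eq_or_lt with him0 | him0
  · obtain ⟨y, rfl⟩ : ∃ y : ℝ, x = y := ⟨x.re, Complex.ext rfl (by simp [← him0])⟩
    rw [Complex.norm_real, Real.norm_eq_abs, abs_le] at hx
    simp only [Complex.ofReal_re, Complex.ofReal_im, true_and]
    rcases lt_trichotomy y 0 with hy | rfl | hy
    · have hpred := he.cornerChart_eq_iff h (m + (N - 1)) (y := -y)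
        ⟨by linarith, by linarith⟩ w
      have hglue := he.apply_cornerChart h (m + (N - 1)) (y := -y) ⟨by linarith, by linarith⟩
      rw [Complex.ofReal_neg, neg_neg, he.apply_pred_succ] at hpred hglue
      rcases hpred.1 (hglue.trans hw) with hw | hw
      · exact Or.inr (Or.inr (Or.inl ⟨hy, hw⟩))
      · exact Or.inl hw
    · rw [cornerChart_ofReal, zero_div, add_zero] at hw
      obtain ⟨m', rfl⟩ := he.exists_eq m w hw
      exact Or.inr (Or.inr (Or.inr ⟨Complex.ofReal_zero, m', by
        rw [← Complex.ofReal_zero, cornerChart_ofReal, zero_div, add_zero]⟩))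
    · rcases (he.cornerChart_eq_iff h m ⟨hy, hx.2⟩ w).1 hw with hw | hw
      · exact Or.inl hw
      · exact Or.inr (Or.inl ⟨hy, hw⟩)
  · exact Or.inl (h.eq_of_norm_lt (norm_cornerChart_lt h.pos _ him0) hw)

lemma eq_and_eq (he : IsCornerCycle M ν q N e) (h : IsPolygonGluing M ν V q) {m m' : ℕ}
    (hm : m < N) (hm' : m' < N) {x x' : ℂ} (hx : x ∈ cutHalfDisc) (hx' : x' ∈ cutHalfDisc)
    (heq : q (cornerChart M (e m) x) = q (cornerChart M (e m') x')) :
    x = x' ∧ (x = 0 ∨ m = m') := by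
  rcases he.eq_or_eq_of_cornerChart h m hx.1 hx.2.1 heq with
    hw | ⟨him, hre, -⟩ | ⟨him, hre, hw⟩ | ⟨rfl, m'', hw⟩
  · obtain ⟨hn, rfl⟩ := eq_and_eq_of_cornerChart_eq (he.lt m) (he.lt m') hx.1 hx'.1 hx.2.1
      hx'.2.1 hw
    exact ⟨rfl, Or.inr (he.eq_of_eq m hm m' hm' hn)⟩
  · exact absurd (hx.2.2 him) hre.not_ge
  · obtain ⟨-, rfl⟩ := eq_and_eq_of_cornerChart_eq (he.lt _) (he.lt m') (by simpa using hx.1) hx'.1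
      (by simp [him]) hx'.2.1 hw
    have := hx'.2.2 (by simp [him])
    rw [Complex.neg_re] at this
    linarith
  · exact ⟨(eq_and_eq_of_cornerChart_eq (he.lt _) (he.lt m') (by simp) hx'.1 le_rfl
      hx'.2.1 hw).2, Or.inl rfl⟩

lemma isOpen (he : IsCornerCycle M ν q N e) (h : IsPolygonGluing M ν V q) :
    IsOpen (⋃ m, (fun x => q (cornerChart M (e m) x)) '' {x | ‖x‖ < 1 ∧ 0 ≤ x.im}) := by
  rw [← h.isQuotientMap.isOpen_preimage]
  have hpreimage : q ⁻¹' (⋃ m, (fun x => q (cornerChart M (e m) x)) '' {x | ‖x‖ < 1 ∧ 0 ≤ x.im}) =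
      ⋃ m, cornerChart M (e m) '' {x | ‖x‖ < 1 ∧ 0 ≤ x.im} := by
    ext w
    simp only [mem_preimage, mem_iUnion]
    constructor
    · rintro ⟨m, x, ⟨hx, him⟩, hw⟩
      rcases he.eq_or_eq_of_cornerChart h m hx.le him hw with
        rfl | ⟨him, -, rfl⟩ | ⟨him, -, rfl⟩ | ⟨-, m', rfl⟩
      · exact ⟨m, x, ⟨hx, him⟩, rfl⟩
      · exact ⟨m + 1, -x, ⟨by simpa using hx, by simp [him]⟩, rfl⟩
      · exact ⟨m + (N - 1), -x, ⟨by simpa using hx, by simp [him]⟩, rfl⟩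
      · exact ⟨m', 0, by simp, rfl⟩
    · rintro ⟨m, x, hx, rfl⟩
      exact ⟨m, x, hx, rfl⟩
  rw [hpreimage]
  exact isOpen_iUnion fun m => isOpen_image_cornerChart h.pos (e m)

lemma isCyclicGluing (he : IsCornerCycle M ν q N e) (h : IsPolygonGluing M ν V q) :
    IsCyclicGluing N fun m x => q (cornerChart M (e m) x) where
  pos := he.pos
  continuous m := h.isQuotientMap.continuous.comp (continuous_cornerChart M (e m))
  periodic m := by simp only [he.periodic m]
  glue m _ hρ := he.apply_cornerChart h m hρ
  eq_and_eq _ hm _ hm' _ hx _ hx' heq := he.eq_and_eq h hm hm' hx hx' heq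
  isOpen := he.isOpen h

lemma exists_isDiscChart (he : IsCornerCycle M ν q N e) (h : IsPolygonGluing M ν V q) :
    ∃ V : ℂ → X, IsDiscChart V ∧ V 0 = q (arc M (e 0)) := by
  have := h.t2Space
  obtain ⟨W, hW, hW0⟩ := (he.isCyclicGluing h).exists_isDiscChart
  refine ⟨W, hW, hW0.trans ?_⟩
  rw [← Complex.ofReal_zero, cornerChart_ofReal, zero_div, add_zero]

end IsCornerCycle

end VertexChart

section Cayley

/-- The Cayley transform, which takes the closed upper half plane to the closed unit disc minus the
point `1`. -/
def cayley (w : ℂ) : ℂ := (w - Complex.I) / (w + Complex.I)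

/-- The inverse of `cayley`. -/
def cayleyInv (z : ℂ) : ℂ := Complex.I * (1 + z) / (1 - z)

lemma add_I_ne_zero {w : ℂ} (hw : 0 ≤ w.im) : w + Complex.I ≠ 0 := fun h => by
  have him := congrArg Complex.im h
  simp only [Complex.add_im, Complex.I_im, Complex.zero_im] at him
  linarith

lemma normSq_add_I_sub (w : ℂ) :
    Complex.normSq (w + Complex.I) - Complex.normSq (w - Complex.I) = 4 * w.im := by
  simp only [Complex.normSq_apply, Complex.sub_re, Complex.sub_im, Complex.add_re, Complex.add_im,
    Complex.I_re, Complex.I_im]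
  ring

lemma norm_cayley_le {w : ℂ} (hw : 0 ≤ w.im) : ‖cayley w‖ ≤ 1 := by
  rw [cayley, norm_div]
  refine div_le_one_of_le₀ ?_ (norm_nonneg _)
  rw [← sq_le_sq₀ (norm_nonneg _) (norm_nonneg _), Complex.sq_norm, Complex.sq_norm]
  linarith [normSq_add_I_sub w]

lemma norm_cayley_lt {w : ℂ} (hw : 0 < w.im) : ‖cayley w‖ < 1 := by
  rw [cayley, norm_div, div_lt_one (norm_pos_iff.2 (add_I_ne_zero hw.le)),
    ← sq_lt_sq₀ (norm_nonneg _) (norm_nonneg _), Complex.sq_norm, Complex.sq_norm]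
  linarith [normSq_add_I_sub w]

lemma cayley_ne_one {w : ℂ} (hw : 0 ≤ w.im) : cayley w ≠ 1 := by
  rw [cayley, Ne, div_eq_one_iff_eq (add_I_ne_zero hw), sub_eq_add_neg, add_right_inj]
  intro h
  have him := congrArg Complex.im h
  norm_num at him

lemma cayleyInv_cayley {w : ℂ} (hw : 0 ≤ w.im) : cayleyInv (cayley w) = w := by
  rw [cayleyInv, div_eq_iff (sub_ne_zero.2 (cayley_ne_one hw).symm), cayley]
  have := add_I_ne_zero hw
  field_simp
  ring

lemma cayley_cayleyInv {z : ℂ} (hz : z ≠ 1) : cayley (cayleyInv z) = z := by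
  have hz' : 1 - z ≠ 0 := sub_ne_zero.2 hz.symm
  have hadd : cayleyInv z + Complex.I = 2 * Complex.I / (1 - z) := by
    rw [cayleyInv]
    field_simp
    ring
  have hsub : cayleyInv z - Complex.I = 2 * Complex.I * z / (1 - z) := by
    rw [cayleyInv]
    field_simp
    ring
  rw [cayley, hadd, hsub]
  have := Complex.I_ne_zero
  field_simp

lemma im_cayleyInv_nonneg {z : ℂ} (hz : ‖z‖ ≤ 1) : 0 ≤ (cayleyInv z).im := by
  have hsq : z.re * z.re + z.im * z.im ≤ 1 := by
    rw [← Complex.normSq_apply, ← Complex.sq_norm]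
    exact pow_le_one₀ (norm_nonneg _) hz
  rw [cayleyInv, Complex.div_im, ← sub_div]
  refine div_nonneg ?_ (Complex.normSq_nonneg _)
  simp only [Complex.mul_re, Complex.mul_im, Complex.I_re, Complex.I_im, Complex.add_re,
    Complex.add_im, Complex.sub_re, Complex.sub_im, Complex.one_re, Complex.one_im]
  linarith

lemma cayley_tan {φ : ℝ} (hφ : Real.cos φ ≠ 0) :
    cayley (Real.tan φ) = -Complex.exp ((2 * φ : ℝ) * Complex.I) := by
  have hcos : (Real.cos φ : ℂ) ≠ 0 := Complex.ofReal_ne_zero.2 hφ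
  have hsq : (Real.cos φ : ℂ) ^ 2 + (Real.sin φ : ℂ) ^ 2 = 1 := by
    exact_mod_cast Real.cos_sq_add_sin_sq φ
  have hexp : Complex.exp ((2 * φ : ℝ) * Complex.I) =
      (Real.cos φ + Real.sin φ * Complex.I) * (Real.cos φ + Real.sin φ * Complex.I) := by
    rw [Complex.ofReal_cos, Complex.ofReal_sin, ← Complex.exp_mul_I, ← Complex.exp_add]
    congr 1
    push_cast
    ring
  rw [hexp, cayley, div_eq_iff (add_I_ne_zero (Complex.ofReal_im _).ge), Real.tan_eq_sin_div_cos,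
    Complex.ofReal_div]
  have hI := Complex.I_sq
  generalize (Real.cos φ : ℂ) = c at *
  generalize (Real.sin φ : ℂ) = s at *
  have hmul : (c + s * Complex.I) * (s + c * Complex.I) = Complex.I := by
    linear_combination Complex.I * hsq + s * c * hI
  rw [show s / c - Complex.I = (s - c * Complex.I) / c by field_simp,
    show s / c + Complex.I = (s + c * Complex.I) / c by field_simp]
  linear_combination (c + s * Complex.I) / c * hmul + s / c * hI

end Cayley

section StripMap

/-- The half-open strip which `stripMap` maps homeomorphically to the disc minus one point. -/
def strip (M : ℕ) : Set ℂ := {x | x.re ∈ Ioo (0 : ℝ) M ∧ 0 ≤ x.im}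

/-- The homeomorphism of the strip onto the closed upper half plane that stretches the interval
`(0, M)` to `ℝ`.  The absolute value extends it to points below the strip. -/
def stripStretch (M : ℕ) (x : ℂ) : ℂ :=
  ⟨Real.tan (Real.pi * x.re / M - Real.pi / 2), |x.im|⟩

/-- A homeomorphism from the strip to the closed unit disc minus the point `1`, which is `arc M` on
the real interval. -/
def stripMap (M : ℕ) (x : ℂ) : UnitDisc :=
  ⟨cayley (stripStretch M x), mem_closedBall_zero_iff.2 (norm_cayley_le (abs_nonneg _))⟩

/-- The inverse of `stripMap`. -/
def stripInv (M : ℕ) (z : ℂ) : ℂ :=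
  ⟨M / 2 + M / Real.pi * Real.arctan (cayleyInv z).re, (cayleyInv z).im⟩

variable {M : ℕ}

lemma angle_mem (hM : 0 < M) {t : ℝ} (ht : t ∈ Ioo (0 : ℝ) M) :
    Real.pi * t / M - Real.pi / 2 ∈ Ioo (-(Real.pi / 2)) (Real.pi / 2) := by
  have hM' : (0 : ℝ) < M := by exact_mod_cast hM
  have hpi := Real.pi_pos
  have hpos : 0 < Real.pi * t / M := div_pos (mul_pos hpi ht.1) hM'
  have hlt : Real.pi * t / M < Real.pi := by
    rw [div_lt_iff₀ hM']
    exact mul_lt_mul_of_pos_left ht.2 hpi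
  constructor <;> linarith

lemma continuousOn_stripMap (hM : 0 < M) :
    ContinuousOn (stripMap M) {x | x.re ∈ Ioo (0 : ℝ) M} := by
  have htan : ContinuousOn (fun x : ℂ => Real.tan (Real.pi * x.re / M - Real.pi / 2))
      {x | x.re ∈ Ioo (0 : ℝ) M} :=
    Real.continuousOn_tan_Ioo.comp (by fun_prop) fun x hx => angle_mem hM hx
  have hstretch : ContinuousOn (stripStretch M) {x | x.re ∈ Ioo (0 : ℝ) M} :=
    Complex.equivRealProdCLM.symm.continuous.comp_continuousOn
      (htan.prodMk (Complex.continuous_im.abs.continuousOn))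
  rw [continuousOn_iff_continuous_domRestrict] at hstretch ⊢
  exact ((hstretch.sub continuous_const).div (hstretch.add continuous_const)
    fun x => add_I_ne_zero (abs_nonneg _)).subtype_mk _

lemma continuousOn_stripInv (M : ℕ) : ContinuousOn (stripInv M) {z | z ≠ 1} := by
  have hcayley : ContinuousOn cayleyInv {z | z ≠ 1} :=
    ContinuousOn.div (by fun_prop) (by fun_prop) fun z hz => sub_ne_zero.2 (Ne.symm hz)
  exact Complex.equivRealProdCLM.symm.continuous.comp_continuousOn
    (((Real.continuous_arctan.comp_continuousOn (Complex.continuous_re.comp_continuousOn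
      hcayley)).const_mul (M / Real.pi) |>.const_add (M / 2 : ℝ)).prodMk
        (Complex.continuous_im.comp_continuousOn hcayley))

lemma stripMap_ne_one (M : ℕ) (x : ℂ) : (stripMap M x : ℂ) ≠ 1 := cayley_ne_one (abs_nonneg _)

lemma stripInv_stripMap (hM : 0 < M) {x : ℂ} (hx : x ∈ strip M) :
    stripInv M (stripMap M x) = x := by
  have : (0 : ℝ) < M := by exact_mod_cast hM
  have hangle := angle_mem hM hx.1
  rw [stripInv, stripMap, cayleyInv_cayley (abs_nonneg _)]
  simp only [stripStretch]
  rw [Real.arctan_tan hangle.1 hangle.2, abs_of_nonneg hx.2]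
  have := Real.pi_ne_zero
  apply Complex.ext
  · simp only
    field_simp
    ring
  · rfl

lemma stripInv_mem (hM : 0 < M) (z : UnitDisc) : stripInv M z ∈ strip M := by
  have hM' : (0 : ℝ) < M := by exact_mod_cast hM
  have hscale : 0 < M / Real.pi := div_pos hM' Real.pi_pos
  have hhalf : M / Real.pi * (Real.pi / 2) = M / 2 := by
    have := Real.pi_ne_zero
    field_simp
  have hlt := mul_lt_mul_of_pos_left (Real.arctan_lt_pi_div_two (cayleyInv z).re) hscale
  have hgt := mul_lt_mul_of_pos_left (Real.neg_pi_div_two_lt_arctan (cayleyInv z).re) hscale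
  rw [mul_neg, hhalf] at hgt
  rw [hhalf] at hlt
  refine ⟨⟨?_, ?_⟩, im_cayleyInv_nonneg (mem_closedBall_zero_iff.1 z.2)⟩
  · simp only [stripInv]
    linarith
  · simp only [stripInv]
    linarith

lemma stripMap_stripInv (hM : 0 < M) {z : UnitDisc} (hz : (z : ℂ) ≠ 1) :
    stripMap M (stripInv M z) = z := by
  have : (0 : ℝ) < M := by exact_mod_cast hM
  have hangle : Real.pi * (stripInv M z).re / M - Real.pi / 2 =
      Real.arctan (cayleyInv z).re := by
    have := Real.pi_ne_zero
    simp only [stripInv]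
    field_simp
    ring
  have hstretch : stripStretch M (stripInv M z) = cayleyInv z := by
    rw [stripStretch, hangle, Real.tan_arctan, abs_of_nonneg (stripInv_mem hM z).2]
    rfl
  apply Subtype.ext
  simp only [stripMap]
  rw [hstretch, cayley_cayleyInv hz]

lemma stripMap_ofReal (hM : 0 < M) {t : ℝ} (ht : t ∈ Ioo (0 : ℝ) M) :
    stripMap M t = arc M t := by
  have hstretch : stripStretch M t = Real.tan (Real.pi * t / M - Real.pi / 2) := by
    simp only [stripStretch, Complex.ofReal_re, Complex.ofReal_im, abs_zero]
    rfl
  apply Subtype.ext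
  simp only [stripMap, arc]
  rw [hstretch, cayley_tan (Real.cos_pos_of_mem_Ioo (angle_mem hM ht)).ne', ← mul_neg_one,
    ← Complex.exp_pi_mul_I, ← Complex.exp_add]
  congr 1
  push_cast
  ring

lemma norm_stripMap_lt (M : ℕ) {x : ℂ} (hx : 0 < x.im) : ‖(stripMap M x : ℂ)‖ < 1 :=
  norm_cayley_lt (abs_pos_of_pos hx)

lemma injOn_stripMap (hM : 0 < M) : InjOn (stripMap M) (strip M) :=
  LeftInvOn.injOn (f₁' := fun z => stripInv M z) fun _ hx => stripInv_stripMap hM hx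

lemma isOpen_image_stripMap (hM : 0 < M) {W : Set ℂ} (hW : IsOpen W) :
    IsOpen (stripMap M '' (W ∩ strip M)) := by
  have himage : stripMap M '' (W ∩ strip M) =
      Subtype.val ⁻¹' ({z : ℂ | z ≠ 1} ∩ stripInv M ⁻¹' W) := by
    ext z
    constructor
    · rintro ⟨x, ⟨hxW, hx⟩, rfl⟩
      exact ⟨stripMap_ne_one M x, by rwa [mem_preimage, stripInv_stripMap hM hx]⟩
    · rintro ⟨hz, hzW⟩
      exact ⟨stripInv M z, ⟨hzW, stripInv_mem hM z⟩, stripMap_stripInv hM hz⟩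
  rw [himage]
  exact ((continuousOn_stripInv M).isOpen_inter_preimage isOpen_ne hW).preimage
    continuous_subtype_val

end StripMap

section StripCharts

variable {X : Type*} [TopologicalSpace X]

lemma exists_openPartialHomeomorph_of_isOpen_image {f : ℂ → X} {U : Set ℂ} (hU : IsOpen U)
    (hf : ContinuousOn f U) (hinj : InjOn f U) (hopen : ∀ W ⊆ U, IsOpen W → IsOpen (f '' W)) :
    ∃ d : OpenPartialHomeomorph ℂ X, d.source = U ∧ ⇑d = f :=
  ⟨.ofContinuousOpenRestrict hinj.toPartialEquiv hf (fun W hW => by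
    have hW' : IsOpen (Subtype.val '' W) := hU.isOpenMap_subtype_val W hW
    rw [domRestrict_eq, image_comp]
    exact hopen _ (Subtype.coe_image_subset U W) hW') hU, rfl, rfl⟩

lemma exists_isDiscChart_of_mem_source (d : OpenPartialHomeomorph ℂ X) {x : ℂ}
    (hx : x ∈ d.source) : ∃ V, IsDiscChart V ∧ V 0 = d x := by
  obtain ⟨r, hr, hrd⟩ := Metric.nhds_basis_closedBall.mem_iff.1 (d.open_source.mem_nhds hx)
  have hrC : (r : ℂ) ≠ 0 := Complex.ofReal_ne_zero.2 hr.ne'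
  have hmaps : MapsTo (fun ζ : ℂ => x + r * ζ) (Metric.closedBall 0 1) d.source := by
    intro ζ hζ
    apply hrd
    rw [← affinity_unitClosedBall hr.le]
    exact ⟨_, ⟨ζ, hζ, rfl⟩, by simp⟩
  have himage : (fun ζ : ℂ => x + r * ζ) '' Metric.ball 0 1 = Metric.ball x r := by
    rw [← affinity_unitBall hr, ← image_smul, ← image_vadd, image_image]
    simp
  refine ⟨fun ζ => d (x + r * ζ), ⟨d.continuousOn.comp (by fun_prop) hmaps, ?_, ?_⟩, by simp⟩
  · exact d.injOn.comp (fun ζ _ ζ' _ h => mul_left_cancel₀ hrC (add_left_cancel h)) hmaps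
  · rw [← image_image d, himage]
    exact d.isOpen_image_of_subset_source Metric.isOpen_ball
      (Metric.ball_subset_closedBall.trans hrd)

variable {M : ℕ} {ν : ℕ → ℕ} {V : Prop} {q : UnitDisc → X} {n : ℕ} {x : ℂ}

lemma mem_Ioo_of_lt (hn : n < M) {t : ℝ} (ht : t ∈ Ioo (n : ℝ) (n + 1)) : t ∈ Ioo (0 : ℝ) M := by
  have hn' : (n : ℝ) + 1 ≤ M := by exact_mod_cast hn
  exact ⟨n.cast_nonneg.trans_lt ht.1, ht.2.trans_le hn'⟩

lemma mem_strip_of_mem_Ioo (hn : n < M) (hre : x.re ∈ Ioo (n : ℝ) (n + 1)) (him : 0 ≤ x.im) :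
    x ∈ strip M :=
  ⟨mem_Ioo_of_lt hn hre, him⟩

lemma re_flip_mem_Ioo (k : ℕ) (hre : x.re ∈ Ioo (n : ℝ) (n + 1)) :
    (n + k + 1 - x).re ∈ Ioo (k : ℝ) (k + 1) := by
  simp only [Complex.sub_re, Complex.add_re, Complex.natCast_re, Complex.one_re]
  constructor <;> linarith [hre.1, hre.2]

lemma im_flip (n k : ℕ) (x : ℂ) : (n + k + 1 - x).im = -x.im := by simp

/-- The gluing map on the side `n` of the strip, continued across the side through the sheet which
is glued to it along the side `ν n`. -/
def edgeMap (M : ℕ) (ν : ℕ → ℕ) (q : UnitDisc → X) (n : ℕ) (x : ℂ) : X :=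
  open Classical in
  if 0 ≤ x.im then q (stripMap M x) else q (stripMap M (n + ν n + 1 - x))

namespace IsPolygonGluing

lemma stripMap_eq_iff (h : IsPolygonGluing M ν V q) (hn : n < M)
    (hre : x.re ∈ Ioo (n : ℝ) (n + 1)) (him : 0 ≤ x.im) (w : UnitDisc) :
    q (stripMap M x) = q w ↔
      stripMap M x = w ∨ x.im = 0 ∧ stripMap M (n + ν n + 1 - x) = w := by
  rcases him.eq_or_lt with h0 | h0
  · obtain ⟨t, rfl⟩ : ∃ t : ℝ, x = t := ⟨x.re, Complex.ext rfl h0.symm⟩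
    have hflip : ((n : ℂ) + ν n + 1 - t) = ((n + ν n + 1 - t : ℝ) : ℂ) := by push_cast; rfl
    have hmem := mem_Ioo_of_lt (h.lt n hn) (re_flip_mem_Ioo (ν n) hre)
    rw [hflip, Complex.ofReal_re] at hmem
    rw [hflip, stripMap_ofReal h.pos (t := t) (mem_Ioo_of_lt hn hre), stripMap_ofReal h.pos hmem,
      h.arc_eq_iff (t := t) hn hre, Complex.ofReal_im, eq_self_iff_true, true_and]
  · refine ⟨fun heq => Or.inl (h.eq_of_norm_lt (norm_stripMap_lt M h0) heq), ?_⟩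
    rintro (rfl | ⟨h1, -⟩)
    · rfl
    · exact absurd h1 h0.ne'

lemma exists_openPartialHomeomorph_interior (h : IsPolygonGluing M ν V q) :
    ∃ d : OpenPartialHomeomorph ℂ X,
      d.source = {x | x.re ∈ Ioo (0 : ℝ) M ∧ 0 < x.im} ∧ ⇑d = fun x => q (stripMap M x) := by
  have hsub : {x : ℂ | x.re ∈ Ioo (0 : ℝ) M ∧ 0 < x.im} ⊆ strip M := fun x hx => ⟨hx.1, hx.2.le⟩
  refine exists_openPartialHomeomorph_of_isOpen_image
    ((isOpen_Ioo.preimage Complex.continuous_re).inter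
      (isOpen_lt continuous_const Complex.continuous_im)) ?_ ?_ ?_
  · exact h.isQuotientMap.continuous.comp_continuousOn
      ((continuousOn_stripMap h.pos).mono fun x hx => hx.1)
  · exact fun x hx y hy heq => injOn_stripMap h.pos (hsub hx) (hsub hy)
      (h.eq_of_norm_lt (norm_stripMap_lt M hx.2) heq)
  · intro W hWU hW
    rw [← h.isQuotientMap.isOpen_preimage]
    convert isOpen_image_stripMap h.pos hW using 1
    rw [inter_eq_left.2 (hWU.trans hsub)]
    ext w
    refine exists_congr fun x => and_congr_right fun hx => ?_
    exact ⟨h.eq_of_norm_lt (norm_stripMap_lt M (hWU hx).2), congrArg q⟩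

lemma edgeMap_of_im_nonpos (h : IsPolygonGluing M ν V q) (hn : n < M)
    (hre : x.re ∈ Ioo (n : ℝ) (n + 1)) (him : x.im ≤ 0) :
    edgeMap M ν q n x = q (stripMap M (n + ν n + 1 - x)) := by
  rcases him.eq_or_lt with h0 | h0
  · exact (if_pos h0.ge).trans ((h.stripMap_eq_iff hn hre h0.ge _).2 (Or.inr ⟨h0, rfl⟩))
  · exact if_neg h0.not_ge

lemma edgeMap_eq_iff (h : IsPolygonGluing M ν V q) (hn : n < M)
    (hre : x.re ∈ Ioo (n : ℝ) (n + 1)) (w : UnitDisc) :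
    edgeMap M ν q n x = q w ↔ 0 ≤ x.im ∧ stripMap M x = w ∨
      x.im ≤ 0 ∧ stripMap M (n + ν n + 1 - x) = w := by
  rcases le_or_gt 0 x.im with hi | hi
  · rw [edgeMap, if_pos hi, h.stripMap_eq_iff hn hre hi, and_iff_right hi, hi.ge_iff_eq']
  · rw [edgeMap, if_neg hi.not_ge, and_iff_right hi.le, or_iff_right fun hx => hi.not_ge hx.1]
    refine ⟨h.eq_of_norm_lt (norm_stripMap_lt M ?_), congrArg q⟩
    rwa [im_flip, neg_pos]

lemma continuousOn_edgeMap (h : IsPolygonGluing M ν V q) (hn : n < M) :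
    ContinuousOn (edgeMap M ν q n) {x | x.re ∈ Ioo (n : ℝ) (n + 1)} := by
  have hq := h.isQuotientMap.continuous
  have hstrip := continuousOn_stripMap h.pos
  unfold edgeMap
  refine ContinuousOn.if (fun x hx => ?_)
    ((hq.comp_continuousOn (hstrip.mono fun x hx => mem_Ioo_of_lt hn hx)).mono inter_subset_left)
    ((hq.comp_continuousOn (hstrip.comp (by fun_prop)
      fun x hx => mem_Ioo_of_lt (h.lt n hn) (re_flip_mem_Ioo (ν n) hx))).mono inter_subset_left)
  have him : x.im = 0 := by simpa only [Complex.frontier_setOfPred_le_im, mem_ofPred_eq] using hx.2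
  exact (h.stripMap_eq_iff hn hx.1 him.ge _).2 (Or.inr ⟨him, rfl⟩)

lemma injOn_edgeMap (h : IsPolygonGluing M ν V q) (hn : n < M) :
    InjOn (edgeMap M ν q n) {x | x.re ∈ Ioo (n : ℝ) (n + 1)} := by
  have hdisj : ∀ {x y : ℂ}, x.re ∈ Ioo (n : ℝ) (n + 1) → y.re ∈ Ioo (n : ℝ) (n + 1) →
      n + ν n + 1 - x ≠ y := by
    rintro x y hx hy rfl
    have hflip := re_flip_mem_Ioo (ν n) hx
    have hlt : (n : ℝ) < ν n + 1 := hy.1.trans hflip.2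
    have hgt : (ν n : ℝ) < n + 1 := hflip.1.trans hy.2
    norm_cast at hlt hgt
    exact h.ne n hn (by lia)
  have hinj := injOn_stripMap h.pos
  intro x hx y hy heq
  have hup : ∀ {x : ℂ}, x.re ∈ Ioo (n : ℝ) (n + 1) → 0 ≤ x.im → x ∈ strip M :=
    fun hx hi => mem_strip_of_mem_Ioo hn hx hi
  have hlo : ∀ {x : ℂ}, x.re ∈ Ioo (n : ℝ) (n + 1) → x.im ≤ 0 → n + ν n + 1 - x ∈ strip M :=
    fun hx hi => mem_strip_of_mem_Ioo (h.lt n hn) (re_flip_mem_Ioo (ν n) hx)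
      (by rwa [im_flip, neg_nonneg])
  rcases le_total 0 y.im with hi | hi
  · rw [edgeMap.eq_def M ν q n y, if_pos hi, h.edgeMap_eq_iff hn hx] at heq
    rcases heq with ⟨hxi, hxy⟩ | ⟨hxi, hxy⟩
    · exact hinj (hup hx hxi) (hup hy hi) hxy
    · exact absurd (hinj (hlo hx hxi) (hup hy hi) hxy) (hdisj hx hy)
  · rw [h.edgeMap_of_im_nonpos hn hy hi, h.edgeMap_eq_iff hn hx] at heq
    rcases heq with ⟨hxi, hxy⟩ | ⟨hxi, hxy⟩
    · exact absurd (hinj (hup hx hxi) (hlo hy hi) hxy).symm (hdisj hy hx)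
    · exact sub_right_injective (hinj (hlo hx hxi) (hlo hy hi) hxy)

lemma isOpen_image_edgeMap (h : IsPolygonGluing M ν V q) (hn : n < M) {W : Set ℂ} (hW : IsOpen W)
    (hWn : W ⊆ {x | x.re ∈ Ioo (n : ℝ) (n + 1)}) : IsOpen (edgeMap M ν q n '' W) := by
  rw [← h.isQuotientMap.isOpen_preimage]
  have hWflip : IsOpen ((fun x : ℂ => n + ν n + 1 - x) ⁻¹' W) := hW.preimage (by fun_prop)
  convert (isOpen_image_stripMap h.pos hW).union (isOpen_image_stripMap h.pos hWflip) using 1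
  ext w
  constructor
  · rintro ⟨x, hx, hxw⟩
    rcases (h.edgeMap_eq_iff hn (hWn hx) w).1 hxw with ⟨hi, hw⟩ | ⟨hi, hw⟩
    · exact Or.inl ⟨x, ⟨hx, mem_strip_of_mem_Ioo hn (hWn hx) hi⟩, hw⟩
    · exact Or.inr ⟨_, ⟨by simpa using hx, mem_strip_of_mem_Ioo (h.lt n hn)
        (re_flip_mem_Ioo (ν n) (hWn hx)) (by rwa [im_flip, neg_nonneg])⟩, hw⟩
  · rintro (⟨x, ⟨hx, -, hi⟩, hw⟩ | ⟨x, ⟨hx, -, hi⟩, hw⟩)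
    · exact ⟨x, hx, (h.edgeMap_eq_iff hn (hWn hx) w).2 (Or.inl ⟨hi, hw⟩)⟩
    · refine ⟨_, hx, (h.edgeMap_eq_iff hn (hWn hx) w).2 (Or.inr ⟨?_, by rwa [sub_sub_cancel]⟩)⟩
      rwa [im_flip, neg_nonpos]

lemma exists_openPartialHomeomorph_edge (h : IsPolygonGluing M ν V q) (hn : n < M) :
    ∃ d : OpenPartialHomeomorph ℂ X,
      d.source = {x | x.re ∈ Ioo (n : ℝ) (n + 1)} ∧ ⇑d = edgeMap M ν q n :=
  exists_openPartialHomeomorph_of_isOpen_image (isOpen_Ioo.preimage Complex.continuous_re)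
    (h.continuousOn_edgeMap hn) (h.injOn_edgeMap hn)
    fun _ hWn hW => h.isOpen_image_edgeMap hn hW hWn

end IsPolygonGluing

end StripCharts

section ClosedSurface

variable {X : Type*} [TopologicalSpace X] {M : ℕ} {ν : ℕ → ℕ} {V : Prop} {q : UnitDisc → X}

lemma exists_mem_Ioo_of_not_isVertex {t : ℝ} (ht : t ∈ Ico (0 : ℝ) M)
    (hv : ¬IsVertex M (arc M t)) : ∃ n < M, t ∈ Ioo (n : ℝ) (n + 1) := by
  refine ⟨⌊t⌋₊, (Nat.floor_lt ht.1).2 ht.2, lt_of_le_of_ne (Nat.floor_le ht.1) fun heq => hv ?_,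
    Nat.lt_floor_add_one t⟩
  exact ⟨⌊t⌋₊, by rw [Int.cast_natCast, heq]⟩

lemma im_stripInv_pos (hM : 0 < M) {z : UnitDisc} (hz : ‖(z : ℂ)‖ < 1) :
    0 < (stripInv M z).im := by
  have hz1 : (z : ℂ) ≠ 1 := by
    rintro h1
    rw [h1, norm_one] at hz
    exact lt_irrefl _ hz
  obtain ⟨hre, him⟩ := stripInv_mem hM z
  refine lt_of_le_of_ne him fun h0 => hz.ne ?_
  have hreal : stripInv M z = ((stripInv M z).re : ℂ) := Complex.ext rfl h0.symm
  rw [← stripMap_stripInv hM hz1, hreal, stripMap_ofReal hM hre, norm_arc]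

variable {S : Type*} [TopologicalSpace S]

/-- `ι` identifies the surface `S` with the complement of the finite set `P` of punctures in the
glued polygon; the punctures lie on the boundary of the polygon and contain all its vertices. -/
structure IsPuncturedPolygon (M : ℕ) (ν : ℕ → ℕ) (V : Prop) (q : UnitDisc → X) (P : Set X)
    (ι : S → X) : Prop extends IsPolygonGluing M ν V q where
  finite : P.Finite
  subset_boundary : P ⊆ q '' {z | ‖(z : ℂ)‖ = 1}
  vertex_subset : q '' {z | IsVertex M z} ⊆ P
  isOpenEmbedding : IsOpenEmbedding ι
  range_eq : range ι = Pᶜ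

namespace IsPolygonGluing

lemma exists_isDiscChart (h : IsPolygonGluing M ν V q)
    (hv : ∀ n < M, ∃ V : ℂ → X, IsDiscChart V ∧ V 0 = q (arc M n)) (x : X) :
    ∃ V : ℂ → X, IsDiscChart V ∧ V 0 = x := by
  obtain ⟨z, rfl⟩ := h.isQuotientMap.surjective x
  rcases (mem_closedBall_zero_iff.1 z.2).lt_or_eq with hz | hz
  · obtain ⟨d, hd, hdq⟩ := h.exists_openPartialHomeomorph_interior
    obtain ⟨V, hV, hV0⟩ := exists_isDiscChart_of_mem_source d (x := stripInv M z)
      (hd ▸ ⟨(stripInv_mem h.pos z).1, im_stripInv_pos h.pos hz⟩)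
    refine ⟨V, hV, hV0.trans ?_⟩
    have hz1 : (z : ℂ) ≠ 1 := by
      rintro h1
      rw [h1, norm_one] at hz
      exact lt_irrefl _ hz
    exact hdq ▸ congrArg q (stripMap_stripInv h.pos hz1)
  · by_cases hz' : IsVertex M z
    · obtain ⟨n, hn, rfl⟩ := hz'.exists_lt_eq_arc h.pos
      exact hv n hn
    · obtain ⟨t, ht, rfl⟩ := exists_eq_arc h.pos hz
      obtain ⟨n, hn, htn⟩ := exists_mem_Ioo_of_not_isVertex ht hz'
      obtain ⟨d, hd, hdq⟩ := h.exists_openPartialHomeomorph_edge hn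
      obtain ⟨V, hV, hV0⟩ := exists_isDiscChart_of_mem_source d (x := t) (hd ▸ htn)
      refine ⟨V, hV, hV0.trans ?_⟩
      rw [hdq, edgeMap, if_pos (Complex.ofReal_im t).ge,
        stripMap_ofReal h.pos (mem_Ioo_of_lt hn htn)]

lemma infinite_image_norm_eq_one (h : IsPolygonGluing M ν V q) :
    (q '' {z | ‖(z : ℂ)‖ = 1}).Infinite := by
  obtain ⟨d, hd, hdq⟩ := h.exists_openPartialHomeomorph_edge h.pos
  have hsub : (fun t : ℝ => (t : ℂ)) '' Ioo 0 1 ⊆ d.source := by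
    rintro _ ⟨t, ht, rfl⟩
    rw [hd]
    simpa using ht
  refine (((Ioo_infinite one_pos).image Complex.ofReal_injective.injOn).image
    (d.injOn.mono hsub)).mono ?_
  rintro _ ⟨_, ⟨t, ht, rfl⟩, rfl⟩
  refine ⟨arc M t, norm_arc M t, ?_⟩
  rw [hdq, edgeMap, if_pos (Complex.ofReal_im t).ge, stripMap_ofReal h.pos]
  exact mem_Ioo_of_lt h.pos (by simpa using ht)

lemma exists_isPuncturedPolygon (h : IsPolygonGluing M ν V q)
    (hch : ∀ x, ∃ V : ℂ → X, IsDiscChart V ∧ V 0 = x) {P : Set X} (hP : P.Finite)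
    (hcard : (q '' {z | IsVertex M z}).encard ≤ P.encard) (f : S ≃ₜ ↥Pᶜ) :
    ∃ (P' : Set X) (ι : S → X), IsPuncturedPolygon M ν V q P' ι := by
  have := h.t2Space
  obtain ⟨P', hvP, hPb, hPP⟩ := exists_superset_subset_encard_eq (s := q '' {z | IsVertex M z})
    (t := q '' {z | ‖(z : ℂ)‖ = 1}) (k := P.encard)
    (image_mono fun z ⟨n, hn⟩ => hn ▸ norm_arc M n) hcard
    (by rw [h.infinite_image_norm_eq_one.encard_eq]; exact le_top)
  obtain ⟨H, hH⟩ := exists_homeomorph_image_eq_of_encard_eq hch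
    (fun F hF => h.isPreconnected_compl hF) hP hPP.symm
  refine ⟨P', fun s => H (f s), h, hH ▸ hP.image H, hPb, hvP,
    H.isOpenEmbedding.comp (hP.isClosed.isOpen_compl.isOpenEmbedding_subtypeVal.comp
      f.isOpenEmbedding), ?_⟩
  rw [← hH, ← image_compl_eq H.bijective, range_comp' H, range_comp' Subtype.val, f.range_coe,
    image_univ, Subtype.range_coe]

end IsPolygonGluing

lemma exists_isDiscChart_zero {n : ℕ} (hn : n < 2) : ∃ V : ℂ → ClosedSurface 0, IsDiscChart V ∧
    V 0 = Quot.mk (SideGluing 0) (arc 2 n) := by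
  refine IsCornerCycle.exists_isDiscChart (N := 1) (e := fun _ => n) (ν := fun n => 1 - n)
    ⟨one_pos, fun _ => rfl, fun _ => hn, fun m hm m' hm' _ => by lia,
      fun _ => ⟨n - 1, by interval_cases n <;> norm_num⟩, fun _ w hw => ⟨0, ?_⟩⟩
    isPolygonGluing_zero
  rcases (isPolygonGluing_zero.eq_iff _ _).1 hw with h | ⟨l, hl, t, -, hnt, rfl⟩ | ⟨h, -⟩
  · exact h.symm
  · obtain ⟨k, hk⟩ := (arc_eq_arc_iff two_pos).1 hnt
    refine (arc_eq_arc_iff two_pos).2 ⟨1 - n + k, ?_⟩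
    have hsum : (l : ℝ) + ((1 - l : ℕ) : ℝ) = 1 := by
      rw [← Nat.cast_add, Nat.add_sub_cancel' (by lia), Nat.cast_one]
    rw [hsum]
    push_cast at hk ⊢
    linarith
  · exact h.elim

/-- The order in which the corners of the standard polygon are arranged around its vertex, as an
involution of the corners. -/
def corner (m : ℕ) : ℕ := if m % 4 = 1 then m + 2 else if m % 4 = 3 then m - 2 else m

lemma corner_corner (m : ℕ) : corner (corner m) = m := by
  unfold corner
  split_ifs <;> lia

lemma corner_lt {g m : ℕ} (hm : m < 4 * g) : corner m < 4 * g := by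
  unfold corner
  split_ifs <;> lia

lemma corner_succ (m : ℕ) : corner (m + 1) = partner (corner m) + 1 := by
  unfold corner partner
  split_ifs <;> lia

lemma isCornerCycle_pos {g : ℕ} (hg : 0 < g) :
    IsCornerCycle (4 * g) partner (Quot.mk (SideGluing g)) (4 * g)
      fun m => corner (m % (4 * g)) where
  pos := by lia
  periodic m := by simp only [Nat.add_mod_right]
  lt m := corner_lt (Nat.mod_lt _ (by lia))
  eq_of_eq m hm m' hm' heq := by
    simp only [Nat.mod_eq_of_lt hm, Nat.mod_eq_of_lt hm'] at heq
    rw [← corner_corner m, heq, corner_corner]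
  succ m := by
    have hlt : m % (4 * g) < 4 * g := Nat.mod_lt _ (by lia)
    rcases (Nat.succ_le_of_lt hlt).lt_or_eq with hm | hm
    · refine ⟨0, ?_⟩
      have hmod : (m + 1) % (4 * g) = m % (4 * g) + 1 := by
        rw [Nat.add_mod, Nat.mod_eq_of_lt (a := 1) (by lia), Nat.mod_eq_of_lt hm]
      rw [hmod, corner_succ]
      simp
    · refine ⟨-1, ?_⟩
      have hmod : (m + 1) % (4 * g) = 0 := by
        rw [Nat.add_mod, Nat.mod_eq_of_lt (a := 1) (by lia)]
        rw [show m % (4 * g) + 1 = 4 * g from hm, Nat.mod_self]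
      have hpartner : partner (corner (m % (4 * g))) + 1 = 4 * g := by
        rw [← corner_succ, ← Nat.succ_eq_add_one, hm, corner, if_neg (by lia), if_neg (by lia)]
      have hcast := congrArg (Nat.cast : ℕ → ℝ) hpartner
      push_cast at hcast ⊢
      rw [hmod, hcast]
      simp [corner]
  exists_eq m w hw := by
    have h := isPolygonGluing_of_pos hg
    obtain ⟨l, hl, rfl⟩ :=
      (SideRel.isVertex h.pos ((h.eq_iff _ _).1 hw) ⟨_, rfl⟩).exists_lt_eq_arc h.pos
    exact ⟨corner l, by rw [Nat.mod_eq_of_lt (corner_lt hl), corner_corner]⟩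

lemma exists_isDiscChart_pos {g : ℕ} (hg : 0 < g) (n : ℕ) :
    ∃ V : ℂ → ClosedSurface g, IsDiscChart V ∧ V 0 = Quot.mk (SideGluing g) (arc (4 * g) n) := by
  have h := isPolygonGluing_of_pos hg
  obtain ⟨V, hV, hV0⟩ := (isCornerCycle_pos hg).exists_isDiscChart h
  have hvert : ∀ m : ℕ, IsVertex (4 * g) (arc (4 * g) m) := fun m => ⟨m, by rw [Int.cast_natCast]⟩
  exact ⟨V, hV, hV0.trans ((h.eq_iff _ _).2 (Or.inr (Or.inr ⟨trivial, hvert _, hvert n⟩)))⟩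

lemma exists_isPolygonGluing (g : ℕ) :
    ∃ (M : ℕ) (ν : ℕ → ℕ) (V : Prop) (q : UnitDisc → ClosedSurface g), IsPolygonGluing M ν V q ∧
      (∀ x, ∃ V : ℂ → ClosedSurface g, IsDiscChart V ∧ V 0 = x) ∧
      (q '' {z | IsVertex M z}).encard ≤ if g = 0 then 2 else 1 := by
  rcases g.eq_zero_or_pos with rfl | hg
  · refine ⟨_, _, _, _, isPolygonGluing_zero,
      isPolygonGluing_zero.exists_isDiscChart fun n hn => exists_isDiscChart_zero hn, ?_⟩
    have hvert : {z | IsVertex 2 z} ⊆ {arc 2 0, arc 2 1} := by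
      intro z hz
      obtain ⟨n, hn, rfl⟩ := hz.exists_lt_eq_arc two_pos
      interval_cases n <;> simp
    rw [if_pos rfl]
    refine (encard_image_le _ _).trans ((encard_le_encard hvert).trans
      ((encard_insert_le _ _).trans ?_))
    rw [encard_singleton, one_add_one_eq_two]
  · have h := isPolygonGluing_of_pos hg
    refine ⟨_, _, _, _, h, h.exists_isDiscChart fun n _ => exists_isDiscChart_pos hg n, ?_⟩
    rw [if_neg hg.ne', encard_le_one_iff]
    rintro _ _ ⟨z, hz, rfl⟩ ⟨w, hw, rfl⟩
    exact (h.eq_iff _ _).2 (Or.inr (Or.inr ⟨trivial, hz, hw⟩))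

end ClosedSurface

section Lifts

lemma exists_continuousOn_lift {Y S E : Type*} [TopologicalSpace Y] [TopologicalSpace S]
    [TopologicalSpace E] {p : E → S} (hp : IsCoveringMap p) {T : Set Y} [SimplyConnectedSpace T]
    [LocallyPathConnectedSpace T] {π : Y → S} (hπ : ContinuousOn π T) {y : Y} (hy : y ∈ T) {e : E}
    (he : p e = π y) : ∃ f : Y → E, ContinuousOn f T ∧ EqOn (p ∘ f) π T := by
  obtain ⟨L, ⟨-, hL⟩, -⟩ := hp.existsUnique_continuousMap_lifts
    ⟨T.domRestrict π, continuousOn_iff_continuous_domRestrict.1 hπ⟩ ⟨y, hy⟩ e he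
  classical
  refine ⟨fun x => if hx : x ∈ T then L ⟨x, hx⟩ else e,
    continuousOn_iff_continuous_domRestrict.2 ?_, fun x hx => ?_⟩
  · refine L.continuous.congr fun x => ?_
    rw [domRestrict_apply, dif_pos x.2]
  · rw [Function.comp_apply, dif_pos hx]
    exact congrFun hL ⟨x, hx⟩

lemma exists_openPartialHomeomorph_lift {X Y E : Type*} [TopologicalSpace X] [TopologicalSpace Y]
    [TopologicalSpace E] {Φ : E → X} (hΦ : IsLocalHomeomorph Φ) (d : OpenPartialHomeomorph Y X)
    {e : E} {y : Y} (hy : y ∈ d.source) (he : Φ e = d y) :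
    ∃ γ : OpenPartialHomeomorph Y E, y ∈ γ.source ∧ γ y = e ∧ γ.source ⊆ d.source ∧
      ∀ w ∈ γ.source, Φ (γ w) = d w := by
  obtain ⟨φ, heφ, rfl⟩ := hΦ e
  refine ⟨d.trans φ.symm, ⟨hy, ?_⟩, ?_, fun w hw => hw.1, fun w hw => φ.right_inv hw.2⟩
  · change d y ∈ φ.target
    exact he ▸ φ.map_source heφ
  · rw [OpenPartialHomeomorph.coe_trans, Function.comp_apply, ← he, φ.left_inv heφ]

lemma exists_openPartialHomeomorph_eqOn {Y Z E : Type*} [TopologicalSpace Y] [TopologicalSpace Z]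
    [TopologicalSpace E] (γ : OpenPartialHomeomorph Y E) (d : OpenPartialHomeomorph Y Z) {y : Y}
    (hyγ : y ∈ γ.source) (hyd : y ∈ d.source) {D : E → Z} (hD : ∀ᶠ w in 𝓝 y, D (γ w) = d w) :
    ∃ d' : OpenPartialHomeomorph E Z, γ y ∈ d'.source ∧ EqOn D d' d'.source := by
  obtain ⟨W, hWD, hW, hyW⟩ := eventually_nhds_iff.1 hD
  refine ⟨(γ.restrOpen W hW).symm.trans d, ⟨(γ.restrOpen W hW).map_source ⟨hyγ, hyW⟩, ?_⟩, ?_⟩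
  · change (γ.symm (γ y)) ∈ d.source
    rwa [γ.left_inv hyγ]
  · rintro e ⟨he, -⟩
    rw [OpenPartialHomeomorph.coe_trans, Function.comp_apply,
      ← hWD _ ((γ.restrOpen W hW).map_target he).2]
    exact congrArg D ((γ.restrOpen W hW).right_inv he).symm

end Lifts

section PuncturedStrip

variable {S X : Type*} [TopologicalSpace S] [TopologicalSpace X] {M : ℕ} {ν : ℕ → ℕ} {V : Prop}
  {q : UnitDisc → X} {P : Set X} {ι : S → X} {n : ℕ} {x : ℂ}

lemma IsPolygonGluing.finite_preimage (h : IsPolygonGluing M ν V q) (hP : P.Finite) :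
    (q ⁻¹' P).Finite := by
  refine hP.preimage' fun x _ => ?_
  obtain ⟨z, rfl⟩ := h.isQuotientMap.surjective x
  rcases (mem_closedBall_zero_iff.1 z.2).eq_or_lt with hz | hz
  · by_cases hz' : IsVertex M z
    · exact (finite_isVertex h.pos).subset fun w hw =>
        SideRel.isVertex h.pos ((h.eq_iff _ _).1 (Eq.symm hw)) hz'
    · obtain ⟨t, ht, rfl⟩ := exists_eq_arc h.pos hz
      obtain ⟨n, hn, htn⟩ := exists_mem_Ioo_of_not_isVertex ht hz'
      refine (toFinite {arc M t, arc M (n + ν n + 1 - t)}).subset fun w hw => ?_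
      exact ((h.arc_eq_iff hn htn w).1 (Eq.symm hw)).imp Eq.symm Eq.symm
  · exact (finite_singleton z).subset fun w hw => (h.eq_of_norm_lt hz (Eq.symm hw)).symm

lemma injOn_arc (hM : 0 < M) : InjOn (arc M) (Ico (0 : ℝ) M) := by
  intro t ht s hs hts
  have : (0 : ℝ) < M := by exact_mod_cast hM
  obtain ⟨k, rfl⟩ := (arc_eq_arc_iff hM).1 hts
  have hneg : (-1 : ℝ) < k := by nlinarith [ht.1, hs.2]
  have hpos : (k : ℝ) < 1 := by nlinarith [ht.2, hs.1]
  have hk : k = 0 := by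
    have : -1 < k := by exact_mod_cast hneg
    have : k < 1 := by exact_mod_cast hpos
    lia
  rw [hk, Int.cast_zero, zero_mul, add_zero]

/-- The parameters in `[0, M]` of the punctures. -/
def cuts (M : ℕ) (q : UnitDisc → X) (P : Set X) : Set ℝ :=
  {t | t ∈ Icc (0 : ℝ) M ∧ q (arc M t) ∈ P}

/-- The part of the strip that corresponds to the complement of the punctures. -/
def puncturedStrip (M : ℕ) (q : UnitDisc → X) (P : Set X) : Set ℂ :=
  {x | x ∈ strip M ∧ q (stripMap M x) ∉ P}

namespace IsPuncturedPolygon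

variable (h : IsPuncturedPolygon M ν V q P ι)

include h

lemma apply_notMem (s : S) : ι s ∉ P := by
  rw [← mem_compl_iff, ← h.range_eq]
  exact mem_range_self s

lemma finite_cuts : (cuts M q P).Finite := by
  have hfinite : (Ico (0 : ℝ) M ∩ arc M ⁻¹' (q ⁻¹' P)).Finite := by
    refine Finite.of_finite_image ((h.finite_preimage h.finite).subset ?_)
      ((injOn_arc h.pos).mono inter_subset_left)
    rintro _ ⟨t, ht, rfl⟩
    exact ht.2
  refine (hfinite.insert (M : ℝ)).subset ?_
  rintro t ⟨ht, htP⟩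
  exact ht.2.eq_or_lt.imp id fun htM => ⟨⟨ht.1, htM⟩, htP⟩

lemma natCast_mem_cuts {m : ℕ} (hm : m ≤ M) : (m : ℝ) ∈ cuts M q P :=
  ⟨⟨m.cast_nonneg, by exact_mod_cast hm⟩, h.vertex_subset ⟨_, ⟨m, by rw [Int.cast_natCast]⟩, rfl⟩⟩

lemma mem_puncturedStrip_of_im_pos (hre : x.re ∈ Ioo (0 : ℝ) M) (him : 0 < x.im) :
    x ∈ puncturedStrip M q P := by
  refine ⟨⟨hre, him.le⟩, fun hx => ?_⟩
  obtain ⟨z, hz, hzx⟩ := h.subset_boundary hx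
  have hlt := norm_stripMap_lt M him
  rw [h.eq_of_norm_lt hlt hzx.symm] at hlt
  exact hlt.ne hz

lemma ofReal_mem_puncturedStrip_iff {t : ℝ} :
    (t : ℂ) ∈ puncturedStrip M q P ↔ t ∈ Ioo (0 : ℝ) M ∧ t ∉ cuts M q P := by
  have hstrip : (t : ℂ) ∈ strip M ↔ t ∈ Ioo (0 : ℝ) M := by simp [strip]
  refine (and_congr_left' hstrip).trans (and_congr_right fun ht => not_congr ?_)
  rw [stripMap_ofReal h.pos ht]
  exact (and_iff_right (Ioo_subset_Icc_self ht)).symm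

lemma exists_mem_Ioo_of_mem_puncturedStrip {t : ℝ} (ht : (t : ℂ) ∈ puncturedStrip M q P) :
    ∃ n < M, t ∈ Ioo (n : ℝ) (n + 1) := by
  obtain ⟨htM, htc⟩ := h.ofReal_mem_puncturedStrip_iff.1 ht
  exact exists_mem_Ioo_of_not_isVertex (Ioo_subset_Ico_self htM) fun hv =>
    htc ⟨Ioo_subset_Icc_self htM, h.vertex_subset (mem_image_of_mem q hv)⟩

lemma flip_mem_puncturedStrip (hn : n < M) (hre : x.re ∈ Ioo (n : ℝ) (n + 1)) (him : x.im = 0)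
    (hx : x ∈ puncturedStrip M q P) : (n + ν n + 1 - x : ℂ) ∈ puncturedStrip M q P := by
  refine ⟨mem_strip_of_mem_Ioo (h.lt n hn) (re_flip_mem_Ioo (ν n) hre) ?_, ?_⟩
  · rw [im_flip, him, neg_zero]
  · rw [← (h.stripMap_eq_iff hn hre him.ge _).2 (Or.inr ⟨him, rfl⟩)]
    exact hx.2

lemma starConvex_puncturedStrip : StarConvex ℝ (⟨M / 2, 1⟩ : ℂ) (puncturedStrip M q P) := by
  have hM : (0 : ℝ) < M := by exact_mod_cast h.pos
  intro x hx a b ha hb hab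
  rcases ha.eq_or_lt with rfl | ha
  · rw [zero_add] at hab
    rwa [hab, zero_smul, one_smul, zero_add]
  · obtain ⟨⟨⟨hre, hreM⟩, him⟩, -⟩ := hx
    apply h.mem_puncturedStrip_of_im_pos
    · simp only [Complex.add_re, Complex.real_smul, Complex.re_ofReal_mul]
      constructor
      · have := mul_nonneg hb hre.le
        positivity
      · nlinarith
    · simp only [Complex.add_im, Complex.real_smul, Complex.im_ofReal_mul]
      have := mul_nonneg hb him
      linarith

lemma mk_mem_puncturedStrip : (⟨M / 2, 1⟩ : ℂ) ∈ puncturedStrip M q P := by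
  have hM : (0 : ℝ) < M := by exact_mod_cast h.pos
  exact h.mem_puncturedStrip_of_im_pos ⟨half_pos hM, half_lt_self hM⟩ one_pos

lemma simplyConnectedSpace_puncturedStrip : SimplyConnectedSpace (puncturedStrip M q P) :=
  have := h.starConvex_puncturedStrip.contractibleSpace ⟨_, h.mk_mem_puncturedStrip⟩
  inferInstance

lemma continuousOn_apply_stripMap : ContinuousOn (fun x => q (stripMap M x)) (strip M) :=
  h.isQuotientMap.continuous.comp_continuousOn ((continuousOn_stripMap h.pos).mono fun _ hx => hx.1)

lemma locallyPathConnectedSpace_puncturedStrip :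
    LocallyPathConnectedSpace (puncturedStrip M q P) := by
  have := h.t2Space
  have hstrip : Convex ℝ (strip M) :=
    ((convex_Ioo (0 : ℝ) M).is_linear_preimage Complex.reLm.isLinear).inter
      (convex_halfSpace_im_ge 0)
  have := hstrip.locallyPathConnectedSpace
  exact (IsOpenEmbedding.inclusion (fun _ hx => hx.1) (by
    convert h.finite.isClosed.isOpen_compl.preimage
      (continuousOn_iff_continuous_domRestrict.1 h.continuousOn_apply_stripMap) using 1
    ext x
    exact and_iff_right x.2)).locallyPathConnectedSpace

lemma exists_apply_stripMap_eq (s : S) : ∃ x ∈ puncturedStrip M q P, q (stripMap M x) = ι s := by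
  obtain ⟨z, hz⟩ := h.isQuotientMap.surjective (ι s)
  have hz1 : (z : ℂ) ≠ 1 := by
    intro h1
    refine h.apply_notMem s (hz ▸ h.vertex_subset ⟨z, ⟨0, Subtype.ext ?_⟩, rfl⟩)
    rw [h1]
    simp [arc]
  refine ⟨stripInv M z, ⟨stripInv_mem h.pos z, ?_⟩, ?_⟩
  all_goals rw [stripMap_stripInv h.pos hz1, hz]
  exact h.apply_notMem s

end IsPuncturedPolygon

end PuncturedStrip

section StripLift

variable {S E X : Type*} [TopologicalSpace S] [TopologicalSpace E] [TopologicalSpace X] {p : E → S}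
  {M : ℕ} {ν : ℕ → ℕ} {V : Prop} {q : UnitDisc → X} {P : Set X} {ι : S → X} {f : ℂ → E} {n : ℕ}
  {x : ℂ}

/-- `f` lifts the parametrization of the punctured surface by the punctured strip to the covering
space. -/
structure IsStripLift (M : ℕ) (q : UnitDisc → X) (P : Set X) (ι : S → X) (p : E → S) (f : ℂ → E) :
    Prop where
  continuousOn : ContinuousOn f (puncturedStrip M q P)
  apply_eq : ∀ x ∈ puncturedStrip M q P, ι (p (f x)) = q (stripMap M x)

lemma IsPuncturedPolygon.exists_isStripLift (h : IsPuncturedPolygon M ν V q P ι)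
    (hp : IsCoveringMap p) (e₀ : E) : ∃ f : ℂ → E, IsStripLift M q P ι p f := by
  have hrange : ∀ x : ℂ, ∃ s, x ∈ puncturedStrip M q P → ι s = q (stripMap M x) := by
    intro x
    by_cases hx : x ∈ puncturedStrip M q P
    · obtain ⟨s, hs⟩ := h.range_eq.ge hx.2
      exact ⟨s, fun _ => hs⟩
    · exact ⟨p e₀, fun hx' => (hx hx').elim⟩
  choose π hπ using hrange
  have hπc : ContinuousOn π (puncturedStrip M q P) :=
    h.isOpenEmbedding.isInducing.continuousOn_iff.2
      ((h.continuousOn_apply_stripMap.mono fun _ hx => hx.1).congr hπ)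
  obtain ⟨x₁, hx₁, hx₁e⟩ := h.exists_apply_stripMap_eq (p e₀)
  have := h.simplyConnectedSpace_puncturedStrip
  have := h.locallyPathConnectedSpace_puncturedStrip
  obtain ⟨f, hf, hfπ⟩ := exists_continuousOn_lift hp hπc hx₁
    (h.isOpenEmbedding.injective (hx₁e.symm.trans (hπ x₁ hx₁).symm))
  exact ⟨f, hf, fun x hx => (congrArg ι (hfπ hx)).trans (hπ x hx)⟩

namespace IsStripLift

variable (hf : IsStripLift M q P ι p f) (h : IsPuncturedPolygon M ν V q P ι)

include hf h

lemma apply_eq_iff (hx : x ∈ puncturedStrip M q P) (s : S) :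
    p (f x) = s ↔ q (stripMap M x) = ι s := by
  rw [← hf.apply_eq x hx, h.isOpenEmbedding.injective.eq_iff]

lemma exists_apply_eq (s : S) : ∃ x ∈ puncturedStrip M q P, p (f x) = s := by
  obtain ⟨x, hx, hxs⟩ := h.exists_apply_stripMap_eq s
  exact ⟨x, hx, (hf.apply_eq_iff h hx s).2 hxs⟩

lemma apply_flip (hn : n < M) (hre : x.re ∈ Ioo (n : ℝ) (n + 1)) (him : x.im = 0)
    (hx : x ∈ puncturedStrip M q P) : p (f x) = p (f (n + ν n + 1 - x)) := by
  rw [hf.apply_eq_iff h hx, hf.apply_eq _ (h.flip_mem_puncturedStrip hn hre him hx)]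
  exact (h.stripMap_eq_iff hn hre him.ge _).2 (Or.inr ⟨him, rfl⟩)

lemma eq_or_eq_flip {x' : ℂ} (hx : x ∈ puncturedStrip M q P) (hx' : x' ∈ puncturedStrip M q P)
    (hxx : p (f x) = p (f x')) :
    x = x' ∨ ∃ n < M, x.re ∈ Ioo (n : ℝ) (n + 1) ∧ x.im = 0 ∧ n + ν n + 1 - x = x' := by
  have hq := (hf.apply_eq_iff h hx _).1 hxx
  rw [hf.apply_eq x' hx'] at hq
  rcases hx.1.2.eq_or_lt with him | him
  · lift x to ℝ using him.symm
    obtain ⟨n, hn, hre⟩ := h.exists_mem_Ioo_of_mem_puncturedStrip hx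
    rcases (h.stripMap_eq_iff hn hre him.le _).1 hq with hxx' | ⟨-, hflip⟩
    · exact Or.inl (injOn_stripMap h.pos hx.1 hx'.1 hxx')
    · exact Or.inr ⟨n, hn, hre, him.symm, injOn_stripMap h.pos
        (h.flip_mem_puncturedStrip hn hre him.symm hx).1 hx'.1 hflip⟩
  · exact Or.inl (injOn_stripMap h.pos hx.1 hx'.1 (h.eq_of_norm_lt (norm_stripMap_lt M him) hq))

end IsStripLift

end StripLift

section SideMap

variable {S E X : Type*} [TopologicalSpace S] [TopologicalSpace E] [TopologicalSpace X]
  [SimplyConnectedSpace E] {p : E → S} (hp : IsCoveringMap p) {x₀ : S} (e₀ : p ⁻¹' {x₀})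
  (ρ : LoopGroup S x₀ →* AffC) {M : ℕ} {ν : ℕ → ℕ} {V : Prop} {q : UnitDisc → X} {P : Set X}
  {ι : S → X} {f : ℂ → E} {n : ℕ} {x : ℂ}

open Classical in
/-- The affine map that the immersion of the strip agrees with near the boundary point `x`: the
identity on the first of two paired sides, and on the second side the map that equivariance of the
developing map then dictates. -/
def sideMap (ν : ℕ → ℕ) (f : ℂ → E) (x : ℂ) : AffC :=
  if h : ν ⌊x.re⌋₊ < ⌊x.re⌋₊ ∧ p (f (⌊x.re⌋₊ + ν ⌊x.re⌋₊ + 1 - x)) = p (f x) then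
    ρ (deckClass hp e₀ _ _ h.2) * AffineEquiv.constVSub ℂ (⌊x.re⌋₊ + ν ⌊x.re⌋₊ + 1 : ℂ)
  else 1

lemma floor_eq_of_mem_Ioo {t : ℝ} (ht : t ∈ Ioo (n : ℝ) (n + 1)) : ⌊t⌋₊ = n :=
  (Nat.floor_eq_iff (n.cast_nonneg.trans ht.1.le)).2 ⟨ht.1.le, ht.2⟩

lemma sideMap_of_lt (hre : x.re ∈ Ioo (n : ℝ) (n + 1)) (hn : n < ν n) :
    sideMap hp e₀ ρ ν f x = 1 := by
  rw [sideMap, dif_neg]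
  rw [floor_eq_of_mem_Ioo hre]
  exact fun h => h.1.not_gt hn

lemma sideMap_of_gt (hre : x.re ∈ Ioo (n : ℝ) (n + 1)) (hn : ν n < n) {y : ℂ}
    (hy : y = n + ν n + 1 - x) (hxy : p (f y) = p (f x)) :
    sideMap hp e₀ ρ ν f x =
      ρ (deckClass hp e₀ _ _ hxy) * AffineEquiv.constVSub ℂ (n + ν n + 1 : ℂ) := by
  subst hy
  obtain rfl := floor_eq_of_mem_Ioo hre
  rw [sideMap, dif_pos ⟨hn, hxy⟩]

lemma IsPolygonGluing.sideMap_flip (h : IsPolygonGluing M ν V q) (hn : n < M)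
    (hre : x.re ∈ Ioo (n : ℝ) (n + 1)) (hpf : p (f x) = p (f (n + ν n + 1 - x))) (z : ℂ) :
    sideMap hp e₀ ρ ν f (n + ν n + 1 - x) (n + ν n + 1 - z) =
      ρ (deckClass hp e₀ _ _ hpf) (sideMap hp e₀ ρ ν f x z) := by
  have hre' := re_flip_mem_Ioo (ν n) hre
  rcases (h.ne n hn).lt_or_gt with hlt | hlt
  · rw [sideMap_of_lt hp e₀ ρ hre' (by rwa [h.invol n hn]), sideMap_of_gt hp e₀ ρ hre hlt rfl
      hpf.symm, ← Function.comp_apply (f := ρ _), ← AffineEquiv.coe_mul, ← mul_assoc, ← map_mul,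
      deckClass_mul, deckClass_self, map_one, one_mul]
    rfl
  · rw [sideMap_of_lt hp e₀ ρ hre hlt, sideMap_of_gt hp e₀ ρ hre' (by rwa [h.invol n hn])
      (by rw [h.invol n hn]; ring) hpf, h.invol n hn, AffineEquiv.coe_mul, Function.comp_apply,
      AffineEquiv.constVSub_apply, AffineEquiv.coe_one, id_eq, vsub_eq_sub]
    ring_nf

lemma IsPuncturedPolygon.exists_forall_mem_Ioo_of_isGap (h : IsPuncturedPolygon M ν V q P ι)
    {l r : ℝ} (hlr : IsGap (cuts M q P) l r) :
    ∃ n < M, ∀ t ∈ Ioo l r, t ∈ Ioo (n : ℝ) (n + 1) ∧ (t : ℂ) ∈ puncturedStrip M q P := by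
  have hmem : ∀ t ∈ Ioo l r, (t : ℂ) ∈ puncturedStrip M q P := fun t ht =>
    h.ofReal_mem_puncturedStrip_iff.2
      ⟨⟨hlr.left_mem.1.1.trans_lt ht.1, ht.2.trans_le hlr.right_mem.1.2⟩,
        fun htc => disjoint_left.1 hlr.disjoint htc ht⟩
  have hcast : ∀ m : ℕ, m ≤ M → (m : ℝ) ∉ Ioo l r := fun m hm =>
    disjoint_left.1 hlr.disjoint (h.natCast_mem_cuts hm)
  obtain ⟨x, hx⟩ := nonempty_Ioo.2 hlr.lt
  obtain ⟨n, hn, hxn⟩ := h.exists_mem_Ioo_of_mem_puncturedStrip (hmem x hx)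
  have hl : (n : ℝ) ≤ l := by
    by_contra! hl
    exact hcast n hn.le ⟨hl, hxn.1.trans hx.2⟩
  have hr : r ≤ n + 1 := by
    by_contra! hr
    exact hcast (n + 1) hn (by push_cast; exact ⟨hx.1.trans hxn.2, hr⟩)
  exact ⟨n, hn, fun t ht => ⟨⟨hl.trans_lt ht.1, ht.2.trans_le hr⟩, hmem t ht⟩⟩

lemma IsStripLift.sideMap_eq_of_isGap (hf : IsStripLift M q P ι p f)
    (h : IsPuncturedPolygon M ν V q P ι) {l r : ℝ} (hlr : IsGap (cuts M q P) l r) {s t : ℝ}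
    (hs : s ∈ Ioo l r) (ht : t ∈ Ioo l r) :
    sideMap hp e₀ ρ ν f s = sideMap hp e₀ ρ ν f t := by
  obtain ⟨n, hn, hmem⟩ := h.exists_forall_mem_Ioo_of_isGap hlr
  rcases (h.ne n hn).lt_or_gt with hlt | hlt
  · have hflip : ∀ u : ℝ, u ∈ Ioo l r → p (f (n + ν n + 1 - u)) = p (f u) := fun u hu =>
      (hf.apply_flip h hn (hmem u hu).1 (Complex.ofReal_im u) (hmem u hu).2).symm
    rw [sideMap_of_gt hp e₀ ρ (hmem s hs).1 hlt rfl (hflip s hs),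
      sideMap_of_gt hp e₀ ρ (hmem t ht).1 hlt rfl (hflip t ht)]
    congr 2
    refine deckClass_eq_of_continuousOn hp e₀ ((convex_Ioo l r).isPathConnected ⟨s, hs⟩)
      (f := fun u : ℝ => f (n + ν n + 1 - u)) (f' := fun u : ℝ => f u) ?_ ?_ hflip hs ht
    · exact hf.continuousOn.comp (by fun_prop) fun u hu =>
        h.flip_mem_puncturedStrip hn (hmem u hu).1 (Complex.ofReal_im u) (hmem u hu).2
    · exact hf.continuousOn.comp (by fun_prop) fun u hu => (hmem u hu).2
  · rw [sideMap_of_lt hp e₀ ρ (hmem s hs).1 hlt, sideMap_of_lt hp e₀ ρ (hmem t ht).1 hlt]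

/-- `F` is a local homeomorphism in the interior of the strip and agrees with the affine map `B x`
near each point `x` of its boundary. -/
structure IsStripImmersion (M : ℕ) (q : UnitDisc → X) (P : Set X) (B : ℂ → AffC) (F : ℂ → ℂ) :
    Prop where
  interior : ∀ x : ℂ, x.re ∈ Ioo (0 : ℝ) M → 0 < x.im →
    ∃ d : OpenPartialHomeomorph ℂ ℂ, x ∈ d.source ∧ ∀ᶠ z in 𝓝 x, F z = d z
  edge : ∀ x ∈ puncturedStrip M q P, x.im = 0 → ∀ᶠ z in 𝓝 x, F z = B x z

lemma IsStripLift.exists_isStripImmersion (hf : IsStripLift M q P ι p f)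
    (h : IsPuncturedPolygon M ν V q P ι) :
    ∃ F : ℂ → ℂ, IsStripImmersion M q P (sideMap hp e₀ ρ ν f) F := by
  obtain ⟨F, hedge, hinterior⟩ := exists_immersion_halfPlane (fun t => sideMap hp e₀ ρ ν f t)
    (fun l r hlr s hs t ht => hf.sideMap_eq_of_isGap hp e₀ ρ h hlr hs ht) h.finite_cuts
  have h0 := h.natCast_mem_cuts M.zero_le
  have hM := h.natCast_mem_cuts le_rfl
  rw [Nat.cast_zero] at h0
  refine ⟨F, hinterior 0 h0 M hM, fun x hx him => ?_⟩
  lift x to ℝ using him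
  obtain ⟨hxM, hxc⟩ := h.ofReal_mem_puncturedStrip_iff.1 hx
  exact hedge 0 h0 M hM x hxM hxc

end SideMap

section Monodromy

variable {S E X : Type*} [TopologicalSpace S] [TopologicalSpace E] [TopologicalSpace X]
  [SimplyConnectedSpace E] {p : E → S} {hp : IsCoveringMap p} {x₀ : S} {e₀ : p ⁻¹' {x₀}}
  {ρ : LoopGroup S x₀ →* AffC} {M : ℕ} {ν : ℕ → ℕ} {V : Prop} {q : UnitDisc → X} {P : Set X}
  {ι : S → X} {f : ℂ → E} {F : ℂ → ℂ} {dev : E → ℂ} {n : ℕ} {x : ℂ}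

namespace IsStripLift

variable (hf : IsStripLift M q P ι p f) (h : IsPuncturedPolygon M ν V q P ι)

include hf h

lemma immersion_apply_eq (hF : IsStripImmersion M q P (sideMap hp e₀ ρ ν f) F) {x' : ℂ}
    (hx : x ∈ puncturedStrip M q P) (hx' : x' ∈ puncturedStrip M q P)
    (hxx : p (f x) = p (f x')) : F x' = ρ (deckClass hp e₀ _ _ hxx) (F x) := by
  rcases hf.eq_or_eq_flip h hx hx' hxx with rfl | ⟨n, hn, hre, him, rfl⟩
  · rw [deckClass_self, map_one, AffineEquiv.coe_one, id_eq]
  · have him' : (n + ν n + 1 - x : ℂ).im = 0 := by rw [im_flip, him, neg_zero]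
    rw [(hF.edge x hx him).self_of_nhds, (hF.edge _ hx' him').self_of_nhds,
      h.sideMap_flip hp e₀ ρ hn hre hxx]

lemma exists_forall_dev_eq (hdev : IsDeckExtension hp e₀ ρ (puncturedStrip M q P) f F dev)
    {U : Set ℂ} (hU : Convex ℝ U) (hx : x ∈ U) {γ : ℂ → E} (hγ : ContinuousOn γ U) {y : ℂ → ℂ}
    (hy : ContinuousOn y U) (hyU : MapsTo y U (strip M))
    (hyγ : ∀ w ∈ U, q (stripMap M (y w)) = ι (p (γ w))) :
    ∃ hyx : p (f (y x)) = p (γ x),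
      ∀ w ∈ U, dev (γ w) = ρ (deckClass hp e₀ _ _ hyx) (F (y w)) := by
  have hyU' : MapsTo y U (puncturedStrip M q P) := fun w hw =>
    ⟨hyU hw, (hyγ w hw).symm ▸ h.apply_notMem _⟩
  have hpy : ∀ w ∈ U, p (f (y w)) = p (γ w) := fun w hw =>
    (hf.apply_eq_iff h (hyU' hw) _).2 (hyγ w hw)
  exact ⟨hpy x hx, fun w hw => hdev.apply_eq_of_continuousOn (hU.isPathConnected ⟨x, hx⟩) hγ
    (hf.continuousOn.comp hy hyU') hyU' hpy hw hx⟩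

variable (hdev : IsDeckExtension hp e₀ ρ (puncturedStrip M q P) f F dev)

include hdev

lemma exists_eventually_dev_eq_of_im_pos {γ : OpenPartialHomeomorph ℂ E} (hx : x ∈ γ.source)
    (hγ : ∀ w ∈ γ.source, (w.re ∈ Ioo (0 : ℝ) M ∧ 0 < w.im) ∧ q (stripMap M w) = ι (p (γ w))) :
    ∃ A : AffC, ∀ᶠ w in 𝓝 x, dev (γ w) = A (F w) := by
  obtain ⟨ε, hε, hεγ⟩ := Metric.nhds_basis_ball.mem_iff.1 (γ.open_source.mem_nhds hx)
  obtain ⟨_, hdevγ⟩ := hf.exists_forall_dev_eq h hdev (convex_ball x ε) (Metric.mem_ball_self hε)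
    (γ.continuousOn.mono hεγ) continuousOn_id (fun w hw => ⟨(hγ w (hεγ hw)).1.1,
      (hγ w (hεγ hw)).1.2.le⟩) fun w hw => (hγ w (hεγ hw)).2
  exact ⟨_, Filter.eventually_of_mem (Metric.ball_mem_nhds x hε) hdevγ⟩

lemma exists_eventually_dev_eq_of_im_eq_zero
    (hF : IsStripImmersion M q P (sideMap hp e₀ ρ ν f) F) (hn : n < M)
    (hxP : x ∈ puncturedStrip M q P) (him : x.im = 0)
    {γ : OpenPartialHomeomorph ℂ E} (hx : x ∈ γ.source)
    (hγ : ∀ w ∈ γ.source, w.re ∈ Ioo (n : ℝ) (n + 1) ∧ edgeMap M ν q n w = ι (p (γ w))) :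
    ∃ A : AffC, ∀ᶠ w in 𝓝 x, dev (γ w) = A w := by
  obtain ⟨ε, hε, hεγ⟩ := Metric.nhds_basis_ball.mem_iff.1 (γ.open_source.mem_nhds hx)
  have hball := Metric.mem_ball_self (x := x) hε
  have hre := (hγ x hx).1
  obtain ⟨hpx, hupper⟩ := hf.exists_forall_dev_eq h hdev (y := fun w => w)
    ((convex_ball x ε).inter (convex_halfSpace_im_ge 0)) ⟨hball, him.ge⟩
    (γ.continuousOn.mono (inter_subset_left.trans hεγ)) continuousOn_id
    (fun w hw => mem_strip_of_mem_Ioo hn (hγ w (hεγ hw.1)).1 hw.2)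
    fun w hw => (if_pos hw.2).symm.trans (hγ w (hεγ hw.1)).2
  obtain ⟨hpx', hlower⟩ := hf.exists_forall_dev_eq h hdev (y := fun w => n + ν n + 1 - w)
    ((convex_ball x ε).inter (convex_halfSpace_im_le 0)) ⟨hball, him.le⟩
    (γ.continuousOn.mono (inter_subset_left.trans hεγ)) (by fun_prop)
    (fun w hw => mem_strip_of_mem_Ioo (h.lt n hn) (re_flip_mem_Ioo (ν n) (hγ w (hεγ hw.1)).1)
      (by rw [im_flip]; exact neg_nonneg.2 hw.2))
    fun w hw => (h.edgeMap_of_im_nonpos hn (hγ w (hεγ hw.1)).1 hw.2).symm.trans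
      (hγ w (hεγ hw.1)).2
  have hflip : Filter.Tendsto (fun w : ℂ => n + ν n + 1 - w) (𝓝 x) (𝓝 (n + ν n + 1 - x)) :=
    (continuous_const.sub continuous_id).tendsto x
  have hxx := hf.apply_flip h hn hre him hxP
  refine ⟨ρ (deckClass hp e₀ _ _ hpx) * sideMap hp e₀ ρ ν f x, ?_⟩
  filter_upwards [Metric.ball_mem_nhds x hε, hF.edge x hxP him, hflip.eventually (hF.edge _
    (h.flip_mem_puncturedStrip hn hre him hxP) (by rw [im_flip, him, neg_zero]))]
    with w hw hFw hFw'
  rcases le_total 0 w.im with hw0 | hw0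
  · exact (hupper w ⟨hw, hw0⟩).trans (congrArg _ hFw)
  · rw [hlower w ⟨hw, hw0⟩, hFw', h.sideMap_flip hp e₀ ρ hn hre hxx,
      ← deckClass_mul hp e₀ hxx hpx', map_mul]
    rfl

lemma isLocalHomeomorph_dev (hF : IsStripImmersion M q P (sideMap hp e₀ ρ ν f) F) :
    IsLocalHomeomorph dev := by
  have hΦ : IsLocalHomeomorph (ι ∘ p) :=
    h.isOpenEmbedding.isLocalHomeomorph.comp hp.isLocalHomeomorph
  refine IsLocalHomeomorph.mk _ fun e => ?_
  obtain ⟨x, hx, hxe⟩ := h.exists_apply_stripMap_eq (p e)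
  rcases hx.1.2.eq_or_lt with him | him
  · obtain ⟨n, hn, hre⟩ : ∃ n < M, x.re ∈ Ioo (n : ℝ) (n + 1) := by
      lift x to ℝ using him.symm
      exact h.exists_mem_Ioo_of_mem_puncturedStrip hx
    obtain ⟨d, hd, hdq⟩ := h.exists_openPartialHomeomorph_edge hn
    obtain ⟨γ, hxγ, rfl, hγd, hγ⟩ := exists_openPartialHomeomorph_lift hΦ d
      (hd.symm ▸ hre : x ∈ d.source) (by rw [hdq, edgeMap, if_pos him.le]; exact hxe.symm)
    rw [hd] at hγd
    rw [hdq] at hγ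
    obtain ⟨A, hA⟩ := hf.exists_eventually_dev_eq_of_im_eq_zero h hdev hF hn hx him.symm hxγ
      fun w hw => ⟨hγd hw, (hγ w hw).symm⟩
    exact exists_openPartialHomeomorph_eqOn γ
      A.toContinuousAffineEquiv.toHomeomorph.toOpenPartialHomeomorph hxγ (mem_univ x) hA
  · obtain ⟨d, hd, hdq⟩ := h.exists_openPartialHomeomorph_interior
    obtain ⟨γ, hxγ, rfl, hγd, hγ⟩ := exists_openPartialHomeomorph_lift hΦ d
      (hd.symm ▸ ⟨hx.1.1, him⟩ : x ∈ d.source) (by rw [hdq]; exact hxe.symm)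
    rw [hd] at hγd
    rw [hdq] at hγ
    obtain ⟨A, hA⟩ := hf.exists_eventually_dev_eq_of_im_pos h hdev hxγ
      fun w hw => ⟨hγd hw, (hγ w hw).symm⟩
    obtain ⟨d', hxd', hFd'⟩ := hF.interior x hx.1.1 him
    refine exists_openPartialHomeomorph_eqOn γ
      (d'.transHomeomorph A.toContinuousAffineEquiv.toHomeomorph) hxγ hxd' ?_
    filter_upwards [hA, hFd'] with w hw hFw
    exact hw.trans (congrArg A hFw)

end IsStripLift

lemma IsPuncturedPolygon.exists_isMonodromy (h : IsPuncturedPolygon M ν V q P ι)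
    (hp : IsCoveringMap p) (e₀ : p ⁻¹' {x₀}) (ρ : LoopGroup S x₀ →* AffC) :
    ∃ σ : ComplexAffineStructure S, IsMonodromy hp e₀ σ ρ := by
  obtain ⟨f, hf⟩ := h.exists_isStripLift hp e₀
  obtain ⟨F, hF⟩ := hf.exists_isStripImmersion hp e₀ ρ h
  obtain ⟨dev, hdev⟩ := exists_isDeckExtension hp e₀ (hf.exists_apply_eq h) ρ
    fun x hx x' hx' hxx => hf.immersion_apply_eq h hF hx hx' hxx
  have hsurj : Function.Surjective p := fun s =>
    let ⟨x, _, hx⟩ := hf.exists_apply_eq h s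
    ⟨f x, hx⟩
  exact ⟨_, isMonodromy_developedStructure hp hsurj e₀ (hf.isLocalHomeomorph_dev h hdev hF)
    (hdev.isDeckEquivariant (hf.exists_apply_eq h))⟩

end Monodromy

end

theorem theoremB_general (g k : ℕ) (hk : 1 ≤ k) (hχ : (2 : ℤ) - 2 * g - k ≤ 0)
    {S : Type*} [TopologicalSpace S] (hS : IsPuncturedSurface g k S)
    {E : Type*} [TopologicalSpace E] [SimplyConnectedSpace E] {p : E → S}
    (hp : IsCoveringMap p) (x₀ : S) (e₀ : p ⁻¹' {x₀}) (ρ : LoopGroup S x₀ →* AffC) :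
    ∃ σ : ComplexAffineStructure S, IsMonodromy hp e₀ σ ρ := by
  obtain ⟨P, hP, ⟨φ⟩⟩ := hS
  obtain ⟨M, ν, V, q, h, hch, hvert⟩ := exists_isPolygonGluing g
  have hk' : (if g = 0 then 2 else 1 : ℕ∞) ≤ k := by
    split_ifs
    · exact_mod_cast (by lia : 2 ≤ k)
    · exact_mod_cast hk
  obtain ⟨P', ι, h'⟩ := h.exists_isPuncturedPolygon hch (finite_of_encard_eq_coe hP)
    (hvert.trans (hk'.trans hP.ge)) φ
  exact h'.exists_isMonodromy hp e₀ ρ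

theorem theoremB (g k : ℕ) (hk : 2 ≤ k) (hχ : (2 : ℤ) - 2 * g - k < 0)
    {S : Type*} [TopologicalSpace S] (hS : IsPuncturedSurface g k S)
    {E : Type*} [TopologicalSpace E] [SimplyConnectedSpace E] {p : E → S}
    (hp : IsCoveringMap p) (x₀ : S) (e₀ : p ⁻¹' {x₀}) :
    (∀ ρ : LoopGroup S x₀ →* AffC, ρ ≠ 1 →
      ∃ σ : ComplexAffineStructure S, IsMonodromy hp e₀ σ ρ) ∧
    (3 ≤ k → ∀ ρ : LoopGroup S x₀ →* AffC,
      ∃ σ : ComplexAffineStructure S, IsMonodromy hp e₀ σ ρ) := by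
  have key := theoremB_general g k (by lia) hχ.le hS hp x₀ e₀
  exact ⟨fun ρ _ => key ρ, fun _ => key⟩
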